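/- A \emph{coordination game} is given by a finite directed graph $G=(V,E)$ without self-loops, a finite set $M$ of colours and, for every node $i\in V$, a non-empty set $A(i)\subseteq M$. The players are the nodes, player $i$ chooses a colour $s_i\in A(i)$, and the payoff of $i$ is $p_i(s)=|\{j\in N_i : s_j=s_i\}|$, where $N_i=\{j : (j\to i)\in E\}$ is the set of neighbours of $i$. A joint strategy $s$ is a \emph{strong equilibrium} if there are no joint strategy $s'$ and non-empty set $K$ of players such that $K=\{i : s_i\neq s'_i\}$ and $p_i(s')>p_i(s)$ for all $i\in K$. \textbf{Corollary.} A strong equilibrium of a coordination game on a graph in which all strongly connected components are simple cycles can be computed in linear time. Here each strongly connected component is either a single node or induces a directed simple cycle on at least two nodes, with no further edges among its nodes. Precisely: there are constants $c,k$ and a single program for a unit-cost random access machine (finitely many registers and arrays, initially zero outside the input; operations: constants, copying, addition, truncated subtraction, comparison, indirect load and store) such that for every such game with $V=\{0,\dots,n-1\}$ and $M=\{0,\dots,C-1\}$, given as the sequence consisting of $n$, $C$ and, for each node $i$ in turn, the length-prefixed lists (in arbitrary order, without repetition) of the elements of $N_i$ and of $A(i)$, a sequence of $L=2+\sum_i(2+|N_i|+|A(i)|)$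 numbers, the program halts after at most $cL$ steps, having produced only numbers that are at most $k(L+C)$ (i.e. working with words of $O(\log(L+C))$ bits), and outputs a strong equilibrium of the game. -/

import Mathlib

/-! ### Strategic games and strong equilibria -/

/-- A strategic game with set of players `N`: every player has a non-empty set of strategies and
a real payoff function on the joint strategies. -/
structure StrategicGame (N : Type) where
  /-- the strategies of each player -/
  Strategy : N → Type
  nonempty : ∀ i, Nonempty (Strategy i)
  /-- the payoff functions -/
  payoff : N → (∀ i, Strategy i) → ℝ

namespace StrategicGame

variable {N : Type}

/-- Joint strategies. -/
abbrev JointStrategy (𝒢 : StrategicGame N) : Type := ∀ i, 𝒢.Strategy i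

/-- `s'` is a deviation of the players in `K` from `s`: `K` is exactly the set of the players
whose strategy changes. -/
def IsDeviation (𝒢 : StrategicGame N) (K : Finset N) (s s' : 𝒢.JointStrategy) : Prop :=
  ∀ i, i ∈ K ↔ s i ≠ s' i

/-- The players in `K` can profitably deviate from `s`. -/
def CanProfitablyDeviate (𝒢 : StrategicGame N) (K : Finset N) (s : 𝒢.JointStrategy) : Prop :=
  ∃ s' : 𝒢.JointStrategy, 𝒢.IsDeviation K s s' ∧ ∀ i ∈ K, 𝒢.payoff i s < 𝒢.payoff i s'

/-- `k`-equilibrium: no coalition (non-empty set of players) of at most `k` players can profitably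
deviate. -/
def IsKEquilibrium (𝒢 : StrategicGame N) (k : ℕ) (s : 𝒢.JointStrategy) : Prop :=
  ∀ K : Finset N, K.Nonempty → K.card ≤ k → ¬ 𝒢.CanProfitablyDeviate K s

/-- Strong equilibrium: an `n`-equilibrium, where `n` is the number of players. -/
def IsStrongEquilibrium [Fintype N] (𝒢 : StrategicGame N) (s : 𝒢.JointStrategy) : Prop :=
  𝒢.IsKEquilibrium (Fintype.card N) s

end StrategicGame

/-! ### Directed graphs whose strongly connected components are simple cycles -/

namespace Digraph

variable {V : Type}

/-- The strongly connected components: the classes of mutual reachability. -/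
def IsSCC (G : Digraph V) (X : Set V) : Prop :=
  ∃ i, X = {j | Relation.ReflTransGen G.Adj i j ∧ Relation.ReflTransGen G.Adj j i}

/-- The subgraph induced by `X` is a simple cycle `v 0 → v 1 → ⋯ → v (m + 1) → v 0` on
`m + 2 ≥ 2` distinct nodes (the addition in `Fin (m + 2)` is modulo `m + 2`), with no
further edges. -/
def InducesSimpleCycle (G : Digraph V) (X : Set V) : Prop :=
  ∃ (m : ℕ) (v : Fin (m + 2) → V), Function.Injective v ∧ Set.range v = X ∧
    ∀ a b, G.Adj (v a) (v b) ↔ b = a + 1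

/-- Every strongly connected component is a simple cycle; as usual, a component that consists of a
single node is allowed. -/
def SCCsAreSimpleCycles (G : Digraph V) : Prop :=
  ∀ X : Set V, G.IsSCC X → (∃ i, X = {i}) ∨ G.InducesSimpleCycle X

end Digraph

/-! ### Coordination games -/

/-- The data of an (unweighted) coordination game: a directed graph on `V` without self-loops and
an assignment of a non-empty set of colours from `M` to every node. -/
structure CoordinationGame (V M : Type) where
  /-- the underlying directed graph -/
  graph : Digraph V
  loopless : ∀ i, ¬ graph.Adj i i
  /-- the colours available to each node -/
  colours : V → Finset M
  colours_nonempty : ∀ i, (colours i).Nonempty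

namespace CoordinationGame

variable {V M : Type}

/-- The players are the nodes, the strategies of `i` are its colours, and the payoff of `i` is the
number of nodes `j` with an edge `j → i` that choose the same colour as `i`. -/
noncomputable def toStrategicGame [Fintype V] (G : CoordinationGame V M) : StrategicGame V where
  Strategy i := {c : M // c ∈ G.colours i}
  nonempty i := let ⟨c, hc⟩ := G.colours_nonempty i; ⟨⟨c, hc⟩⟩
  payoff i s := ({j : V | G.graph.Adj j i ∧ (s j : M) = (s i : M)}.ncard : ℝ)

/-- `nbrs` and `cols` are a list representation of the game: `nbrs i` lists, in any order and
without repetition, the neighbours of `i` (the nodes `j` with an edge `j → i`), and `cols i` lists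
the colours available to `i`. -/
structure IsRepresentedBy {n C : ℕ} (G : CoordinationGame (Fin n) (Fin C))
    (nbrs : Fin n → List (Fin n)) (cols : Fin n → List (Fin C)) : Prop where
  nbrs_nodup : ∀ i, (nbrs i).Nodup
  mem_nbrs : ∀ i j, j ∈ nbrs i ↔ G.graph.Adj j i
  cols_nodup : ∀ i, (cols i).Nodup
  mem_cols : ∀ i c, c ∈ cols i ↔ c ∈ G.colours i

end CoordinationGame

/-- A list of numbers as a list of words, preceded by its length. -/
def encodeList {m : ℕ} (l : List (Fin m)) : List ℕ :=
  l.length :: l.map (fun x => (x : ℕ))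

/-- The input: the number of nodes, the number of colours, and then for each node in turn the list
of its neighbours and the list of its colours, both preceded by their lengths. Its length is
`2 + ∑ i, (2 + |N_i| + |A(i)|)`. -/
def encodeGame {n C : ℕ} (nbrs : Fin n → List (Fin n)) (cols : Fin n → List (Fin C)) : List ℕ :=
  n :: C :: (List.ofFn fun i => encodeList (nbrs i) ++ encodeList (cols i)).flatten

/-! ### Random access machines

Unit-cost random access machines with bounded word size. A program uses finitely many registers
and finitely many arrays, addresses an array through a register, and has addition, truncated
subtraction and comparison of words as its only operations. -/

namespace WordRAM

/-- RAM programs; `x`, `y`, `z` are names of registers and `a` is the name of an array. -/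
inductive Program : Type
  /-- do nothing -/
  | skip : Program
  /-- `x := v` -/
  | setConst (x v : ℕ) : Program
  /-- `x := y` -/
  | move (x y : ℕ) : Program
  /-- `x := y + z` -/
  | plus (x y z : ℕ) : Program
  /-- `x := max (y - z) 0` -/
  | minus (x y z : ℕ) : Program
  /-- `x := a[y]` -/
  | load (x a y : ℕ) : Program
  /-- `a[x] := y` -/
  | store (a x y : ℕ) : Program
  /-- `p; q` -/
  | seq (p q : Program) : Program
  /-- `if x < y then p else q` -/
  | ifLt (x y : ℕ) (p q : Program) : Program
  /-- `while x < y do p` -/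
  | whileLt (x y : ℕ) (p : Program) : Program

/-- A memory state. -/
@[ext]
structure State where
  /-- the contents of the registers -/
  reg : ℕ → ℕ
  /-- the contents of the arrays; `mem a i` is the cell with index `i` of the array `a` -/
  mem : ℕ → ℕ → ℕ

/-- Write to a register. -/
def State.setReg (σ : State) (x v : ℕ) : State :=
  { σ with reg := Function.update σ.reg x v }

/-- Write to a memory cell. -/
def State.setMem (σ : State) (a i v : ℕ) : State :=
  { σ with mem := Function.update σ.mem a (Function.update (σ.mem a) i v) }

/-- At the start the input words are in array `0`; all else is `0`. -/
def State.init (input : List ℕ) : State where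
  reg _ := 0
  mem a i := if a = 0 then input.getD i 0 else 0

/-- `Run W p σ t τ`: started in `σ`, the program `p` halts in the state `τ` after exactly `t` steps,
and every number that it produces on the way is at most `W`. Each elementary instruction and each
test takes one step. -/
inductive Run (W : ℕ) : Program → State → ℕ → State → Prop
  | skip (σ : State) : Run W .skip σ 1 σ
  | setConst (σ : State) (x v : ℕ) (h : v ≤ W) : Run W (.setConst x v) σ 1 (σ.setReg x v)
  | move (σ : State) (x y : ℕ) : Run W (.move x y) σ 1 (σ.setReg x (σ.reg y))
  | plus (σ : State) (x y z : ℕ) (h : σ.reg y + σ.reg z ≤ W) :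
      Run W (.plus x y z) σ 1 (σ.setReg x (σ.reg y + σ.reg z))
  | minus (σ : State) (x y z : ℕ) : Run W (.minus x y z) σ 1 (σ.setReg x (σ.reg y - σ.reg z))
  | load (σ : State) (x a y : ℕ) : Run W (.load x a y) σ 1 (σ.setReg x (σ.mem a (σ.reg y)))
  | store (σ : State) (a x y : ℕ) : Run W (.store a x y) σ 1 (σ.setMem a (σ.reg x) (σ.reg y))
  | seq {p q : Program} {σ τ υ : State} {t u : ℕ} (h₁ : Run W p σ t τ) (h₂ : Run W q τ u υ) :
      Run W (.seq p q) σ (t + u) υ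
  | ifTrue {x y : ℕ} {p q : Program} {σ τ : State} {t : ℕ} (h : σ.reg x < σ.reg y)
      (h₁ : Run W p σ t τ) : Run W (.ifLt x y p q) σ (t + 1) τ
  | ifFalse {x y : ℕ} {p q : Program} {σ τ : State} {t : ℕ} (h : ¬ σ.reg x < σ.reg y)
      (h₁ : Run W q σ t τ) : Run W (.ifLt x y p q) σ (t + 1) τ
  | whileTrue {x y : ℕ} {p : Program} {σ τ υ : State} {t u : ℕ} (h : σ.reg x < σ.reg y)
      (h₁ : Run W p σ t τ) (h₂ : Run W (.whileLt x y p) τ u υ) :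
      Run W (.whileLt x y p) σ (t + 1 + u) υ
  | whileFalse {x y : ℕ} {p : Program} {σ : State} (h : ¬ σ.reg x < σ.reg y) :
      Run W (.whileLt x y p) σ 1 σ

end WordRAM

/-! A payoff depends only on the colours of in-neighbours, so the components can be coloured one at
a time, each after all those from which edges lead into it. Once a set of nodes closed under
in-neighbours carries a strong equilibrium of its own subgame, every coalition that touches it
contains a member of it that does not gain. It remains to colour one new component against fixed
colours outside.

Let the weight of a colour at a node be the number of its already coloured in-neighbours with this
colour; on a cycle there is a bonus of 1 for agreeing with the predecessor. Suppose that every node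
has a colour of maximal weight, that it agrees with its predecessor whenever the predecessor's
colour has maximal weight for it, and that the cycle is monochromatic if some colour has maximal
weight for all its nodes. A node that gains by deviating must win the bonus with another colour of
maximal weight, and by the second condition its predecessor must deviate too. So the whole cycle
deviates, to a single colour of maximal weight everywhere; by the third condition all bonuses were
already collected, and nobody gains. This is `Stable.extend`.

Such a colouring arises as follows: every node picks a colour of maximal weight, the root picks one
common to all nodes if there is any, and then one walks twice around the cycle, each node copying
its predecessor's colour if it has maximal weight for it. One round settles a common colour
(`sweep_common`); in general two rounds suffice (`sweep_nash`).

The components are found by a depth-first search against the edges, so that a component is left only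
after everything it depends on. Since a node has at most one in-neighbour in its own component, no
stack of components is needed: meeting an active node again closes a cycle, which is the tree path
between the two nodes (`Search.Inv`, with `back`, `retreat` and `finish`).

The rest is a verified program. The predicate `wp` tracks final state and running time, `potential`
pays for the search, and common best colours are recognized by increasing stamps, which never have
to be cleared (`wp_procNode`, `wp_comp`, `wp_searchAll`, `wp_solve`). The passage back to games is
`isCyclic_toLists` and `isStrongEquilibrium_of_stable`. -/

namespace SCCAlg

/-! ### Stable partial colourings and their extension by one component. -/

/-- The number of neighbours of `y` that choose the same colour as `y`. -/
def payoff (N : ℕ → List ℕ) (s : ℕ → ℕ) (y : ℕ) : ℕ :=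
  (N y).countP (fun u => decide (s u = s y))

/-- The number of neighbours of `y` with status `2` that choose the colour `c`. -/
def weight (N : ℕ → List ℕ) (st s : ℕ → ℕ) (y c : ℕ) : ℕ :=
  (N y).countP (fun u => decide (st u = 2 ∧ s u = c))

/-- The colour `c` is a best choice for `y` against the nodes with status `2`. -/
def Best (N A : ℕ → List ℕ) (st s : ℕ → ℕ) (y c : ℕ) : Prop :=
  c ∈ A y ∧ ∀ c' ∈ A y, weight N st s y c' ≤ weight N st s y c

/-- `s` is a strong equilibrium of the game restricted to the nodes with status `2`. -/
def Stable (N A : ℕ → List ℕ) (st s : ℕ → ℕ) : Prop :=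
  (∀ x, st x = 2 → s x ∈ A x) ∧
  ∀ s' : ℕ → ℕ, (∀ x, st x = 2 → s' x ∈ A x) → (∃ x, st x = 2 ∧ s' x ≠ s x) →
    ∃ x, st x = 2 ∧ s' x ≠ s x ∧ payoff N s' x ≤ payoff N s x

/-- Payoff as weight plus bonus: `z` is the only possible unfinished entry, and without repetition
it contributes at most 1. -/
theorem countP_split {l : List ℕ} (hl : l.Nodup) (st q : ℕ → ℕ) (z c : ℕ) (hz : st z ≠ 2)
    (h : ∀ u ∈ l, st u = 2 ∨ u = z) :
    l.countP (fun u => decide (q u = c)) =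
      l.countP (fun u => decide (st u = 2 ∧ q u = c)) + if z ∈ l ∧ q z = c then 1 else 0 := by
  induction l with
  | nil => simp
  | cons a l ih =>
    rw [List.nodup_cons] at hl
    have ih := ih hl.2 (fun u hu => h u (List.mem_cons_of_mem _ hu))
    rw [List.countP_cons, List.countP_cons, ih]
    rcases h a List.mem_cons_self with ha | rfl
    · have : a ≠ z := by rintro rfl; exact hz ha
      simp [ha, this.symm]; omega
    · simp [hz, hl.1]

theorem payoff_congr {N : ℕ → List ℕ} {s s' : ℕ → ℕ} {y : ℕ} (hy : s y = s' y)
    (h : ∀ u ∈ N y, s u = s' u) : payoff N s y = payoff N s' y := by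
  apply List.countP_congr
  intro u hu
  simp [h u hu, hy]

theorem weight_congr {N : ℕ → List ℕ} {st s s' : ℕ → ℕ} {y c : ℕ}
    (h : ∀ u, st u = 2 → s u = s' u) : weight N st s y c = weight N st s' y c := by
  apply List.countP_congr
  intro u _
  by_cases hu : st u = 2
  · simp [h u hu]
  · simp [hu]

/-- The new component is unrolled into a sequence `Y` of period `k`, which avoids arithmetic modulo
`k` and covers a single node as the case `k = 1`. The last three hypotheses are the three conditions
under which a coalition of the component cannot gain. -/
theorem Stable.extend {N A : ℕ → List ℕ} {st st' s s' : ℕ → ℕ} (h : Stable N A st s)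
    (hnd : ∀ x, (N x).Nodup) (hcl : ∀ x, st x = 2 → ∀ u ∈ N x, st u = 2)
    {Y : ℕ → ℕ} {k : ℕ} (hk : 0 < k) (hper : ∀ i, Y (i + k) = Y i)
    (hnew : ∀ i, st (Y i) ≠ 2) (hN : ∀ i, ∀ u ∈ N (Y (i + 1)), st u = 2 ∨ u = Y i)
    (hst : ∀ x, st' x = 2 ↔ st x = 2 ∨ ∃ i, x = Y i)
    (hs : ∀ x, st x = 2 → s' x = s x)
    (hbest : ∀ i, Best N A st s (Y i) (s' (Y i)))
    (hNE : ∀ i, Best N A st s (Y (i + 1)) (s' (Y i)) → s' (Y (i + 1)) = s' (Y i))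
    (hcom : ∀ c, (∀ i, Best N A st s (Y i) c) → ∀ i, s' (Y (i + 1)) = s' (Y i)) :
    Stable N A st' s' := by
  refine ⟨fun x hx => ?_, fun t ht hdev => ?_⟩
  · rcases (hst x).1 hx with hx | ⟨i, rfl⟩
    · rw [hs x hx]; exact h.1 x hx
    · exact (hbest i).1
  by_cases hD : ∃ x, st x = 2 ∧ t x ≠ s x
  · obtain ⟨x, hx, hne, hp⟩ := h.2 t (fun x hx => ht x ((hst x).2 (Or.inl hx))) hD
    refine ⟨x, (hst x).2 (Or.inl hx), by rwa [hs x hx], hp.trans (le_of_eq ?_)⟩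
    exact payoff_congr (hs x hx).symm (fun u hu => (hs u (hcl x hx u hu)).symm)
  push Not at hD
  by_contra hno
  push Not at hno
  have hw' : ∀ y c, weight N st s' y c = weight N st s y c := fun y c => weight_congr hs
  have hw : ∀ y c, weight N st t y c = weight N st s y c := fun y c => weight_congr hD
  have hform : ∀ q : ℕ → ℕ, ∀ i, payoff N q (Y (i + 1)) =
      weight N st q (Y (i + 1)) (q (Y (i + 1))) +
        if Y i ∈ N (Y (i + 1)) ∧ q (Y i) = q (Y (i + 1)) then 1 else 0 := fun q i =>
    countP_split (hnd _) st q (Y i) _ (hnew i) (hN i)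
  have hmem : ∀ i, st' (Y i) = 2 := fun i => (hst _).2 (Or.inr ⟨i, rfl⟩)
  -- The old weight is maximal, so a gain can come only from the bonus, and the new colour must have
  -- maximal weight as well. Had the predecessor kept its colour, `hNE` would have given the bonus
  -- already.
  have step : ∀ i, t (Y (i + 1)) ≠ s' (Y (i + 1)) →
      t (Y i) ≠ s' (Y i) ∧ t (Y i) = t (Y (i + 1)) ∧ Best N A st s (Y (i + 1)) (t (Y (i + 1))) ∧
        s' (Y (i + 1)) ≠ s' (Y i) := by
    intro i hi
    have hgain := hno _ (hmem (i + 1)) hi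
    rw [hform, hform, hw, hw'] at hgain
    have hle := (hbest (i + 1)).2 _ (ht _ (hmem (i + 1)))
    have h1 : Y i ∈ N (Y (i + 1)) ∧ t (Y i) = t (Y (i + 1)) := by
      by_contra hc
      rw [if_neg hc] at hgain
      omega
    have h2 : s' (Y i) ≠ s' (Y (i + 1)) := by
      intro hc
      rw [if_pos h1, if_pos ⟨h1.1, hc⟩] at hgain
      omega
    rw [if_pos h1, if_neg (fun hc => h2 hc.2)] at hgain
    have hB : Best N A st s (Y (i + 1)) (t (Y (i + 1))) :=
      ⟨ht _ (hmem _), fun c' hc' => ((hbest (i + 1)).2 c' hc').trans (by omega)⟩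
    refine ⟨fun hc => ?_, h1.2, hB, h2.symm⟩
    rw [← h1.2, hc] at hB
    exact h2 (hNE i hB).symm
  obtain ⟨x, hx, hxne⟩ := hdev
  obtain ⟨i₀, rfl⟩ : ∃ i, x = Y i := by
    rcases (hst x).1 hx with hx' | hx'
    · exact absurd ((hD x hx').trans (hs x hx').symm) hxne
    · exact hx'
  have hdown : ∀ m j, t (Y (j + m)) ≠ s' (Y (j + m)) → t (Y j) ≠ s' (Y j) := by
    intro m
    induction m with
    | zero => exact fun j hj => hj
    | succ m ih => exact fun j hj => ih j (step (j + m) hj).1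
  have hpers : ∀ m i, Y (i + m * k) = Y i := by
    intro m
    induction m with
    | zero => simp
    | succ m ih => intro i; rw [Nat.succ_mul, ← add_assoc, hper, ih]
  have hall : ∀ j, t (Y j) ≠ s' (Y j) := by
    intro j
    -- The deviating node also has the index `i₀ + j * k`, which is at least `j`; deviation is
    -- inherited by smaller indices.
    have hj : j ≤ i₀ + j * k := by nlinarith
    obtain ⟨m, hm⟩ := Nat.exists_eq_add_of_le hj
    apply hdown m j
    rw [← hm, hpers]
    exact hxne
  have hconst : ∀ i, t (Y i) = t (Y 0) := by
    intro i
    induction i with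
    | zero => rfl
    | succ i ih => rw [← (step i (hall _)).2.1, ih]
  -- The colour to which everybody moves is best for all, so `hcom` says that neighbours on the
  -- cycle already agreed, against `step`.
  refine (step 0 (hall _)).2.2.2 (hcom (t (Y 0)) (fun i => ?_) 0)
  have hi : Y i = Y ((i + k - 1) + 1) := by rw [show i + k - 1 + 1 = i + k by omega, hper]
  rw [← hconst i, hi]
  exact (step _ (hall _)).2.2.1

/-! ### Two rounds of copying around a cycle -/

open Classical in
/-- The colouring after `j` steps along `Y`; each step copies the colour of the predecessor if this
is a permitted choice. -/
noncomputable def sweep (B : ℕ → ℕ → Prop) (Y : ℕ → ℕ) (s : ℕ → ℕ) : ℕ → ℕ → ℕ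
  | 0 => s
  | j + 1 => if B (Y (j + 1)) (sweep B Y s j (Y j)) then
      Function.update (sweep B Y s j) (Y (j + 1)) (sweep B Y s j (Y j)) else sweep B Y s j

section Sweep

variable {B : ℕ → ℕ → Prop} {Y : ℕ → ℕ} {s : ℕ → ℕ}

theorem sweep_succ_ne {j x : ℕ} (hx : x ≠ Y (j + 1)) :
    sweep B Y s (j + 1) x = sweep B Y s j x := by
  rw [sweep]; split_ifs <;> simp [hx]

theorem sweep_succ_copy {j : ℕ} (h : B (Y (j + 1)) (sweep B Y s j (Y j))) :
    sweep B Y s (j + 1) (Y (j + 1)) = sweep B Y s j (Y j) := by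
  rw [sweep, if_pos h]; simp

theorem sweep_succ_keep {j : ℕ} (h : ¬ B (Y (j + 1)) (sweep B Y s j (Y j))) :
    sweep B Y s (j + 1) (Y (j + 1)) = sweep B Y s j (Y (j + 1)) := by
  rw [sweep, if_neg h]

theorem sweep_of_ne {j x : ℕ} (hx : ∀ i, x ≠ Y i) : sweep B Y s j x = s x := by
  induction j with
  | zero => rfl
  | succ j ih => rw [sweep_succ_ne (hx _), ih]

theorem sweep_best (h : ∀ i, B (Y i) (s (Y i))) (j : ℕ) :
    ∀ i, B (Y i) (sweep B Y s j (Y i)) := by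
  induction j with
  | zero => exact h
  | succ j ih =>
    intro i
    by_cases hi : Y i = Y (j + 1)
    · rw [hi]
      by_cases hc : B (Y (j + 1)) (sweep B Y s j (Y j))
      · rwa [sweep_succ_copy hc]
      · rw [sweep_succ_keep hc]; exact ih _
    · rw [sweep_succ_ne hi]; exact ih i

theorem sweep_common (h : ∀ i, B (Y i) (s (Y 0))) (j : ℕ) :
    ∀ i ≤ j, sweep B Y s j (Y i) = s (Y 0) := by
  induction j with
  | zero => intro i hi; rw [Nat.le_zero.1 hi]; rfl
  | succ j ih =>
    have hc : sweep B Y s (j + 1) (Y (j + 1)) = s (Y 0) := by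
      rw [sweep_succ_copy, ih j le_rfl]
      rw [ih j le_rfl]; exact h _
    intro i hi
    by_cases hY : Y i = Y (j + 1)
    · rw [hY, hc]
    · rw [sweep_succ_ne hY]
      exact ih i (by rcases Nat.lt_or_eq_of_le hi with hi | rfl; · omega
                     · exact absurd rfl hY)

variable {k : ℕ}

/-- The node `Y i` is next touched at step `i + k`. -/
theorem sweep_last (hinj : ∀ i j, i < j → j < i + k → Y i ≠ Y j) (i m : ℕ) (hm : m < k) :
    sweep B Y s (i + m) (Y i) = sweep B Y s i (Y i) := by
  induction m with
  | zero => rfl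
  | succ m ih =>
    rw [← add_assoc, sweep_succ_ne (hinj i _ (by omega) (by omega)), ih (by omega)]

/-- With `c j` the colour of `Y j` right after step `j`, each link inside the second round is
correct by construction. The only doubtful link leads from the last node of that round to its first,
and it is correct because the colour of `Y 0` does not change in the second round. -/
theorem sweep_nash (hk : 0 < k) (hper : ∀ i, Y (i + k) = Y i)
    (hinj : ∀ i j, i < j → j < i + k → Y i ≠ Y j) (i : ℕ)
    (h : B (Y (i + 1)) (sweep B Y s (2 * k) (Y i))) :
    sweep B Y s (2 * k) (Y (i + 1)) = sweep B Y s (2 * k) (Y i) := by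
  set c : ℕ → ℕ := fun j => sweep B Y s j (Y j) with hc
  have hcopy : ∀ j, B (Y (j + 1)) (c j) → c (j + 1) = c j := fun j hj => sweep_succ_copy hj
  have hkeep : ∀ j, ¬ B (Y (j + 1 + k)) (c (j + k)) → c (j + 1 + k) = c (j + 1) := by
    intro j hj
    simp only [hc]
    rw [show j + 1 + k = (j + k) + 1 by ring, sweep_succ_keep (by convert hj using 2; ring_nf),
      show j + k + 1 = j + 1 + k by ring, hper,
      show j + k = (j + 1) + (k - 1) by omega, sweep_last hinj _ _ (by omega)]
  have hfin : ∀ j, k < j → j ≤ 2 * k → sweep B Y s (2 * k) (Y j) = c j := by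
    intro j h1 h2
    have := sweep_last (B := B) (s := s) hinj j (2 * k - j) (by omega)
    rwa [Nat.add_sub_cancel' h2] at this
  -- The second round spreads `c k` until a node refuses it; that node keeps its colour of the first
  -- round, and from there on the second round repeats the first. At `j = k` both alternatives say
  -- the same.
  have key : ∀ j ≤ k, c (j + k) = c j ∨ c (j + k) = c k := by
    intro j
    induction j with
    | zero => intro _; right; simp
    | succ j ih =>
      intro hj
      by_cases hb : B (Y (j + 1 + k)) (c (j + k))
      · have h1 : c (j + 1 + k) = c (j + k) := by
          rw [show j + 1 + k = j + k + 1 by ring] at hb ⊢; exact hcopy _ hb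
        rcases ih (by omega) with h2 | h2
        · left
          rw [hper, h2] at hb
          rw [h1, h2, hcopy j hb]
        · right; rw [h1, h2]
      · left; exact hkeep j hb
  have hper' : ∀ m i, Y (i + m * k) = Y i := by
    intro m
    induction m with
    | zero => simp
    | succ m ih => intro i; rw [Nat.succ_mul, ← add_assoc, hper, ih]
  have hcyc : c (2 * k) = c k := by
    have := key k le_rfl
    rw [← two_mul] at this
    exact this.elim id id
  have hYi : Y i = Y (i % k) := by
    conv_lhs => rw [← Nat.mod_add_div i k, mul_comm k, hper']
  have hYi' : Y (i + 1) = Y (i % k + 1) := by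
    conv_lhs => rw [← Nat.mod_add_div i k, mul_comm k, add_right_comm, hper']
  have hlt := Nat.mod_lt i hk
  rw [hYi, hYi'] at h
  rw [hYi, hYi']
  generalize i % k = j at h hlt ⊢
  have h1 : sweep B Y s (2 * k) (Y (j + 1)) = c (j + 1 + k) := by
    rw [← hfin _ (by omega) (by omega), hper]
  rcases Nat.eq_zero_or_pos j with rfl | hj
  · have h0 : sweep B Y s (2 * k) (Y 0) = c (2 * k) := by
      rw [← hfin _ (by omega) le_rfl, two_mul, hper, ← Nat.zero_add k, hper]
    rw [h0, hcyc] at h ⊢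
    rw [h1, show 0 + 1 + k = k + 1 by ring]
    refine hcopy k ?_
    rwa [add_comm k 1, hper]
  · have h0 : sweep B Y s (2 * k) (Y j) = c (j + k) := by
      rw [← hfin _ (by omega) (by omega), hper]
    rw [h0] at h ⊢
    rw [h1, show j + 1 + k = j + k + 1 by ring]
    refine hcopy _ ?_
    rwa [show j + k + 1 = j + 1 + k by ring, hper]

end Sweep

/-! ### Depth-first search -/

/-- `Reach N a b`: one gets from `a` to `b` by passing to neighbours. -/
abbrev Reach (N : ℕ → List ℕ) : ℕ → ℕ → Prop := Relation.ReflTransGen (fun a b => b ∈ N a)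

/-- Lists of neighbours of a loopless graph on `{0, …, n - 1}` in which every node has at most one
neighbour in its strongly connected component. -/
structure IsCyclic (n : ℕ) (N : ℕ → List ℕ) : Prop where
  nodup : ∀ x, (N x).Nodup
  lt : ∀ x, ∀ u ∈ N x, u < n
  self : ∀ x, x ∉ N x
  unique : ∀ v u u', u ∈ N v → u' ∈ N v → Reach N u v → Reach N u' v → u = u'

/-- The state of the search: `st` is `0` for new, `1` for active and `2` for finished nodes; `par` is
the parent (`n` for a root of the search forest); `low` is the root of the cycle of a node, once this
is known, and `tail` closes the cycle at its root; `ex` counts the explored neighbours; `d` is the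
depth; `cur` is the current node. -/
structure Search where
  st : ℕ → ℕ
  par : ℕ → ℕ
  low : ℕ → ℕ
  tail : ℕ → ℕ
  ex : ℕ → ℕ
  d : ℕ → ℕ
  cur : ℕ

/-- `b` is an ancestor of the active node `a`, or `a` itself. -/
abbrev Anc (n : ℕ) (st par : ℕ → ℕ) : ℕ → ℕ → Prop :=
  Relation.ReflTransGen (fun a b => st a = 1 ∧ par a = b ∧ b ≠ n)

/-- The nodes between `t` and its ancestor `r`. -/
def Between (n : ℕ) (st par : ℕ → ℕ) (t r x : ℕ) : Prop := Anc n st par t x ∧ Anc n st par x r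

/-- The current path consists of `cur` and its ancestors. The values `low x = x` and `tail x = x`
mean that nothing is known; otherwise `tail r` is the node at which the root `r` was met again.
`pend`: an active node off the current path is fully explored and waits for the root of its cycle.
`expl`: an explored neighbour is finished, unless the node lies on a closed cycle or the neighbour
is its child on the current path. `link`: every active node shares its component with a node of the
current path, so a neighbour that is met while active lies in the component of `cur`. -/
structure Search.Inv (n : ℕ) (N : ℕ → List ℕ) (S : Search) : Prop where
  cur : S.cur = n ∨ S.st S.cur = 1
  lt : ∀ x, S.st x ≠ 0 → x < n
  st_le : ∀ x, S.st x ≤ 2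
  ex_le : ∀ x, S.ex x ≤ (N x).length
  fresh : ∀ x, S.st x = 0 → S.ex x = 0
  closed : ∀ x, S.st x = 2 → ∀ u ∈ N x, S.st u = 2
  tree : ∀ x, S.st x = 1 → S.par x = n ∨
    (S.st (S.par x) = 1 ∧ x ∈ (N (S.par x)).take (S.ex (S.par x)) ∧ S.d x = S.d (S.par x) + 1)
  pend : ∀ x, S.st x = 1 → ¬ Anc n S.st S.par S.cur x → S.ex x = (N x).length ∧ S.low x ≠ x
  expl : ∀ x, S.st x = 1 → ∀ u ∈ (N x).take (S.ex x), S.st u = 2 ∨ (S.st u = 1 ∧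
    (S.low x ≠ x ∨ S.tail x ≠ x ∨ (Anc n S.st S.par S.cur u ∧ S.par u = x)))
  link : ∀ x, S.st x = 1 → ∃ w, Anc n S.st S.par S.cur w ∧ S.st w = 1 ∧ Reach N x w ∧ Reach N w x
  low : ∀ x, S.st x = 1 → S.low x ≠ x →
    Between n S.st S.par (S.tail (S.low x)) (S.low x) x ∧ S.st (S.low x) = 1 ∧
      S.low (S.low x) = S.low x ∧ S.tail (S.low x) ≠ S.low x ∧ Anc n S.st S.par S.cur (S.low x)
  tail : ∀ r, S.st r = 1 → S.tail r ≠ r → S.low r = r ∧ Anc n S.st S.par (S.tail r) r ∧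
    r ∈ (N (S.tail r)).take (S.ex (S.tail r)) ∧ S.st (S.tail r) = 1

/-! ### Ancestors in the search forest. -/

namespace Search.Inv

variable {n : ℕ} {N : ℕ → List ℕ} {S : Search}

theorem anc_cases {st par : ℕ → ℕ} {a b : ℕ} (h : Anc n st par a b) :
    a = b ∨ (st a = 1 ∧ par a ≠ n ∧ Anc n st par (par a) b) := by
  rcases Relation.ReflTransGen.cases_head h with rfl | ⟨c, ⟨h1, rfl, h2⟩, h3⟩
  · exact Or.inl rfl
  · exact Or.inr ⟨h1, h2, h3⟩

theorem mem_of_take {l : List ℕ} {i u : ℕ} (h : u ∈ l.take i) : u ∈ l := List.mem_of_mem_take h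

theorem anc_st (h : S.Inv n N) {a b : ℕ} (hab : Anc n S.st S.par a b) (ha : S.st a = 1) :
    S.st b = 1 := by
  induction hab with
  | refl => exact ha
  | tail _ hbc ih =>
    obtain ⟨h1, h2, h3⟩ := hbc
    rcases h.tree _ h1 with h4 | h4
    · exact absurd (h2.symm.trans h4) h3
    · rw [← h2]; exact h4.1

theorem anc_reach (h : S.Inv n N) {a b : ℕ} (hab : Anc n S.st S.par a b) : Reach N b a := by
  induction hab with
  | refl => exact .refl
  | tail _ hbc ih =>
    obtain ⟨h1, h2, h3⟩ := hbc
    rcases h.tree _ h1 with h4 | h4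
    · exact absurd (h2.symm.trans h4) h3
    · rw [h2] at h4
      exact .head (mem_of_take h4.2.1) ih

theorem anc_depth (h : S.Inv n N) {a b : ℕ} (hab : Anc n S.st S.par a b) :
    a = b ∨ S.d b < S.d a := by
  induction hab with
  | refl => exact Or.inl rfl
  | tail _ hbc ih =>
    obtain ⟨h1, h2, h3⟩ := hbc
    rcases h.tree _ h1 with h4 | h4
    · exact absurd (h2.symm.trans h4) h3
    · rw [h2] at h4
      right
      rcases ih with rfl | ih <;> omega

theorem anc_antisymm (h : S.Inv n N) {a b : ℕ} (hab : Anc n S.st S.par a b)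
    (hba : Anc n S.st S.par b a) : a = b := by
  rcases h.anc_depth hab with h1 | h1
  · exact h1
  · rcases h.anc_depth hba with h2 | h2
    · exact h2.symm
    · omega

/-! ### Closed cycles are strongly connected components. -/

/-- A closed cycle. -/
def Cyc (n : ℕ) (S : Search) (r x : ℕ) : Prop := Between n S.st S.par (S.tail r) r x

section Cycle

variable {r : ℕ} (hr : S.st r = 1) (ht : S.tail r ≠ r)
include hr ht

theorem cyc_st (h : S.Inv n N) {x : ℕ} (hx : Cyc n S r x) : S.st x = 1 :=
  h.anc_st hx.1 (h.tail r hr ht).2.2.2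

theorem cyc_root (h : S.Inv n N) : Cyc n S r r := ⟨(h.tail r hr ht).2.1, .refl⟩

theorem reach_tail (h : S.Inv n N) : Reach N (S.tail r) r :=
  .single (mem_of_take (h.tail r hr ht).2.2.1)

theorem cyc_reach (h : S.Inv n N) {x y : ℕ} (hx : Cyc n S r x) (hy : Cyc n S r y) :
    Reach N x y :=
  ((h.anc_reach hx.1).trans (h.reach_tail hr ht)).trans (h.anc_reach hy.2)

theorem cyc_pred (h : S.Inv n N) {y : ℕ} (hy : Cyc n S r y) :
    ∃ z, Cyc n S r z ∧ z ∈ (N y).take (S.ex y) ∧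
      ((S.st z = 1 ∧ S.par z = y) ∨ (z = r ∧ y = S.tail r)) := by
  rcases Relation.ReflTransGen.cases_tail hy.1 with hyt | ⟨z, hz, hE⟩
  · subst hyt
    exact ⟨r, h.cyc_root hr ht, (h.tail r hr ht).2.2.1, Or.inr ⟨rfl, rfl⟩⟩
  · refine ⟨z, ⟨hz, .head hE hy.2⟩, ?_, Or.inl ⟨hE.1, hE.2.1⟩⟩
    rcases h.tree z hE.1 with h4 | h4
    · exact absurd (hE.2.1.symm.trans h4) hE.2.2
    · rw [hE.2.1] at h4; exact h4.2.1

/-- The cycle already provides one neighbour of `y` in the component of `y` (`cyc_pred`), and there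
is only one. -/
theorem cyc_unique (h : S.Inv n N) (hG : IsCyclic n N) {y u : ℕ} (hy : Cyc n S r y)
    (hu : u ∈ N y) (huy : Reach N u y) :
    Cyc n S r u ∧ u ∈ (N y).take (S.ex y) ∧
      ((S.st u = 1 ∧ S.par u = y) ∨ (u = r ∧ y = S.tail r)) := by
  obtain ⟨z, hz, hzy, hz'⟩ := h.cyc_pred hr ht hy
  obtain rfl := hG.unique y u z hu (mem_of_take hzy) huy (h.cyc_reach hr ht hz hy)
  exact ⟨hz, hzy, hz'⟩

/-- A path that starts on the cycle and can return never leaves it, by `cyc_unique` at each edge. -/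
theorem cyc_scc (h : S.Inv n N) (hG : IsCyclic n N) {x y : ℕ} (hy : Cyc n S r y)
    (hyx : Reach N y x) (hxy : Reach N x y) : Cyc n S r x := by
  induction hyx with
  | refl => exact hy
  | tail hab hbc ih =>
    have hb := ih (.head hbc hxy)
    refine (h.cyc_unique hr ht hG hb hbc ?_).1
    exact hxy.trans hab

/-- A second cycle closed at `p` would lie in the same component. Its tail, a proper descendant of
`p`, would then have `p` as its cycle neighbour and hence be the parent of `p`, which the depths
forbid. -/
theorem tail_eq (h : S.Inv n N) (hG : IsCyclic n N) {p : ℕ} (hp : Cyc n S r p) (hpr : p ≠ r) :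
    S.tail p = p := by
  by_contra htp
  have hps := h.cyc_st hr ht hp
  obtain ⟨-, h2, h3, h4⟩ := h.tail p hps htp
  have hct : Cyc n S r (S.tail p) :=
    h.cyc_scc hr ht hG hp (h.anc_reach h2) (h.reach_tail hps htp)
  rcases (h.cyc_unique hr ht hG hct (mem_of_take h3) (h.anc_reach h2)).2.2 with h5 | h5
  · rcases h.tree p hps with h6 | h6
    · exact absurd h6 (by have := h.lt _ (show S.st (S.par p) ≠ 0 by rw [h5.2, h4]; simp); omega)
    · rw [h5.2] at h6
      rcases h.anc_depth h2 with h7 | h7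
      · exact htp h7
      · omega
  · exact hpr h5.1

end Cycle

/-! ### Moves of the search that finish no component. -/

theorem mem_take_update {ex : ℕ → ℕ} {v u : ℕ} (hu : (N v)[ex v]? = some u) (x y : ℕ) :
    y ∈ (N x).take (Function.update ex v (ex v + 1) x) ↔
      y ∈ (N x).take (ex x) ∨ (x = v ∧ y = u) := by
  by_cases hx : x = v
  · subst hx
    rw [Function.update_self, List.take_add_one, hu]
    simp
  · rw [Function.update_of_ne hx]
    simp [hx]

theorem ex_update_le (h : S.Inv n N) {v u : ℕ} (hu : (N v)[S.ex v]? = some u) (x : ℕ) :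
    Function.update S.ex v (S.ex v + 1) x ≤ (N x).length := by
  by_cases hx : x = v
  · subst hx
    rw [Function.update_self]
    obtain ⟨h1, -⟩ := List.getElem?_eq_some_iff.1 hu
    exact h1
  · rw [Function.update_of_ne hx]; exact h.ex_le x

theorem anc_mono {st st' par par' : ℕ → ℕ} {a b : ℕ} (h : Anc n st par a b)
    (hmono : ∀ x, st x = 1 → st' x = 1 ∧ par' x = par x) : Anc n st' par' a b := by
  induction h with
  | refl => exact .refl
  | tail _ h ih => exact ih.tail ⟨(hmono _ h.1).1, (hmono _ h.1).2.trans h.2.1, h.2.2⟩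

theorem skip (h : S.Inv n N) {u : ℕ} (hcur : S.st S.cur = 1)
    (hu : (N S.cur)[S.ex S.cur]? = some u) (hus : S.st u = 2) :
    Search.Inv n N { S with ex := Function.update S.ex S.cur (S.ex S.cur + 1) } where
  cur := h.cur
  lt := h.lt
  st_le := h.st_le
  ex_le := h.ex_update_le hu
  fresh x hx := by
    have : x ≠ S.cur := by rintro rfl; simp [hcur] at hx
    simp only [Function.update_of_ne this]
    exact h.fresh x hx
  closed := h.closed
  tree x hx := (h.tree x hx).imp id (fun h1 => ⟨h1.1, (mem_take_update hu _ _).2 (Or.inl h1.2.1),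
    h1.2.2⟩)
  pend x hx hx' := by
    have : x ≠ S.cur := by rintro rfl; exact hx' .refl
    simp only [Function.update_of_ne this]
    exact h.pend x hx hx'
  expl x hx y hy := by
    rcases (mem_take_update hu _ _).1 hy with hy | ⟨rfl, rfl⟩
    · exact h.expl x hx y hy
    · exact Or.inl hus
  link := h.link
  low := h.low
  tail r hr ht :=
    let ⟨h1, h2, h3, h4⟩ := h.tail r hr ht
    ⟨h1, h2, (mem_take_update hu _ _).2 (Or.inl h3), h4⟩

/-- The state after a new node `u` has been entered from the node `v` (`n` at a root). -/
def _root_.SCCAlg.Search.enter (S : Search) (u v e : ℕ) (ex : ℕ → ℕ) : Search where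
  st := Function.update S.st u 1
  par := Function.update S.par u v
  low := Function.update S.low u u
  tail := Function.update S.tail u u
  ex := ex
  d := Function.update S.d u e
  cur := u

/-- Common core of `push` and `start`. The counters `ex` stay abstract because only an entry from
another node, `S.cur ≠ n`, advances one of them. -/
theorem enter_aux (h : S.Inv n N) {u : ℕ} (hun : u < n) (hus : S.st u = 0) {ex : ℕ → ℕ} {e : ℕ}
    (hexle : ∀ x, ex x ≤ (N x).length)
    (hfresh : ∀ x, S.st x = 0 → ex x = 0)
    (hne : ∀ x, x ≠ S.cur → ex x = S.ex x)
    (hmem : ∀ x y,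
        y ∈ (N x).take (ex x) ↔ y ∈ (N x).take (S.ex x) ∨ (x = S.cur ∧ y = u ∧ S.cur ≠ n))
    (he : S.cur = n ∨ e = S.d S.cur + 1) :
    Search.Inv n N (S.enter u S.cur e ex) := by
  have hne' : ∀ {x}, S.st x ≠ 0 → x ≠ u := by rintro x hx rfl; exact hx hus
  have hne1 : ∀ {x}, S.st x = 1 → x ≠ u := fun hx => hne' (by simp [hx])
  have hmono : ∀ x, S.st x = 1 → Function.update S.st u 1 x = 1 ∧
      Function.update S.par u S.cur x = S.par x := fun x hx => by
    simp [hne1 hx, hx]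
  have hanc : ∀ {x}, S.st x = 1 → Anc n S.st S.par S.cur x →
      Anc n (Function.update S.st u 1) (Function.update S.par u S.cur) u x := by
    intro x hx hax
    refine .head ⟨by simp, by simp, ?_⟩ (anc_mono hax hmono)
    intro hc
    rcases anc_cases hax with h1 | h1
    · have := h.lt x (by simp [hx]); omega
    · have := h.lt _ (by rw [h1.1]; simp); omega
  have hst : ∀ {x}, Function.update S.st u 1 x = 1 → x = u ∨ (x ≠ u ∧ S.st x = 1) := by
    intro x hx
    by_cases hxu : x = u
    · exact Or.inl hxu
    · exact Or.inr ⟨hxu, by simpa [hxu] using hx⟩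
  have htk : (N u).take (ex u) = [] := by rw [hfresh u hus]; simp
  have hcuru : S.cur ≠ u := by
    rcases h.cur with h1 | h1
    · omega
    · exact hne1 h1
  constructor
  · right; simp [enter]
  · intro x hx
    by_cases hxu : x = u
    · omega
    · exact h.lt x (by simpa [enter, hxu] using hx)
  · intro x
    by_cases hxu : x = u
    · simp [enter, hxu]
    · simpa [enter, hxu] using h.st_le x
  · exact hexle
  · intro x hx
    by_cases hxu : x = u
    · simp [enter, hxu] at hx
    · exact hfresh x (by simpa [enter, hxu] using hx)
  · intro x hx y hy
    have hxu : x ≠ u := by rintro rfl; simp [enter] at hx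
    have := h.closed x (by simpa [enter, hxu] using hx) y hy
    simpa [enter, hne' (x := y) (by simp [this])] using this
  · intro x hx
    rcases hst hx with rfl | ⟨hxu, hx⟩
    · simp only [enter, Function.update_self]
      rcases h.cur with h1 | h1
      · exact Or.inl h1
      · right
        have hcn : S.cur ≠ n := by have := h.lt S.cur (by simp [h1]); omega
        simp only [Function.update_of_ne hcuru]
        exact ⟨h1, (hmem _ _).2 (Or.inr ⟨rfl, rfl, hcn⟩), he.resolve_left hcn⟩
    · simp only [enter, Function.update_of_ne hxu]
      refine (h.tree x hx).imp id (fun h1 => ?_)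
      rw [Function.update_of_ne (hne1 h1.1), Function.update_of_ne (hne1 h1.1)]
      exact ⟨h1.1, (hmem _ _).2 (Or.inl h1.2.1), h1.2.2⟩
  · intro x hx hx'
    rcases hst hx with rfl | ⟨hxu, hx⟩
    · exact absurd .refl hx'
    · have h1 := h.pend x hx (fun hc => hx' (hanc hx hc))
      have hxc : x ≠ S.cur := by rintro rfl; exact hx' (hanc hx .refl)
      simpa [enter, hxu, hne x hxc] using h1
  · intro x hx y hy
    rcases hst hx with rfl | ⟨hxu, hx⟩
    · change y ∈ (N x).take (ex x) at hy
      rw [htk] at hy; simp at hy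
    · rcases (hmem _ _).1 hy with hy | ⟨rfl, rfl, hcn⟩
      · rcases h.expl x hx y hy with h1 | ⟨h1, h2⟩
        · left; simpa [enter, hne' (x := y) (by simp [h1])] using h1
        · right
          have hyu := hne1 h1
          refine ⟨by simpa [enter, hyu] using h1, ?_⟩
          simp only [enter, Function.update_of_ne hxu, Function.update_of_ne hyu]
          exact h2.imp id (Or.imp id (fun h3 => ⟨hanc h1 h3.1, h3.2⟩))
      · right
        refine ⟨by simp [enter], Or.inr (Or.inr ⟨.refl, by simp [enter]⟩)⟩
  · intro x hx
    rcases hst hx with rfl | ⟨hxu, hx⟩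
    · exact ⟨x, .refl, hx, .refl, .refl⟩
    · obtain ⟨w, h1, h2, h3⟩ := h.link x hx
      exact ⟨w, hanc h2 h1, by simpa [enter, hne1 h2] using h2, h3⟩
  · intro x hx hlow
    rcases hst hx with rfl | ⟨hxu, hx⟩
    · simp [enter] at hlow
    · simp only [enter, Function.update_of_ne hxu] at hlow ⊢
      obtain ⟨h1, h2, h3, h4, h5⟩ := h.low x hx hlow
      have hlu := hne1 h2
      simp only [Function.update_of_ne hlu]
      exact ⟨⟨anc_mono h1.1 hmono, anc_mono h1.2 hmono⟩, h2, h3, h4, hanc h2 h5⟩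
  · intro r hr ht
    rcases hst hr with rfl | ⟨hru, hr⟩
    · simp [enter] at ht
    · simp only [enter, Function.update_of_ne hru] at ht ⊢
      obtain ⟨h1, h2, h3, h4⟩ := h.tail r hr ht
      rw [Function.update_of_ne (hne1 h4)]
      exact ⟨h1, anc_mono h2 hmono, (hmem _ _).2 (Or.inl h3), h4⟩

theorem push (h : S.Inv n N) (hG : IsCyclic n N) {u : ℕ} (hcur : S.st S.cur = 1)
    (hu : (N S.cur)[S.ex S.cur]? = some u) (hus : S.st u = 0) :
    Search.Inv n N (S.enter u S.cur (S.d S.cur + 1)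
      (Function.update S.ex S.cur (S.ex S.cur + 1))) := by
  have hcn : S.cur ≠ n := by have := h.lt S.cur (by simp [hcur]); omega
  refine h.enter_aux (hG.lt _ u (List.mem_of_getElem? hu)) hus (h.ex_update_le hu) ?_ ?_ ?_
    (Or.inr rfl)
  · intro x hx
    rw [Function.update_of_ne (by rintro rfl; simp [hcur] at hx)]
    exact h.fresh x hx
  · intro x hx; rw [Function.update_of_ne hx]
  · intro x y
    rw [mem_take_update hu]
    simp [hcn]

theorem start (h : S.Inv n N) {u : ℕ} (hcur : S.cur = n) (hun : u < n) (hus : S.st u = 0) :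
    Search.Inv n N (S.enter u n 0 S.ex) := by
  have := h.enter_aux (ex := S.ex) (e := 0) hun hus h.ex_le h.fresh (fun _ _ => rfl)
    (fun x y => by simp [hcur]) (Or.inl hcur)
  rwa [hcur] at this

theorem not_mem_take {l : List ℕ} (hl : l.Nodup) {i u : ℕ} (h : l[i]? = some u) :
    u ∉ l.take i := by
  intro hu
  obtain ⟨j, hj, hju⟩ := List.mem_iff_getElem.1 hu
  rw [List.getElem_take] at hju
  obtain ⟨hi, hiu⟩ := List.getElem?_eq_some_iff.1 h
  rw [List.length_take] at hj
  have := (hl.getElem_inj_iff).1 (hju.trans hiu.symm)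
  omega

/-- The active neighbour `u` lies in the component of the current node. No cycle can have been
closed there before, so `u` is an ancestor and the path between the two becomes the cycle. -/
theorem back (h : S.Inv n N) (hG : IsCyclic n N) {u : ℕ} (hcur : S.st S.cur = 1)
    (hu : (N S.cur)[S.ex S.cur]? = some u) (hus : S.st u = 1) :
    Search.Inv n N { S with
      ex := Function.update S.ex S.cur (S.ex S.cur + 1)
      low := Function.update S.low S.cur u
      tail := Function.update S.tail u S.cur } := by
  have huN : u ∈ N S.cur := List.mem_of_getElem? hu
  have huv : u ≠ S.cur := by intro hc; rw [hc] at huN; exact hG.self _ huN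
  have hReach : Reach N u S.cur := by
    obtain ⟨w, h1, -, h3, -⟩ := h.link u hus
    exact h3.trans (h.anc_reach h1)
  -- On a closed cycle the cycle neighbour `u` would be explored already, but it is the next entry
  -- of a list without repetition.
  have hv : ∀ r, S.st r = 1 → S.tail r ≠ r → ¬ Cyc n S r S.cur := fun r hr ht hc =>
    not_mem_take (hG.nodup _) hu (h.cyc_unique hr ht hG hc huN hReach).2.1
  have hcu : ∀ r, S.st r = 1 → S.tail r ≠ r → ¬ Cyc n S r u := fun r hr ht hc =>
    hv r hr ht (h.cyc_scc hr ht hG hc hReach (.single huN))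
  have htail : ∀ x, S.st x = 1 → (∀ r, S.st r = 1 → S.tail r ≠ r → ¬ Cyc n S r x) →
      S.tail x = x ∧ S.low x = x := by
    intro x hx hc
    constructor
    · by_contra ht; exact hc x hx ht (h.cyc_root hx ht)
    · by_contra hl
      obtain ⟨h1, h2, -, h4, -⟩ := h.low x hx hl
      exact hc _ h2 h4 h1
  obtain ⟨htv, hlv⟩ := htail _ hcur hv
  obtain ⟨htu, hlu⟩ := htail _ hus hcu
  -- Off the current path `u` would be pending, with a known root, against `hlu`.
  have hanc : Anc n S.st S.par S.cur u := by
    by_contra hc; exact (h.pend u hus hc).2 hlu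
  constructor
  · exact h.cur
  · exact h.lt
  · exact h.st_le
  · exact h.ex_update_le hu
  · intro x hx
    have : x ≠ S.cur := by rintro rfl; simp [hcur] at hx
    simp only [Function.update_of_ne this]
    exact h.fresh x hx
  · exact h.closed
  · exact fun x hx => (h.tree x hx).imp id
      (fun h1 => ⟨h1.1, (mem_take_update hu _ _).2 (Or.inl h1.2.1), h1.2.2⟩)
  · intro x hx hx'
    have : x ≠ S.cur := by rintro rfl; exact hx' .refl
    simp only [Function.update_of_ne this]
    exact h.pend x hx hx'
  · intro x hx y hy
    by_cases hxv : x = S.cur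
    · subst hxv
      simp only [Function.update_self]
      rcases (mem_take_update hu _ _).1 hy with hy | ⟨-, rfl⟩
      · exact (h.expl _ hx y hy).imp id (fun h1 => ⟨h1.1, Or.inl huv⟩)
      · exact Or.inr ⟨hus, Or.inl huv⟩
    · rcases (mem_take_update hu _ _).1 hy with hy | ⟨h1, -⟩
      · refine (h.expl x hx y hy).imp id (fun h1 => ⟨h1.1, ?_⟩)
        simp only [Function.update_of_ne hxv]
        refine h1.2.imp id (Or.imp (fun h2 => ?_) id)
        rwa [Function.update_of_ne (by rintro rfl; exact h2 htu)]
      · exact absurd h1 hxv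
  · exact h.link
  · intro x hx hl
    by_cases hxv : x = S.cur
    · subst hxv
      simp only [Function.update_self, Function.update_of_ne huv]
      exact ⟨⟨.refl, hanc⟩, hus, hlu, huv.symm, hanc⟩
    · simp only [Function.update_of_ne hxv] at hl ⊢
      obtain ⟨h1, h2, h3, h4, h5⟩ := h.low x hx hl
      rw [Function.update_of_ne (a := S.low x) (by rintro h6; rw [h6] at h4; exact h4 htu),
        Function.update_of_ne (a := S.low x) (by rintro h6; rw [h6] at h4; exact h4 htv)]
      exact ⟨h1, h2, h3, h4, h5⟩
  · intro r hr ht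
    by_cases hru : r = u
    · subst hru
      have h1 := (mem_take_update hu S.cur r).2 (Or.inr ⟨rfl, rfl⟩)
      rw [Function.update_self] at h1
      simp only [Function.update_self, Function.update_of_ne huv]
      exact ⟨hlu, hanc, h1, hcur⟩
    · simp only [Function.update_of_ne hru] at ht ⊢
      obtain ⟨h1, h2, h3, h4⟩ := h.tail r hr ht
      rw [Function.update_of_ne (by rintro rfl; exact ht htv)]
      exact ⟨h1, h2, (mem_take_update hu _ _).2 (Or.inl h3), h4⟩

/-- The current node is on a cycle with a higher root, so its parent lies on the same cycle and
receives the same root. The node left behind becomes pending. -/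
theorem retreat (h : S.Inv n N) (hG : IsCyclic n N) (hcur : S.st S.cur = 1)
    (hex : S.ex S.cur = (N S.cur).length) (hlow : S.low S.cur ≠ S.cur) :
    (S.par S.cur ≠ n ∧ S.d S.cur = S.d (S.par S.cur) + 1) ∧ Search.Inv n N { S with
      low := Function.update S.low (S.par S.cur) (S.low S.cur)
      cur := S.par S.cur } := by
  obtain ⟨h1, h2, h3, h4, h5⟩ := h.low _ hcur hlow
  rcases anc_cases h5 with h6 | ⟨-, hpn, hpr⟩
  · exact absurd h6.symm hlow
  obtain ⟨hps, hpe, hpd⟩ := (h.tree _ hcur).resolve_left hpn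
  have hcp : Cyc n S (S.low S.cur) (S.par S.cur) := ⟨h1.1.tail ⟨hcur, rfl, hpn⟩, hpr⟩
  have hpc : S.par S.cur ≠ S.cur := by intro hc; rw [hc] at hpd; omega
  set r := S.low S.cur with hr
  set p := S.par S.cur with hp
  have hanc : ∀ {x}, x ≠ S.cur → Anc n S.st S.par S.cur x → Anc n S.st S.par p x := by
    intro x hx hax
    rcases anc_cases hax with h6 | h6
    · exact absurd h6.symm hx
    · exact h6.2.2
  have htp : S.tail p ≠ p → p = r := fun ht => by
    by_contra hc; exact ht (h.tail_eq h2 h4 hG hcp hc)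
  refine ⟨⟨hpn, hpd⟩, ?_⟩
  constructor
  · exact Or.inr hps
  · exact h.lt
  · exact h.st_le
  · exact h.ex_le
  · exact h.fresh
  · exact h.closed
  · exact h.tree
  · intro x hx hx'
    have hxp : x ≠ p := by rintro rfl; exact hx' .refl
    simp only [Function.update_of_ne hxp]
    by_cases hxc : x = S.cur
    · rw [hxc]; exact ⟨hex, hlow⟩
    · exact h.pend x hx (fun hc => hx' (hanc hxc hc))
  · intro x hx y hy
    refine (h.expl x hx y hy).imp id (fun h6 => ⟨h6.1, ?_⟩)
    -- For the parent, the child on the current path is lost as a reason; being on the closed cycle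
    -- replaces it.
    by_cases hxp : x = p
    · subst hxp
      simp only [Function.update_self]
      by_cases hpr' : p = r
      · right; left; rw [hpr']; exact h4
      · left; exact Ne.symm hpr'
    · simp only [Function.update_of_ne hxp]
      refine h6.2.imp id (Or.imp id (fun h7 => ⟨hanc ?_ h7.1, h7.2⟩))
      intro hc
      rw [hc] at h7
      exact hxp h7.2.symm
  · intro x hx
    obtain ⟨w, h6, h7, h8, h9⟩ := h.link x hx
    -- Nodes linked through the node just left are now linked through the root of its cycle.
    by_cases hw : w = S.cur
    · subst hw
      have hv : Cyc n S r S.cur := h1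
      exact ⟨r, hpr, h2, h8.trans (h.cyc_reach h2 h4 hv (h.cyc_root h2 h4)),
        (h.cyc_reach h2 h4 (h.cyc_root h2 h4) hv).trans h9⟩
    · exact ⟨w, hanc hw h6, h7, h8, h9⟩
  · intro x hx hl
    by_cases hxp : x = p
    · subst hxp
      simp only [Function.update_self] at hl ⊢
      rw [Function.update_of_ne hl]
      exact ⟨hcp, h2, h3, h4, hpr⟩
    · simp only [Function.update_of_ne hxp] at hl ⊢
      obtain ⟨g1, g2, g3, g4, g5⟩ := h.low x hx hl
      refine ⟨g1, g2, ?_, g4, hanc ?_ g5⟩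
      · by_cases hq : S.low x = p
        · rw [hq, Function.update_self]; rw [hq] at g4; exact (htp g4).symm
        · rw [Function.update_of_ne hq]; exact g3
      · intro hc; rw [hc] at g3; exact hlow g3
  · intro q hq ht
    obtain ⟨g1, g2, g3, g4⟩ := h.tail q hq ht
    refine ⟨?_, g2, g3, g4⟩
    by_cases hqp : q = p
    · subst hqp; simp only [Function.update_self]; exact (htp ht).symm
    · simp only [Function.update_of_ne hqp]; exact g1

/-! ### Finishing a component. -/

theorem cyc_self (h : S.Inv n N) (hcur : S.st S.cur = 1) : Cyc n S S.cur S.cur := by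
  by_cases ht : S.tail S.cur = S.cur
  · rw [Cyc, ht]; exact ⟨.refl, .refl⟩
  · exact h.cyc_root hcur ht

theorem cyc_st' (h : S.Inv n N) (hcur : S.st S.cur = 1) {x : ℕ} (hx : Cyc n S S.cur x) :
    S.st x = 1 := by
  by_cases ht : S.tail S.cur = S.cur
  · rw [Cyc, ht] at hx; rw [← h.anc_antisymm hx.1 hx.2]; exact hcur
  · exact h.cyc_st hcur ht hx

/-- Without a closed cycle an unfinished neighbour of the root could only be its child on the
current path, but that path ends at the root. With a cycle, all its nodes are fully explored by
`pend`, and an active neighbour leads back to the cycle by `link`. -/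
theorem cyc_explored (h : S.Inv n N) (hcur : S.st S.cur = 1)
    (hex : S.ex S.cur = (N S.cur).length) (hlow : S.low S.cur = S.cur) {x : ℕ}
    (hx : Cyc n S S.cur x) {u : ℕ} (hu : u ∈ N x) :
    S.st u = 2 ∨ (S.tail S.cur ≠ S.cur ∧ Reach N u x) := by
  by_cases ht : S.tail S.cur = S.cur
  · left
    rw [Cyc, ht] at hx
    obtain rfl := h.anc_antisymm hx.1 hx.2
    rcases h.expl _ hcur u (by rwa [hex, List.take_length]) with h1 | ⟨h1, h2 | h2 | ⟨h2, h3⟩⟩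
    · exact h1
    · exact absurd hlow h2
    · exact absurd ht h2
    · exfalso
      rcases h.tree u h1 with h4 | h4
      · have := h.lt S.cur (by simp [hcur]); omega
      · rw [h3] at h4
        rcases h.anc_depth h2 with h5 | h5
        · rw [← h5] at h4; omega
        · omega
  · have hful : S.ex x = (N x).length := by
      by_cases hxv : x = S.cur
      · rw [hxv]; exact hex
      · refine (h.pend x (h.cyc_st' hcur hx) (fun hc => hxv ?_)).1
        exact h.anc_antisymm hx.2 hc
    rcases h.expl x (h.cyc_st' hcur hx) u (by rwa [hful, List.take_length]) with h1 | ⟨h1, -⟩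
    · exact Or.inl h1
    · obtain ⟨w, h2, h3, h4, -⟩ := h.link u h1
      exact Or.inr ⟨ht, (h4.trans (h.anc_reach h2)).trans
        (h.cyc_reach hcur ht (h.cyc_root hcur ht) hx)⟩

/-- Redirecting the parent pointer of the root to the tail closes the tree path into a circle; if
`tail` is unset, the root becomes a circle of length 1. The pointers run in the direction of the
edges of the graph. -/
theorem cyc_step (h : S.Inv n N) (hcur : S.st S.cur = 1) {x : ℕ} (hx : Cyc n S S.cur x) :
    Cyc n S S.cur (Function.update S.par S.cur (S.tail S.cur) x) := by
  by_cases hxv : x = S.cur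
  · rw [hxv, Function.update_self]
    exact ⟨.refl, (h.cyc_self hcur).1⟩
  · rw [Function.update_of_ne hxv]
    rcases anc_cases hx.2 with h1 | ⟨h1, h2, h3⟩
    · exact absurd h1 hxv
    · exact ⟨hx.1.tail ⟨h1, rfl, h2⟩, h3⟩

/-- This supplies the hypothesis `hN` of `Stable.extend`. -/
theorem cyc_edges (h : S.Inv n N) (hG : IsCyclic n N) (hcur : S.st S.cur = 1)
    (hex : S.ex S.cur = (N S.cur).length) (hlow : S.low S.cur = S.cur) {x : ℕ}
    (hx : Cyc n S S.cur x) {u : ℕ}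
    (hu : u ∈ N (Function.update S.par S.cur (S.tail S.cur) x)) : S.st u = 2 ∨ u = x := by
  have hx' := h.cyc_step hcur hx
  refine (h.cyc_explored hcur hex hlow hx' hu).imp id (fun ⟨ht, hux⟩ => ?_)
  refine hG.unique _ u x hu ?_ hux (h.cyc_reach hcur ht hx hx')
  by_cases hxv : x = S.cur
  · rw [hxv, Function.update_self]
    exact mem_of_take (h.tail _ hcur ht).2.2.1
  · rw [Function.update_of_ne hxv]
    rcases anc_cases hx.2 with h1 | ⟨h1, h2, h3⟩
    · exact absurd h1 hxv
    · exact mem_of_take ((h.tree x h1).resolve_left h2).2.1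

theorem cyc_iterate (h : S.Inv n N) (hcur : S.st S.cur = 1) (i : ℕ) :
    Cyc n S S.cur ((Function.update S.par S.cur (S.tail S.cur))^[i] S.cur) := by
  induction i with
  | zero => exact h.cyc_self hcur
  | succ i ih => rw [Function.iterate_succ_apply']; exact h.cyc_step hcur ih

theorem iterate_to_root {x : ℕ} (hx : Anc n S.st S.par x S.cur) :
    ∃ m, (Function.update S.par S.cur (S.tail S.cur))^[m] x = S.cur := by
  induction hx using Relation.ReflTransGen.head_induction_on with
  | refl => exact ⟨0, rfl⟩
  | head hE hac ih =>
    rename_i a c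
    by_cases hav : a = S.cur
    · exact ⟨0, hav⟩
    · obtain ⟨m, hm⟩ := ih
      refine ⟨m + 1, ?_⟩
      rw [Function.iterate_succ_apply, Function.update_of_ne hav, hE.2.1, hm]

theorem exists_iterate (h : S.Inv n N) {x : ℕ} (hx : Cyc n S S.cur x) :
    ∃ i, x = (Function.update S.par S.cur (S.tail S.cur))^[i] S.cur := by
  obtain ⟨h1, h2⟩ := hx
  induction h1 with
  | refl => exact ⟨1, by simp⟩
  | tail hab hE ih =>
    rename_i b c
    obtain ⟨i, hi⟩ := ih (.head hE h2)
    by_cases hbv : b = S.cur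
    · subst hbv
      refine ⟨0, ?_⟩
      exact (h.anc_antisymm (.single hE) h2).symm
    · refine ⟨i + 1, ?_⟩
      rw [Function.iterate_succ_apply', ← hi, Function.update_of_ne hbv, hE.2.1]

theorem periodic (h : S.Inv n N) (hcur : S.st S.cur = 1) :
    0 < Function.minimalPeriod (Function.update S.par S.cur (S.tail S.cur)) S.cur := by
  obtain ⟨m, hm⟩ := iterate_to_root (h.cyc_self hcur).1
  apply Function.IsPeriodicPt.minimalPeriod_pos (n := m + 1) (Nat.succ_pos m)
  change _^[m + 1] _ = _
  rw [Function.iterate_succ_apply, Function.update_self, hm]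

/-- The finished nodes remain closed under neighbours, hence under reachability. So a witness that
reaches a surviving active node also survives. -/
theorem finish (h : S.Inv n N) (hG : IsCyclic n N) (hcur : S.st S.cur = 1)
    (hex : S.ex S.cur = (N S.cur).length) (hlow : S.low S.cur = S.cur) {st' : ℕ → ℕ}
    (hst : ∀ x, Cyc n S S.cur x → st' x = 2) (hst' : ∀ x, ¬ Cyc n S S.cur x → st' x = S.st x) :
    (S.par S.cur = n ∨ S.d S.cur = S.d (S.par S.cur) + 1) ∧ Search.Inv n N { S with
      st := st'
      par := Function.update S.par S.cur (S.tail S.cur)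
      cur := S.par S.cur } := by
  have hself := h.cyc_self hcur
  have hcl : ∀ x, st' x = 2 → ∀ u ∈ N x, st' u = 2 := by
    intro x hx u hu
    by_cases hxc : Cyc n S S.cur x
    · rcases h.cyc_explored hcur hex hlow hxc hu with h1 | ⟨ht, h1⟩
      · rwa [hst' u (fun hc => by have := h.cyc_st' hcur hc; omega)]
      · exact hst u (h.cyc_unique hcur ht hG hxc hu h1).1
    · rw [hst' x hxc] at hx
      have hu2 := h.closed x hx u hu
      rwa [hst' u (fun hc => by have := h.cyc_st' hcur hc; omega)]
  have hclR : ∀ {x y}, Reach N x y → st' x = 2 → st' y = 2 := by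
    intro x y hxy hx
    induction hxy with
    | refl => exact hx
    | tail _ hbc ih => exact hcl _ ih _ hbc
  have h1 : ∀ {x}, st' x = 1 → ¬ Cyc n S S.cur x ∧ S.st x = 1 := by
    intro x hx
    have hxc : ¬ Cyc n S S.cur x := fun hc => by rw [hst x hc] at hx; simp at hx
    exact ⟨hxc, by rw [← hst' x hxc]; exact hx⟩
  have h1' : ∀ {x}, S.st x = 1 → st' x ≠ 2 → st' x = 1 := by
    intro x hx hx2
    rw [hst' x (fun hc => hx2 (hst x hc)), hx]
  have hne : ∀ {x}, st' x ≠ 2 → x ≠ S.cur := by rintro x hx rfl; exact hx (hst _ hself)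
  have hanc : ∀ {a b}, Anc n S.st S.par a b → st' a ≠ 2 →
      Anc n st' (Function.update S.par S.cur (S.tail S.cur)) a b := by
    intro a b hab
    induction hab using Relation.ReflTransGen.head_induction_on with
    | refl => exact fun _ => .refl
    | head hE hac ih =>
      rename_i a c
      intro ha
      refine .head ⟨h1' hE.1 ha, by rw [Function.update_of_ne (hne ha)]; exact hE.2.1, hE.2.2⟩
        (ih (fun hc => ha (hclR (h.anc_reach (.single hE)) hc)))
  -- The component consists of descendants of the current node, while its parent has smaller depth.
  have hpar : S.par S.cur ≠ n → st' (S.par S.cur) ≠ 2 := by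
    intro hpn
    obtain ⟨h2, -, h3⟩ := (h.tree _ hcur).resolve_left hpn
    rw [hst' _ (fun hc => by rcases h.anc_depth hc.2 with h4 | h4 <;> [rw [h4] at h3; skip] <;>
        omega),
      h2]
    simp
  have hancp : ∀ {x}, st' x ≠ 2 → Anc n S.st S.par S.cur x →
      Anc n st' (Function.update S.par S.cur (S.tail S.cur)) (S.par S.cur) x := by
    intro x hx hax
    rcases anc_cases hax with h2 | ⟨-, h2, h3⟩
    · exact absurd h2.symm (hne hx)
    · exact hanc h3 (hpar h2)
  refine ⟨(h.tree _ hcur).imp id (fun h2 => h2.2.2), ?_⟩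
  constructor
  · by_cases hpn : S.par S.cur = n
    · exact Or.inl hpn
    · exact Or.inr (h1' ((h.tree _ hcur).resolve_left hpn).1 (hpar hpn))
  · intro x hx
    by_cases hxc : Cyc n S S.cur x
    · exact h.lt x (by rw [h.cyc_st' hcur hxc]; simp)
    · exact h.lt x (by rw [← hst' x hxc]; exact hx)
  · intro x
    by_cases hxc : Cyc n S S.cur x
    · exact (hst x hxc).le
    · simp only [hst' x hxc]; exact h.st_le x
  · exact h.ex_le
  · intro x hx
    by_cases hxc : Cyc n S S.cur x
    · simp only [hst x hxc] at hx; omega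
    · exact h.fresh x (by rw [← hst' x hxc]; exact hx)
  · exact hcl
  · intro x hx
    have hx' := h1 hx
    have hx2 : st' x ≠ 2 := by have : st' x = 1 := hx; omega
    simp only [Function.update_of_ne (hne hx2)]
    refine (h.tree x hx'.2).imp id (fun h2 => ⟨h1' h2.1 (fun hc => ?_), h2.2⟩)
    exact hx2 (hcl _ hc _ (mem_of_take h2.2.1))
  · intro x hx hxa
    have hx2 : st' x ≠ 2 := by have : st' x = 1 := hx; omega
    exact h.pend x (h1 hx).2 (fun hc => hxa (hancp hx2 hc))
  · intro x hx u hu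
    have hx2 : st' x ≠ 2 := by have : st' x = 1 := hx; omega
    by_cases hu2 : st' u = 2
    · exact Or.inl hu2
    rcases h.expl x (h1 hx).2 u hu with h2 | ⟨h2, h3⟩
    · left; exact (hst' u (fun hc => hu2 (hst u hc))).trans h2
    · right
      refine ⟨h1' h2 hu2, h3.imp id (Or.imp id (fun h4 => ⟨hancp hu2 h4.1, ?_⟩))⟩
      exact (Function.update_of_ne (hne hu2) _ _).trans h4.2
  · intro x hx
    have hx2 : st' x ≠ 2 := by have : st' x = 1 := hx; omega
    obtain ⟨w, g1, g2, g3, g4⟩ := h.link x (h1 hx).2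
    have hw : st' w ≠ 2 := fun hc => hx2 (hclR g4 hc)
    exact ⟨w, hancp hw g1, h1' g2 hw, g3, g4⟩
  · intro x hx hl
    have hx2 : st' x ≠ 2 := by have : st' x = 1 := hx; omega
    obtain ⟨g1, g2, g3, g4, g5⟩ := h.low x (h1 hx).2 hl
    have hrx := h.cyc_reach g2 g4 (h.cyc_root g2 g4) g1
    have hq : st' (S.low x) ≠ 2 := fun hc => hx2 (hclR hrx hc)
    have ht : st' (S.tail (S.low x)) ≠ 2 :=
      fun hc => hq (hclR (h.reach_tail g2 g4) hc)
    exact ⟨⟨hanc g1.1 ht, hanc g1.2 hx2⟩, h1' g2 hq, g3, g4, hancp hq g5⟩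
  · intro r hr ht
    have hr2 : st' r ≠ 2 := by have : st' r = 1 := hr; omega
    obtain ⟨g1, g2, g3, g4⟩ := h.tail r (h1 hr).2 ht
    have ht2 : st' (S.tail r) ≠ 2 := fun hc => hr2 (hcl _ hc _ (mem_of_take g3))
    exact ⟨g1, hanc g2 ht2, g3, h1' g4 ht2⟩

/-- With `cur = n` the current path contains no active node, so `link` has no witness. -/
theorem not_active (h : S.Inv n N) (hcur : S.cur = n) (x : ℕ) : S.st x ≠ 1 := by
  intro hx
  obtain ⟨w, h1, h2, -⟩ := h.link x hx
  have hn : S.st n = 0 := by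
    by_contra hc; exact absurd (h.lt n hc) (lt_irrefl n)
  rcases anc_cases h1 with h3 | h3
  · rw [← h3, hcur, hn] at h2; simp at h2
  · rw [hcur, hn] at h3; simp at h3

end Search.Inv

open WordRAM

/-! ### Reasoning about programs -/

/-- `p` halts from `σ`, and its running time and final state satisfy `Q`. -/
def wp (W : ℕ) (p : Program) (Q : ℕ → State → Prop) (σ : State) : Prop :=
  ∃ t τ, Run W p σ t τ ∧ Q t τ

section WP

variable {W : ℕ} {Q Q' : ℕ → State → Prop} {σ : State}

theorem wp.mono {p : Program} (h : wp W p Q σ) (hQ : ∀ t τ, Q t τ → Q' t τ) : wp W p Q' σ :=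
  let ⟨t, τ, h1, h2⟩ := h
  ⟨t, τ, h1, hQ t τ h2⟩

/-- The rules are equivalences, so rewriting with them executes straight-line code symbolically. -/
theorem wp_skip : wp W .skip Q σ ↔ Q 1 σ :=
  ⟨fun ⟨_, _, h, hQ⟩ => by cases h; exact hQ, fun h => ⟨_, _, .skip σ, h⟩⟩

theorem wp_setConst {x v : ℕ} : wp W (.setConst x v) Q σ ↔ v ≤ W ∧ Q 1 (σ.setReg x v) :=
  ⟨fun ⟨_, _, h, hQ⟩ => by cases h with | setConst _ _ _ h => exact ⟨h, hQ⟩,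
    fun h => ⟨_, _, .setConst σ x v h.1, h.2⟩⟩

theorem wp_move {x y : ℕ} : wp W (.move x y) Q σ ↔ Q 1 (σ.setReg x (σ.reg y)) :=
  ⟨fun ⟨_, _, h, hQ⟩ => by cases h; exact hQ, fun h => ⟨_, _, .move σ x y, h⟩⟩

theorem wp_plus {x y z : ℕ} : wp W (.plus x y z) Q σ ↔
    σ.reg y + σ.reg z ≤ W ∧ Q 1 (σ.setReg x (σ.reg y + σ.reg z)) :=
  ⟨fun ⟨_, _, h, hQ⟩ => by cases h with | plus _ _ _ _ h => exact ⟨h, hQ⟩,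
    fun h => ⟨_, _, .plus σ x y z h.1, h.2⟩⟩

theorem wp_load {x a y : ℕ} : wp W (.load x a y) Q σ ↔ Q 1 (σ.setReg x (σ.mem a (σ.reg y))) :=
  ⟨fun ⟨_, _, h, hQ⟩ => by cases h; exact hQ, fun h => ⟨_, _, .load σ x a y, h⟩⟩

theorem wp_store {a x y : ℕ} : wp W (.store a x y) Q σ ↔
    Q 1 (σ.setMem a (σ.reg x) (σ.reg y)) :=
  ⟨fun ⟨_, _, h, hQ⟩ => by cases h; exact hQ, fun h => ⟨_, _, .store σ a x y, h⟩⟩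

theorem wp_seq {p q : Program} : wp W (.seq p q) Q σ ↔
    wp W p (fun t τ => wp W q (fun u υ => Q (t + u) υ) τ) σ := by
  constructor
  · rintro ⟨_, _, h, hQ⟩
    cases h with
    | seq h1 h2 => exact ⟨_, _, h1, _, _, h2, hQ⟩
  · rintro ⟨t, τ, h1, u, υ, h2, hQ⟩
    exact ⟨_, _, .seq h1 h2, hQ⟩

theorem wp_ifLt {x y : ℕ} {p q : Program} : wp W (.ifLt x y p q) Q σ ↔
    (σ.reg x < σ.reg y → wp W p (fun t τ => Q (t + 1) τ) σ) ∧
    (¬ σ.reg x < σ.reg y → wp W q (fun t τ => Q (t + 1) τ) σ) := by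
  constructor
  · rintro ⟨_, _, h, hQ⟩
    cases h with
    | ifTrue h h1 => exact ⟨fun _ => ⟨_, _, h1, hQ⟩, fun h' => absurd h h'⟩
    | ifFalse h h1 => exact ⟨fun h' => absurd h' h, fun _ => ⟨_, _, h1, hQ⟩⟩
  · rintro ⟨h1, h2⟩
    by_cases h : σ.reg x < σ.reg y
    · obtain ⟨t, τ, h3, h4⟩ := h1 h
      exact ⟨_, _, .ifTrue h h3, h4⟩
    · obtain ⟨t, τ, h3, h4⟩ := h2 h
      exact ⟨_, _, .ifFalse h h3, h4⟩

/-- A loop whose invariant carries an upper bound for the remaining time. -/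
theorem wp_while {x y m : ℕ} {p : Program} (I : State → ℕ → Prop) (hI : I σ m)
    (hbody : ∀ σ m, I σ m → σ.reg x < σ.reg y →
      wp W p (fun t τ => ∃ m', I τ m' ∧ t + 1 + m' ≤ m) σ) :
    wp W (.whileLt x y p)
      (fun t τ => ∃ m', I τ m' ∧ ¬ τ.reg x < τ.reg y ∧ t + m' ≤ m + 1) σ := by
  induction m using Nat.strong_induction_on generalizing σ with
  | _ m ih =>
    by_cases h : σ.reg x < σ.reg y
    · obtain ⟨t, τ, h1, m', h2, h3⟩ := hbody σ m hI h
      obtain ⟨u, υ, h4, m'', h5, h6, h7⟩ := ih m' (by omega) h2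
      exact ⟨_, _, .whileTrue h h1 h4, m'', h5, h6, by omega⟩
    · exact ⟨1, σ, .whileFalse h, m, hI, h, by omega⟩

end WP

theorem reg_setReg (σ : State) (x v r : ℕ) :
    (σ.setReg x v).reg r = if r = x then v else σ.reg r := by
  simp [State.setReg, Function.update_apply]

theorem mem_setReg (σ : State) (x v : ℕ) : (σ.setReg x v).mem = σ.mem := rfl

theorem reg_setMem (σ : State) (a i v : ℕ) : (σ.setMem a i v).reg = σ.reg := rfl

theorem mem_setMem (σ : State) (a i v b : ℕ) :
    (σ.setMem a i v).mem b = if b = a then Function.update (σ.mem a) i v else σ.mem b := by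
  simp only [State.setMem, Function.update_apply]

/-! ### Frame conditions. -/

/-- The registers that a program may change. -/
def regs : Program → List ℕ
  | .skip => []
  | .setConst x _ => [x]
  | .move x _ => [x]
  | .plus x _ _ => [x]
  | .minus x _ _ => [x]
  | .load x _ _ => [x]
  | .store _ _ _ => []
  | .seq p q => regs p ++ regs q
  | .ifLt _ _ p q => regs p ++ regs q
  | .whileLt _ _ p => regs p

/-- The arrays that a program may change. -/
def arrays : Program → List ℕ
  | .store a _ _ => [a]
  | .seq p q => arrays p ++ arrays q
  | .ifLt _ _ p q => arrays p ++ arrays q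
  | .whileLt _ _ p => arrays p
  | _ => []

/-- `p` leaves all the other registers and arrays alone. -/
def Frame (p : Program) (σ τ : State) : Prop :=
  (∀ r, r ∉ regs p → τ.reg r = σ.reg r) ∧ ∀ a, a ∉ arrays p → τ.mem a = σ.mem a

/-- The condition is syntactic, so for a concrete program it is settled by `decide`. -/
theorem Frame.of_run {W t : ℕ} {p : Program} {σ τ : State} (h : Run W p σ t τ) :
    Frame p σ τ := by
  induction h with
  | skip => exact ⟨fun _ _ => rfl, fun _ _ => rfl⟩
  | seq _ _ ih1 ih2 =>
    refine ⟨fun r hr => ?_, fun a ha => ?_⟩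
    · simp only [regs, List.mem_append, not_or] at hr
      rw [ih2.1 r hr.2, ih1.1 r hr.1]
    · simp only [arrays, List.mem_append, not_or] at ha
      rw [ih2.2 a ha.2, ih1.2 a ha.1]
  | ifTrue _ _ ih =>
    refine ⟨fun r hr => ?_, fun a ha => ?_⟩
    · simp only [regs, List.mem_append, not_or] at hr
      exact ih.1 r hr.1
    · simp only [arrays, List.mem_append, not_or] at ha
      exact ih.2 a ha.1
  | ifFalse _ _ ih =>
    refine ⟨fun r hr => ?_, fun a ha => ?_⟩
    · simp only [regs, List.mem_append, not_or] at hr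
      exact ih.1 r hr.2
    · simp only [arrays, List.mem_append, not_or] at ha
      exact ih.2 a ha.2
  | whileTrue _ _ _ ih1 ih2 =>
    refine ⟨fun r hr => ?_, fun a ha => ?_⟩
    · rw [ih2.1 r hr, ih1.1 r hr]
    · rw [ih2.2 a ha, ih1.2 a ha]
  | whileFalse => exact ⟨fun _ _ => rfl, fun _ _ => rfl⟩
  | store =>
    refine ⟨fun r _ => rfl, fun a ha => ?_⟩
    simp only [arrays, List.mem_singleton] at ha
    simp [mem_setMem, ha]
  | _ =>
    refine ⟨fun r hr => ?_, fun a _ => rfl⟩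
    simp only [regs, List.mem_singleton] at hr
    simp [reg_setReg, hr]

theorem wp.frame {W : ℕ} {p : Program} {Q : ℕ → State → Prop} {σ : State} (h : wp W p Q σ) :
    wp W p (fun t τ => Frame p σ τ ∧ Q t τ) σ :=
  let ⟨t, τ, h1, h2⟩ := h
  ⟨t, τ, h1, Frame.of_run h1, h2⟩

theorem Frame.refl (p : Program) (σ : State) : Frame p σ σ := ⟨fun _ _ => rfl, fun _ _ => rfl⟩

theorem Frame.trans {p : Program} {σ τ υ : State} (h : Frame p σ τ) (h' : Frame p τ υ) :
    Frame p σ υ :=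
  ⟨fun r hr => (h'.1 r hr).trans (h.1 r hr), fun a ha => (h'.2 a ha).trans (h.2 a ha)⟩

theorem wp_while_frame {W x y m : ℕ} {p : Program} {σ : State} (I : State → ℕ → Prop) (hI : I σ m)
    (hbody : ∀ τ m, Frame p σ τ → I τ m → τ.reg x < τ.reg y →
      wp W p (fun t υ => ∃ m', I υ m' ∧ t + 1 + m' ≤ m) τ) :
    wp W (.whileLt x y p)
      (fun t τ => Frame p σ τ ∧ ∃ m', I τ m' ∧ ¬ τ.reg x < τ.reg y ∧ t + m' ≤ m + 1) σ := by
  refine (wp_while (fun τ m => Frame p σ τ ∧ I τ m) ⟨Frame.refl p σ, hI⟩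
    fun τ m hτ hlt => (hbody τ m hτ.1 hτ.2 hlt).frame.mono ?_).mono ?_
  · rintro t υ ⟨hF, m', h1, h2⟩
    exact ⟨m', ⟨hτ.1.trans hF, h1⟩, h2⟩
  · rintro t τ ⟨m', ⟨hF, h1⟩, h2⟩
    exact ⟨hF, m', h1, h2⟩

/-! ### Running through a list -/

/-- Register `4` runs from its present value up to the value of register `5`; each time the word of
the input at this address is loaded into register `6`. -/
def forEach (p : Program) : Program :=
  .whileLt 4 5 (.seq (.load 6 0 4) (.seq p (.plus 4 4 1)))

/-- The list `l` stands in `f` at `b`. -/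
def ListAt (f : ℕ → ℕ) (b : ℕ) (l : List ℕ) : Prop := ∀ j (h : j < l.length), f (b + j) = l[j]

/-- The invariant `J` may not depend on the loop registers 4 and 6. The 3 extra steps per entry are
the test, the load and the increment. -/
theorem wp_forEach {W T b : ℕ} {p : Program} {σ : State} {l : List ℕ} (J : ℕ → State → Prop)
    (hp : 1 ∉ regs p ∧ 4 ∉ regs p ∧ 5 ∉ regs p ∧ 0 ∉ arrays p)
    (h1 : σ.reg 1 = 1) (h4 : σ.reg 4 = b) (h5 : σ.reg 5 = b + l.length)
    (hl : ListAt (σ.mem 0) b l) (hW : b + l.length ≤ W) (hJ : J 0 σ)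
    (hJs : ∀ j σ v, J j σ → J j (σ.setReg 4 v) ∧ J j (σ.setReg 6 v))
    (hbody : ∀ j (h : j < l.length) (τ : State), τ.reg 6 = l[j] → τ.reg 4 = b + j →
      Frame (forEach p) σ τ → J j τ → wp W p (fun t υ => t ≤ T ∧ J (j + 1) υ) τ) :
    wp W (forEach p)
      (fun t τ => t ≤ (T + 3) * l.length + 1 ∧ Frame (forEach p) σ τ ∧ J l.length τ) σ := by
  have hfr : ∀ {τ}, Frame (forEach p) σ τ → τ.reg 1 = 1 ∧ τ.reg 5 = b + l.length ∧
      τ.mem 0 = σ.mem 0 := fun h =>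
    ⟨(h.1 1 (by simp [forEach, regs, hp])).trans h1,
      (h.1 5 (by simp [forEach, regs, hp])).trans h5,
      h.2 0 (by simp [forEach, arrays, hp])⟩
  have := wp_while (W := W) (σ := σ) (x := 4) (y := 5) (m := (T + 3) * l.length)
    (p := .seq (.load 6 0 4) (.seq p (.plus 4 4 1)))
    (fun τ m => Frame (forEach p) σ τ ∧ ∃ j ≤ l.length, τ.reg 4 = b + j ∧ J j τ ∧
      m = (T + 3) * (l.length - j)) ⟨⟨fun _ _ => rfl, fun _ _ => rfl⟩, 0, by omega, h4, hJ, rfl⟩ ?_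
  · refine this.mono ?_
    rintro t τ ⟨m', ⟨hF, j, hj, h4', hJ', hm⟩, hlt, ht⟩
    obtain ⟨-, h5', -⟩ := hfr hF
    have hjl : j = l.length := by omega
    subst hjl
    exact ⟨by simp at hm; omega, hF, hJ'⟩
  · rintro τ m ⟨hF, j, hj, h4', hJ', hm⟩ hlt
    obtain ⟨h1', h5', h0'⟩ := hfr hF
    have hjl : j < l.length := by omega
    have hmem : τ.mem 0 (b + j) = l[j] := by rw [h0']; exact hl j hjl
    have hF' : Frame (forEach p) σ (τ.setReg 6 l[j]) :=
      ⟨fun r hr => by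
        rw [reg_setReg, if_neg (by rintro rfl; simp [forEach, regs] at hr), hF.1 r hr],
        fun a ha => hF.2 a ha⟩
    simp only [wp_seq, wp_load, h4', hmem]
    refine (hbody j hjl _ (by simp [reg_setReg]) (by simp [reg_setReg, h4']) hF'
      (hJs _ _ _ hJ').2).frame.mono ?_
    rintro t υ ⟨hFp, ht, hJ''⟩
    have e4 : υ.reg 4 = b + j := by rw [hFp.1 4 hp.2.1]; simp [reg_setReg, h4']
    have e1 : υ.reg 1 = 1 := by rw [hFp.1 1 hp.1]; simp [reg_setReg, h1']
    rw [wp_plus, e4, e1]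
    refine ⟨by omega, (T + 3) * (l.length - (j + 1)), ⟨⟨fun r hr => ?_, fun a ha => ?_⟩, j + 1,
        by omega, ?_, (hJs _ _ _ hJ'').1, rfl⟩, ?_⟩
    · have hr' := hr
      simp only [forEach, regs, List.mem_append, List.mem_singleton, not_or] at hr'
      rw [reg_setReg, if_neg hr'.2.2, hFp.1 r hr'.2.1, hF'.1 r hr]
    · have ha' := ha
      simp only [forEach, arrays, List.mem_append, not_or] at ha'
      rw [mem_setReg, hFp.2 a ha'.2.1, hF'.2 a ha]
    · simp [reg_setReg, add_assoc]
    · rw [hm, show l.length - j = (l.length - (j + 1)) + 1 by omega, Nat.mul_add]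
      omega

/-! ### The inner loops

Registers: `0`, `1`, `2` hold these constants, `3` the number of nodes, `4`, `5`, `6` serve the
loops through lists, `7`, `8` are auxiliary, `9` counts nodes,
    `10` is the current node of the search
and `11` its parent, `12` and `21` are nodes of the component being coloured, `13` is a flag,
    `14` the
maximal weight, `15` a colour that attains it, `16` the last stamp, `17` the least valid stamp, `18`
the size of the component, `19` and `22` control the rounds, `20` is a colour.

Arrays: `0` input, `1` colours, `2` addresses of the lists of neighbours,
    `3` addresses of the lengths
of the lists of colours, `4` addresses of the next neighbours to explore, `5` status, `6` parent,
`7` root of the cycle, `8` end of the cycle, `9` weights, `10` flags of the best colours,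
    `11` stamps
of the colours. -/

/-- A status is at most 2, so the test `1 < status` singles out the finished neighbours. -/
def countBody : Program :=
  .seq (.load 7 5 6) (.ifLt 1 7
    (.seq (.load 8 1 6) (.seq (.load 7 9 8) (.seq (.plus 7 7 1) (.store 9 8 7)))) .skip)

def bestBody : Program :=
  .seq (.load 7 9 6) (.ifLt 14 7 (.seq (.move 14 7) (.move 15 6)) .skip)

/-- The flags in array 10 are indexed by input addresses, so each pair of a node and one of its
colours has a flag of its own. -/
def markBody : Program :=
  .seq (.load 7 9 6) (.ifLt 7 14 (.store 10 4 0)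
    (.seq (.store 10 4 1) (.seq (.load 7 11 6) (.ifLt 7 17 .skip (.store 11 6 16)))))

def resetBody : Program := .seq (.load 7 1 6) (.store 9 7 0)

def checkBody : Program :=
  .seq (.load 7 10 4) (.ifLt 0 7
    (.seq (.load 8 11 6) (.ifLt 8 16 .skip (.store 1 10 6))) .skip)

def scanBody : Program :=
  .seq (.load 7 10 4) (.ifLt 0 7
    (.ifLt 6 20 .skip (.ifLt 20 6 .skip (.store 1 21 20))) .skip)

section Loops

variable {W b : ℕ} {σ : State} {l : List ℕ}
  (h0 : σ.reg 0 = 0) (h1 : σ.reg 1 = 1) (h4 : σ.reg 4 = b) (h5 : σ.reg 5 = b + l.length)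
  (hl : ListAt (σ.mem 0) b l) (hW : b + l.length ≤ W)

include h1 h4 h5 hl hW

theorem wp_count (hst : ∀ x, σ.mem 5 x ≤ 2) (h9 : σ.mem 9 = fun _ => 0) :
    wp W (forEach countBody) (fun t τ => t ≤ 9 * l.length + 1 ∧ Frame (forEach countBody) σ τ ∧
      τ.mem 9 = fun c => l.countP (fun u => decide (σ.mem 5 u = 2 ∧ σ.mem 1 u = c))) σ := by
  refine (wp_forEach (T := 6) (fun j τ => τ.mem 9 = fun c =>
    (l.take j).countP (fun u => decide (σ.mem 5 u = 2 ∧ σ.mem 1 u = c)))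
    (by decide) h1 h4 h5 hl hW (by simp [h9]) (fun j σ v h => ⟨h, h⟩) ?_).mono ?_
  · intro j hj τ h6 h4' hF hJ
    have e1 : τ.reg 1 = 1 := (hF.1 1 (by decide)).trans h1
    have e5 : τ.mem 5 = σ.mem 5 := hF.2 5 (by decide)
    have em : τ.mem 1 = σ.mem 1 := hF.2 1 (by decide)
    have hle := hst l[j]
    have hc : (l.take j).countP (fun u => decide (σ.mem 5 u = 2 ∧ σ.mem 1 u = σ.mem 1 l[j])) ≤ j :=
      List.countP_le_length.trans (by simp)
    simp only [countBody, wp_seq, wp_load, wp_ifLt, wp_plus, wp_store, wp_skip, reg_setReg,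
        mem_setReg,
      mem_setMem, h6, e1, e5, em, hJ]
    simp only [Bool.decide_and] at hc ⊢
    simp
    refine ⟨fun h => ⟨by omega, ?_⟩, fun h => ?_⟩
    · have h2 : σ.mem 5 l[j] = 2 := by omega
      funext c
      rw [List.take_succ_eq_append_getElem hj, List.countP_append]
      by_cases hcc : c = σ.mem 1 l[j]
      · simp [hcc, h2]
      · simp [hcc, h2, Ne.symm hcc]
    · have h2 : σ.mem 5 l[j] ≠ 2 := by omega
      funext c
      rw [List.take_succ_eq_append_getElem hj, List.countP_append]
      simp [h2]
  · rintro t τ ⟨h, hF, hJ⟩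
    refine ⟨h, hF, ?_⟩
    rw [hJ, List.take_length]

/-- If all weights are 0 the strict test never succeeds; therefore register 15 has to hold a colour
of the list from the start. -/
theorem wp_best (h14 : σ.reg 14 = 0) (h15 : σ.reg 15 ∈ l) :
    wp W (forEach bestBody) (fun t τ => t ≤ 7 * l.length + 1 ∧ Frame (forEach bestBody) σ τ ∧
      τ.reg 15 ∈ l ∧ τ.reg 14 = σ.mem 9 (τ.reg 15) ∧ ∀ c ∈ l, σ.mem 9 c ≤ τ.reg 14) σ := by
  refine (wp_forEach (T := 4) (fun j τ => τ.reg 15 ∈ l ∧ τ.reg 14 ≤ σ.mem 9 (τ.reg 15) ∧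
    ∀ c ∈ l.take j, σ.mem 9 c ≤ τ.reg 14)
    (by decide) h1 h4 h5 hl hW (by simp [h14, h15]) (fun j σ v h => by simpa [reg_setReg] using h)
      ?_).mono ?_
  · rintro j hj τ h6 h4' hF ⟨hJ1, hJ2, hJ3⟩
    have e9 : τ.mem 9 = σ.mem 9 := hF.2 9 (by decide)
    simp only [bestBody, wp_seq, wp_load, wp_ifLt, wp_move, wp_skip, reg_setReg, h6, e9,
      List.take_succ_eq_append_getElem hj, List.mem_append, List.mem_singleton]
    simp
    refine ⟨fun h c hc => ?_, fun h => ⟨hJ1, hJ2, fun c hc => ?_⟩⟩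
    · rcases hc with hc | rfl
      · exact (hJ3 c hc).trans h.le
      · exact le_rfl
    · rcases hc with hc | rfl
      · exact hJ3 c hc
      · exact h
  · rintro t τ ⟨h, hF, hJ1, hJ2, hJ3⟩
    rw [List.take_length] at hJ3
    exact ⟨h, hF, hJ1, le_antisymm hJ2 (hJ3 _ hJ1), hJ3⟩

open Classical in
include h0 in
theorem wp_mark (hg : σ.reg 17 ≤ σ.reg 16) :
    wp W (forEach markBody) (fun t τ => t ≤ 9 * l.length + 1 ∧ Frame (forEach markBody) σ τ ∧
      (∀ i (h : i < l.length), τ.mem 10 (b + i) = if σ.mem 9 l[i] < σ.reg 14 then 0 else 1) ∧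
      (∀ a, (a < b ∨ b + l.length ≤ a) → τ.mem 10 a = σ.mem 10 a) ∧
      ∀ c, τ.mem 11 c = if c ∈ l ∧ ¬ σ.mem 9 c < σ.reg 14 ∧ ¬ σ.mem 11 c < σ.reg 17 then σ.reg 16
        else σ.mem 11 c) σ := by
  refine (wp_forEach (T := 6) (fun j τ =>
      (∀ i (h : i < l.length), i < j →
        τ.mem 10 (b + i) = if σ.mem 9 l[i] < σ.reg 14 then 0 else 1) ∧
      (∀ a, (a < b ∨ b + j ≤ a) → τ.mem 10 a = σ.mem 10 a) ∧
      ∀ c, τ.mem 11 c = if c ∈ l.take j ∧ ¬ σ.mem 9 c < σ.reg 14 ∧ ¬ σ.mem 11 c < σ.reg 17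
        then σ.reg 16 else σ.mem 11 c)
    (by decide) h1 h4 h5 hl hW (by simp) (fun j σ v h => ⟨h, h⟩) ?_).mono ?_
  · rintro j hj τ h6 h4' hF ⟨hJ1, hJ2, hJ3⟩
    have e0 : τ.reg 0 = 0 := (hF.1 0 (by decide)).trans h0
    have e1 : τ.reg 1 = 1 := (hF.1 1 (by decide)).trans h1
    have e14 : τ.reg 14 = σ.reg 14 := hF.1 14 (by decide)
    have e16 : τ.reg 16 = σ.reg 16 := hF.1 16 (by decide)
    have e17 : τ.reg 17 = σ.reg 17 := hF.1 17 (by decide)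
    have e9 : τ.mem 9 = σ.mem 9 := hF.2 9 (by decide)
    simp only [markBody, wp_seq, wp_load, wp_ifLt, wp_store, wp_skip, reg_setReg, mem_setReg, h6,
        e9,
      mem_setMem, reg_setMem, h4', e0, e1, e14, e16, e17]
    have htake : ∀ c, c ∈ l.take (j + 1) ↔ c ∈ l.take j ∨ c = l[j] := fun c => by
      rw [List.take_succ_eq_append_getElem hj, List.mem_append, List.mem_singleton]
    have good : ∀ v, v = (if σ.mem 9 l[j] < σ.reg 14 then 0 else 1) →
        (∀ i (h : i < l.length), i ≤ j → Function.update (τ.mem 10) (b + j) v (b + i) =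
          if σ.mem 9 l[i] < σ.reg 14 then 0 else 1) ∧
        ∀ a, (a < b ∨ b + (j + 1) ≤ a) → Function.update (τ.mem 10) (b + j) v a = σ.mem 10 a := by
      refine fun v hv => ⟨fun i hi hij => ?_, fun a ha => ?_⟩
      · by_cases hij' : i = j
        · subst hij'; simp [hv]
        · rw [Function.update_of_ne (by omega)]; exact hJ1 i hi (by omega)
      · rw [Function.update_of_ne (by omega)]; exact hJ2 a (by omega)
    simp
    refine ⟨fun h => ?_, fun h => ⟨fun h' => ?_, fun h' => ?_⟩⟩
    · obtain ⟨g1, g2⟩ := good 0 (by simp [h])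
      refine ⟨g1, g2, fun c => ?_⟩
      rw [hJ3]
      simp only [htake]
      by_cases hc : c = l[j]
      · subst hc; simp [h]
      · simp [hc]
    · obtain ⟨g1, g2⟩ := good 1 (by simp [h])
      refine ⟨g1, g2, fun c => ?_⟩
      rw [hJ3]
      simp only [htake]
      by_cases hc : c = l[j]
      · subst hc
        have h17 : σ.mem 11 l[j] < σ.reg 17 := by
          rw [hJ3] at h'
          split_ifs at h' with h2
          · omega
          · exact h'
        simp [h17]
      · simp [hc]
    · obtain ⟨g1, g2⟩ := good 1 (by simp [h])
      refine ⟨g1, g2, fun c => ?_⟩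
      simp only [htake]
      by_cases hc : c = l[j]
      · subst hc
        simp only [Function.update_self]
        rw [hJ3] at h'
        split_ifs at h' with h2
        · simp [h2.2.1, h2.2.2]
        · simp [h, h']
      · rw [Function.update_of_ne hc, hJ3]; simp [hc]
  · rintro t τ ⟨h, hF, hJ1, hJ2, hJ3⟩
    rw [List.take_length] at hJ3
    exact ⟨h, hF, fun i hi => hJ1 i hi hi, hJ2, hJ3⟩

-- Only colours of neighbours can have a non-zero weight, so a second pass over the neighbours
-- clears the table at a cost independent of the number of colours.
include h0 in
theorem wp_reset (h9 : ∀ c, (∀ u ∈ l, σ.mem 1 u ≠ c) → σ.mem 9 c = 0) :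
    wp W (forEach resetBody) (fun t τ => t ≤ 5 * l.length + 1 ∧ Frame (forEach resetBody) σ τ ∧
      τ.mem 9 = fun _ => 0) σ := by
  refine (wp_forEach (T := 2) (fun j τ => ∀ c, (∀ u ∈ l.drop j, σ.mem 1 u ≠ c) → τ.mem 9 c = 0)
    (by decide) h1 h4 h5 hl hW (by simpa using h9) (fun j σ v h => ⟨h, h⟩) ?_).mono ?_
  · rintro j hj τ h6 h4' hF hJ
    have e0 : τ.reg 0 = 0 := (hF.1 0 (by decide)).trans h0
    have em : τ.mem 1 = σ.mem 1 := hF.2 1 (by decide)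
    simp only [resetBody, wp_seq, wp_load, wp_store, reg_setReg, mem_setReg, h6, em,
      mem_setMem, e0]
    simp only [Nat.reduceEqDiff, ↓reduceIte]
    refine ⟨by omega, fun c hc => ?_⟩
    by_cases hcc : c = σ.mem 1 l[j]
    · subst hcc; simp
    · rw [Function.update_of_ne hcc]
      apply hJ
      intro u hu
      rw [List.drop_eq_getElem_cons hj] at hu
      rcases List.mem_cons.1 hu with rfl | hu
      · exact Ne.symm hcc
      · exact hc u hu
  · rintro t τ ⟨h, hF, hJ⟩
    refine ⟨h, hF, ?_⟩
    funext c
    exact hJ c (by simp)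

-- The last clause is used with the newest stamp in register 16: if some best colour of the root is
-- common to the whole component, the root ends up with a common one.
include h0 in
theorem wp_check :
    wp W (forEach checkBody) (fun t τ => t ≤ 8 * l.length + 1 ∧ Frame (forEach checkBody) σ τ ∧
      ∃ x, τ.mem 1 = Function.update (σ.mem 1) (σ.reg 10) x ∧
        (x = σ.mem 1 (σ.reg 10) ∨ ∃ i, ∃ h : i < l.length, x = l[i] ∧ 0 < σ.mem 10 (b + i)) ∧
        ∀ i (h : i < l.length), 0 < σ.mem 10 (b + i) → σ.reg 16 ≤ σ.mem 11 l[i] →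
          σ.reg 16 ≤ σ.mem 11 x) σ := by
  refine (wp_forEach (T := 5) (fun j τ => ∃ x,
        τ.mem 1 = Function.update (σ.mem 1) (σ.reg 10) x ∧
        (x = σ.mem 1 (σ.reg 10) ∨ ∃ i, ∃ h : i < l.length, x = l[i] ∧ 0 < σ.mem 10 (b + i)) ∧
        ∀ i (h : i < l.length), i < j → 0 < σ.mem 10 (b + i) → σ.reg 16 ≤ σ.mem 11 l[i] →
          σ.reg 16 ≤ σ.mem 11 x)
    (by decide) h1 h4 h5 hl hW ⟨σ.mem 1 (σ.reg 10), by simp⟩ (fun j σ v h => ⟨h, h⟩) ?_).mono ?_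
  · rintro j hj τ h6 h4' hF ⟨x, hx1, hx2, hx3⟩
    have e0 : τ.reg 0 = 0 := (hF.1 0 (by decide)).trans h0
    have e10 : τ.reg 10 = σ.reg 10 := hF.1 10 (by decide)
    have e16 : τ.reg 16 = σ.reg 16 := hF.1 16 (by decide)
    have m10 : τ.mem 10 = σ.mem 10 := hF.2 10 (by decide)
    have m11 : τ.mem 11 = σ.mem 11 := hF.2 11 (by decide)
    simp only [checkBody, wp_seq, wp_load, wp_ifLt, wp_store, wp_skip, reg_setReg, mem_setReg,
      mem_setMem, h6, h4', e0, e10, e16, m10, m11, hx1]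
    simp only [Nat.reduceEqDiff, ↓reduceIte, Function.update_idem]
    refine ⟨fun h => ⟨fun h' => ⟨by omega, x, rfl, hx2, fun i hi hij g1 g2 => ?_⟩,
      fun h' => ⟨by omega, l[j], rfl, Or.inr ⟨j, hj, rfl, h⟩, fun i hi hij g1 g2 => by omega⟩⟩,
      fun h => ⟨by omega, x, rfl, hx2, fun i hi hij g1 g2 => ?_⟩⟩
    · rcases Nat.lt_succ_iff_lt_or_eq.1 hij with hij | rfl
      · exact hx3 i hi hij g1 g2
      · omega
    · rcases Nat.lt_succ_iff_lt_or_eq.1 hij with hij | rfl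
      · exact hx3 i hi hij g1 g2
      · omega
  · rintro t τ ⟨h, hF, x, hx1, hx2, hx3⟩
    exact ⟨h, hF, x, hx1, hx2, fun i hi => hx3 i hi hi⟩

open Classical in
include h0 in
theorem wp_scan :
    wp W (forEach scanBody) (fun t τ => t ≤ 8 * l.length + 1 ∧ Frame (forEach scanBody) σ τ ∧
      τ.mem 1 = if ∃ i, ∃ h : i < l.length, l[i] = σ.reg 20 ∧ 0 < σ.mem 10 (b + i) then
        Function.update (σ.mem 1) (σ.reg 21) (σ.reg 20) else σ.mem 1) σ := by
  refine (wp_forEach (T := 5) (fun j τ =>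
      τ.mem 1 = if ∃ i, ∃ h : i < l.length, i < j ∧ l[i] = σ.reg 20 ∧ 0 < σ.mem 10 (b + i) then
        Function.update (σ.mem 1) (σ.reg 21) (σ.reg 20) else σ.mem 1)
    (by decide) h1 h4 h5 hl hW (by simp) (fun j σ v h => ⟨h, h⟩) ?_).mono ?_
  · rintro j hj τ h6 h4' hF hJ
    have e0 : τ.reg 0 = 0 := (hF.1 0 (by decide)).trans h0
    have e20 : τ.reg 20 = σ.reg 20 := hF.1 20 (by decide)
    have e21 : τ.reg 21 = σ.reg 21 := hF.1 21 (by decide)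
    have m10 : τ.mem 10 = σ.mem 10 := hF.2 10 (by decide)
    have keep : ¬ (l[j] = σ.reg 20 ∧ 0 < σ.mem 10 (b + j)) →
        τ.mem 1 = if ∃ i, ∃ h : i < l.length, i < j + 1 ∧ l[i] = σ.reg 20 ∧ 0 < σ.mem 10 (b + i)
          then Function.update (σ.mem 1) (σ.reg 21) (σ.reg 20) else σ.mem 1 := by
      intro hn
      rw [hJ]
      refine if_congr ⟨fun ⟨i, h, h'⟩ => ⟨i, h, by omega, h'.2⟩, fun ⟨i, h, h', h''⟩ => ?_⟩ rfl rfl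
      rcases Nat.lt_succ_iff_lt_or_eq.1 h' with hij | rfl
      · exact ⟨i, h, hij, h''⟩
      · exact absurd h'' hn
    have copy : l[j] = σ.reg 20 → 0 < σ.mem 10 (b + j) →
        Function.update (τ.mem 1) (σ.reg 21) (σ.reg 20) =
        if ∃ i, ∃ h : i < l.length, i < j + 1 ∧ l[i] = σ.reg 20 ∧ 0 < σ.mem 10 (b + i)
          then Function.update (σ.mem 1) (σ.reg 21) (σ.reg 20) else σ.mem 1 := by
      intro g1 g2
      rw [if_pos ⟨j, hj, by omega, g1, g2⟩, hJ]
      split_ifs <;> simp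
    simp only [scanBody, wp_seq, wp_load, wp_ifLt, wp_store, wp_skip, reg_setReg, mem_setReg,
      mem_setMem, h6, h4', e0, m10]
    simp only [Nat.reduceEqDiff, ↓reduceIte, e20, e21]
    refine ⟨fun h => ⟨fun h' => ⟨by omega, keep (by omega)⟩, fun h' => ⟨fun h'' =>
      ⟨by omega, keep (by omega)⟩, fun h'' => ⟨by omega, copy (by omega) h⟩⟩⟩,
      fun h => ⟨by omega, keep (by omega)⟩⟩
  · rintro t τ ⟨h, hF, hJ⟩
    refine ⟨h, hF, ?_⟩
    rw [hJ]
    exact if_congr ⟨fun ⟨i, h, h'⟩ => ⟨i, h, h'.2⟩, fun ⟨i, h, h'⟩ => ⟨i, h, h, h'⟩⟩ rfl rfl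

end Loops

/-! ### Colouring a component -/

/-- The length of the description of the node `x` in the input. -/
def cost (N A : ℕ → List ℕ) (x : ℕ) : ℕ := (N x).length + (A x).length + 2

/-- The position of the description of the node `x` in the input. -/
def offset (N A : ℕ → List ℕ) (x : ℕ) : ℕ := 2 + ∑ i ∈ Finset.range x, cost N A i

/-- The address of the list of colours of the node `x`. -/
def colAddr (N A : ℕ → List ℕ) (x : ℕ) : ℕ := offset N A x + 2 + (N x).length

theorem offset_succ (N A : ℕ → List ℕ) (x : ℕ) :
    offset N A (x + 1) = offset N A x + cost N A x := by
  simp [offset, Finset.sum_range_succ, add_assoc]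

theorem offset_mono (N A : ℕ → List ℕ) {x y : ℕ} (h : x ≤ y) : offset N A x ≤ offset N A y :=
  Nat.add_le_add_left (Finset.sum_le_sum_of_subset (Finset.range_mono h)) 2

/-- The words of the input that describe the nodes. -/
structure Layout (n : ℕ) (N A : ℕ → List ℕ) (f : ℕ → ℕ) : Prop where
  nbrs : ∀ x < n, ListAt f (offset N A x + 1) (N x)
  ncols : ∀ x < n, f (offset N A x + 1 + (N x).length) = (A x).length
  cols : ∀ x < n, ListAt f (colAddr N A x) (A x)

/-- The registers and arrays that never change after the initialization. -/
structure Env (n : ℕ) (N A : ℕ → List ℕ) (σ : State) : Prop where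
  r0 : σ.reg 0 = 0
  r1 : σ.reg 1 = 1
  r2 : σ.reg 2 = 2
  r3 : σ.reg 3 = n
  layout : Layout n N A (σ.mem 0)
  nb : ∀ x < n, σ.mem 2 x = offset N A x + 1
  na : ∀ x < n, σ.mem 3 x = offset N A x + 1 + (N x).length

theorem Env.congr {n : ℕ} {N A : ℕ → List ℕ} {σ τ : State} (h : Env n N A σ)
    (hr : ∀ r < 4, τ.reg r = σ.reg r) (h0 : τ.mem 0 = σ.mem 0) (h2 : τ.mem 2 = σ.mem 2)
    (h3 : τ.mem 3 = σ.mem 3) : Env n N A τ where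
  r0 := (hr 0 (by decide)).trans h.r0
  r1 := (hr 1 (by decide)).trans h.r1
  r2 := (hr 2 (by decide)).trans h.r2
  r3 := (hr 3 (by decide)).trans h.r3
  layout := by rw [h0]; exact h.layout
  nb := by rw [h2]; exact h.nb
  na := by rw [h3]; exact h.na

theorem Env.of_frame {n : ℕ} {N A : ℕ → List ℕ} {σ τ : State} {p : Program} (h : Env n N A σ)
    (hF : Frame p σ τ)
    (hp : (∀ r < 4, r ∉ regs p) ∧ 0 ∉ arrays p ∧ 2 ∉ arrays p ∧ 3 ∉ arrays p) : Env n N A τ :=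
  h.congr (fun r hr => hF.1 r (hp.1 r hr)) (hF.2 0 hp.2.1) (hF.2 2 hp.2.2.1) (hF.2 3 hp.2.2.2)

/-- Run through the neighbours of the node in register `y`. -/
def loopNbrs (y : ℕ) (p : Program) : Program :=
  -- The word that holds the number of colours directly follows the neighbours, so its address in
  -- array 3 is the end of their list.
  .seq (.load 4 2 y) (.seq (.load 5 3 y) (forEach p))

/-- Run through the colours of the node in register `y`. -/
def loopCols (y : ℕ) (p : Program) : Program :=
  .seq (.load 4 3 y) (.seq (.load 5 0 4) (.seq (.plus 4 4 1) (.seq (.plus 5 4 5) (forEach p))))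

section Component

variable {n W : ℕ} {N A : ℕ → List ℕ} {σ : State}

theorem wp_loopNbrs {x y : ℕ} {p : Program} {Q : ℕ → State → Prop} (hE : Env n N A σ)
    (hW : offset N A n ≤ W) (hx : x < n) (hy : σ.reg y = x) (hy4 : y ≠ 4)
    (h : ∀ τ : State, τ.reg 4 = offset N A x + 1 → τ.reg 5 = offset N A x + 1 + (N x).length →
      ListAt (τ.mem 0) (offset N A x + 1) (N x) → offset N A x + 1 + (N x).length ≤ W →
      (∀ r, r ≠ 4 → r ≠ 5 → τ.reg r = σ.reg r) → τ.mem = σ.mem →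
      wp W (forEach p) (fun t υ => Q (t + 2) υ) τ) : wp W (loopNbrs y p) Q σ := by
  simp only [loopNbrs, wp_seq, wp_load, reg_setReg, if_neg hy4, mem_setReg, hy, hE.nb x hx,
      hE.na x hx]
  have hb : offset N A x + cost N A x ≤ W :=
    ((offset_succ N A x).symm.le.trans (offset_mono N A hx)).trans hW
  refine (h _ ?_ ?_ ?_ ?_ ?_ ?_).mono ?_
  · simp [reg_setReg]
  · simp [reg_setReg]
  · exact hE.layout.nbrs x hx
  · rw [cost] at hb; omega
  · intro r h4 h5; simp [reg_setReg, h4, h5]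
  · rfl
  · intro t τ hQ
    rwa [show 1 + (1 + t) = t + 2 by ring]

theorem wp_loopCols {x y : ℕ} {p : Program} {Q : ℕ → State → Prop} (hE : Env n N A σ)
    (hW : offset N A n ≤ W) (hx : x < n) (hy : σ.reg y = x)
    (h : ∀ τ : State, τ.reg 4 = colAddr N A x → τ.reg 5 = colAddr N A x + (A x).length →
      ListAt (τ.mem 0) (colAddr N A x) (A x) → colAddr N A x + (A x).length ≤ W →
      (∀ r, r ≠ 4 → r ≠ 5 → τ.reg r = σ.reg r) → τ.mem = σ.mem →
      wp W (forEach p) (fun t υ => Q (t + 4) υ) τ) : wp W (loopCols y p) Q σ := by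
  have hb : offset N A x + cost N A x ≤ W :=
    ((offset_succ N A x).symm.le.trans (offset_mono N A hx)).trans hW
  rw [cost] at hb
  have hb' : colAddr N A x + (A x).length ≤ W := by rw [colAddr]; omega
  simp only [loopCols, wp_seq, wp_load, wp_plus, reg_setReg, mem_setReg, hy, hE.na x hx]
  simp only [Nat.reduceEqDiff, ↓reduceIte, hE.r1, hE.layout.ncols x hx, OfNat.one_ne_ofNat]
  refine ⟨by omega, by omega, (h _ ?_ ?_ ?_ hb' ?_ ?_).mono ?_⟩
  · simp [reg_setReg, colAddr]; omega
  · simp [reg_setReg, colAddr]; omega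
  · exact hE.layout.cols x hx
  · intro r h4 h5; simp [reg_setReg, h4, h5]
  · rfl
  · intro t τ hQ
    rwa [show 1 + (1 + (1 + (1 + t))) = t + 4 by ring]

/-- Find the best colours of the node in register `12` and choose one of them. -/
def procNode : Program :=
  .seq (loopNbrs 12 countBody) (.seq (.move 14 0) (.seq (.load 4 3 12) (.seq (.plus 4 4 1)
    (.seq (.load 15 0 4) (.seq (loopCols 12 bestBody) (.seq (.plus 16 16 1)
      (.seq (loopCols 12 markBody) (.seq (.move 17 16) (.seq (loopNbrs 12 resetBody)
        (.store 1 12 15))))))))))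

/-- A colour receives the new stamp if it is best for `x` and its previous stamp was still valid.
Iterated over a component, the newest stamp marks the colours that are best for all nodes treated so
far; stamps only grow, so older ones need no clearing. -/
theorem wp_procNode {x : ℕ} (hE : Env n N A σ) (hW : offset N A n ≤ W) (hx : x < n)
    (h12 : σ.reg 12 = x) (hst : ∀ x, σ.mem 5 x ≤ 2) (h9 : σ.mem 9 = fun _ => 0) (hA : A x ≠ [])
    (hg : σ.reg 17 ≤ σ.reg 16) (hgW : σ.reg 16 + 1 ≤ W)
    (hmark : ∀ c, σ.mem 11 c ≤ σ.reg 16) :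
    wp W procNode (fun t τ => Frame procNode σ τ ∧ t ≤ 16 * cost N A x ∧
      (∃ b, Best N A (σ.mem 5) (σ.mem 1) x b ∧ τ.mem 1 = Function.update (σ.mem 1) x b) ∧
      τ.mem 9 = (fun _ => 0) ∧
      (∀ i (h : i < (A x).length), 0 < τ.mem 10 (colAddr N A x + i) ↔
        Best N A (σ.mem 5) (σ.mem 1) x (A x)[i]) ∧
      (∀ a, (a < offset N A x ∨ offset N A (x + 1) ≤ a) → τ.mem 10 a = σ.mem 10 a) ∧
      τ.reg 16 = σ.reg 16 + 1 ∧ τ.reg 17 = σ.reg 16 + 1 ∧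
      ∀ c, τ.mem 11 c ≤ σ.reg 16 + 1 ∧ (σ.reg 16 + 1 ≤ τ.mem 11 c ↔
        Best N A (σ.mem 5) (σ.mem 1) x c ∧ σ.reg 17 ≤ σ.mem 11 c)) σ := by
  refine wp.frame ?_
  have hAl : 0 < (A x).length := List.length_pos_of_ne_nil hA
  have hb : offset N A x + cost N A x ≤ W :=
    ((offset_succ N A x).symm.le.trans (offset_mono N A hx)).trans hW
  have hoff := offset_succ N A x
  have hcost : cost N A x = (N x).length + (A x).length + 2 := rfl
  have hca : colAddr N A x = offset N A x + 2 + (N x).length := rfl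
  rw [procNode, wp_seq]
  refine wp_loopNbrs hE hW hx h12 (by decide) (fun σ₁ a4 a5 al aW ar am => ?_)
  refine (wp_count (by rw [ar 1 (by decide) (by decide), hE.r1]) a4 a5 al aW (by rw [am]; exact hst)
    (by rw [am]; exact h9)).mono ?_
  rintro t₁ τ₁ ⟨ht₁, F₁, m9⟩
  rw [am] at m9
  have E₁ : Env n N A τ₁ := (hE.congr (fun r hr => ar r (by omega) (by omega)) (by rw [am])
    (by rw [am]) (by rw [am])).of_frame F₁ (by decide)
  have r12 : τ₁.reg 12 = x := by rw [F₁.1 12 (by decide), ar 12 (by decide) (by decide), h12]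
  have r16 : τ₁.reg 16 = σ.reg 16 := by rw [F₁.1 16 (by decide), ar 16 (by decide) (by decide)]
  have r17 : τ₁.reg 17 = σ.reg 17 := by rw [F₁.1 17 (by decide), ar 17 (by decide) (by decide)]
  have m1 : τ₁.mem 1 = σ.mem 1 := by rw [F₁.2 1 (by decide), am]
  have m10 : τ₁.mem 10 = σ.mem 10 := by rw [F₁.2 10 (by decide), am]
  have m11 : τ₁.mem 11 = σ.mem 11 := by rw [F₁.2 11 (by decide), am]
  have m9' : τ₁.mem 9 = fun c => weight N (σ.mem 5) (σ.mem 1) x c := m9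
  have hfirst : τ₁.mem 0 (colAddr N A x) = (A x)[0] := E₁.layout.cols x hx 0 hAl
  simp only [wp_seq, wp_move, wp_load, wp_plus, reg_setReg, mem_setReg, Nat.reduceEqDiff,
      ↓reduceIte,
    r12, E₁.na x hx, E₁.r1, OfNat.one_ne_ofNat, E₁.r0]
  rw [show offset N A x + 1 + (N x).length + 1 = colAddr N A x by omega, hfirst]
  refine ⟨by omega, ?_⟩
  refine wp_loopCols (E₁.congr (fun r hr => ?_) rfl rfl rfl) hW hx (by simp [reg_setReg, r12])
    (fun σ₂ a4 a5 al aW ar am => ?_)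
  · have h1 : r ≠ 14 := by omega
    have h2 : r ≠ 4 := by omega
    have h3 : r ≠ 15 := by omega
    simp [reg_setReg, h1, h2, h3]
  simp only [mem_setReg] at am
  refine (wp_best (l := A x) (by rw [ar 1 (by decide) (by decide)]; simp [reg_setReg,
      E₁.r1]) a4 a5 al
    aW (by rw [ar 14 (by decide) (by decide)]; simp [reg_setReg])
    (by rw [ar 15 (by decide) (by decide)]; simp [reg_setReg])).mono ?_
  rintro t₂ τ₂ ⟨ht₂, F₂, hbA, hb14, hbmax⟩
  have E₂ : Env n N A τ₂ := (E₁.congr (τ := σ₂) (fun r hr => ?_) (by rw [am]) (by rw [am])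
    (by rw [am])).of_frame F₂ (by decide)
  swap
  · rw [ar r (by omega) (by omega)]
    have h1 : r ≠ 14 := by omega
    have h2 : r ≠ 4 := by omega
    have h3 : r ≠ 15 := by omega
    simp [reg_setReg, h1, h2, h3]
  have r12₂ : τ₂.reg 12 = x := by
    rw [F₂.1 12 (by decide), ar 12 (by decide) (by decide)]; simp [reg_setReg, r12]
  have r16₂ : τ₂.reg 16 = σ.reg 16 := by
    rw [F₂.1 16 (by decide), ar 16 (by decide) (by decide)]; simp [reg_setReg, r16]
  have r17₂ : τ₂.reg 17 = σ.reg 17 := by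
    rw [F₂.1 17 (by decide), ar 17 (by decide) (by decide)]; simp [reg_setReg, r17]
  have mm : τ₂.mem = τ₁.mem := by
    funext a; rw [F₂.2 a (by simp [forEach, arrays, bestBody]), am]
  rw [am, m9'] at hb14 hbmax
  -- Register 14 now holds the maximal weight, which turns `Best` into the comparison made by
  -- `markBody`.
  have hbest : ∀ c, Best N A (σ.mem 5) (σ.mem 1) x c ↔
      c ∈ A x ∧ ¬ weight N (σ.mem 5) (σ.mem 1) x c < τ₂.reg 14 := by
    intro c
    refine and_congr_right (fun hc => ⟨fun h => ?_, fun h c' hc' => ?_⟩)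
    · rw [hb14]; exact not_lt.2 (h _ hbA)
    · exact (hbmax c' hc').trans (not_lt.1 h)
  generalize hbb : τ₂.reg 15 = b at *
  have hBb : Best N A (σ.mem 5) (σ.mem 1) x b := (hbest b).2 ⟨hbA, by rw [hb14]; simp⟩
  rw [r16₂, E₂.r1]
  refine ⟨hgW, ?_⟩
  refine wp_loopCols (E₂.congr (fun r hr => ?_) rfl rfl rfl) hW hx (by simp [reg_setReg, r12₂])
    (fun σ₃ a4 a5 al aW ar am => ?_)
  · have h1 : r ≠ 16 := by omega
    simp [reg_setReg, h1]
  simp only [mem_setReg, mm] at am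
  have a14 : σ₃.reg 14 = τ₂.reg 14 := by rw [ar 14 (by decide) (by decide)]; simp [reg_setReg]
  have a15 : σ₃.reg 15 = b := by rw [ar 15 (by decide) (by decide)]; simp [reg_setReg, hbb]
  have a16 : σ₃.reg 16 = σ.reg 16 + 1 := by rw [ar 16 (by decide) (by decide)]; simp [reg_setReg]
  have a17 : σ₃.reg 17 = σ.reg 17 := by
    rw [ar 17 (by decide) (by decide)]; simp [reg_setReg, r17₂]
  have a12 : σ₃.reg 12 = x := by rw [ar 12 (by decide) (by decide)]; simp [reg_setReg, r12₂]
  have aE : Env n N A σ₃ := by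
    refine E₂.congr (fun r hr => ?_) (by rw [am, mm]) (by rw [am, mm]) (by rw [am, mm])
    rw [ar r (by omega) (by omega)]
    have h1 : r ≠ 16 := by omega
    simp [reg_setReg, h1]
  refine (wp_mark (l := A x) aE.r0 aE.r1 a4 a5 al aW (by omega)).mono ?_
  rintro t₃ τ₃ ⟨ht₃, F₃, hg1, hg2, hm⟩
  rw [am, m9', a14] at hg1
  rw [am, m10] at hg2
  rw [am, m9', m11, a14, a16, a17] at hm
  have E₃ : Env n N A τ₃ := aE.of_frame F₃ (by decide)
  have r12₃ : τ₃.reg 12 = x := (F₃.1 12 (by decide)).trans a12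
  have r15₃ : τ₃.reg 15 = b := (F₃.1 15 (by decide)).trans a15
  have r16₃ : τ₃.reg 16 = σ.reg 16 + 1 := (F₃.1 16 (by decide)).trans a16
  have m1₃ : τ₃.mem 1 = σ.mem 1 := by rw [F₃.2 1 (by decide), am, m1]
  have m9₃ : τ₃.mem 9 = fun c => weight N (σ.mem 5) (σ.mem 1) x c := by
    rw [F₃.2 9 (by decide), am, m9']
  rw [r16₃]
  refine wp_loopNbrs (E₃.congr (fun r hr => ?_) rfl rfl rfl) hW hx (by simp [reg_setReg, r12₃])
    (by decide) (fun σ₄ a4 a5 al aW ar am => ?_)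
  · have h1 : r ≠ 17 := by omega
    simp [reg_setReg, h1]
  simp only [mem_setReg] at am
  refine (wp_reset (l := N x) (by rw [ar 0 (by decide) (by decide)]; simp [reg_setReg, E₃.r0])
    (by rw [ar 1 (by decide) (by decide)]; simp [reg_setReg, E₃.r1]) a4 a5 al aW ?_).mono ?_
  · intro c hc
    rw [am, m1₃] at hc
    rw [am, m9₃]
    exact List.countP_eq_zero.2 (fun u hu => by simp [hc u hu])
  rintro t₄ τ₄ ⟨ht₄, F₄, h9₄⟩
  have e12 : τ₄.reg 12 = x := by
    rw [F₄.1 12 (by decide), ar 12 (by decide) (by decide)]; simp [reg_setReg, r12₃]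
  have e15 : τ₄.reg 15 = b := by
    rw [F₄.1 15 (by decide), ar 15 (by decide) (by decide)]; simp [reg_setReg, r15₃]
  have e16 : τ₄.reg 16 = σ.reg 16 + 1 := by
    rw [F₄.1 16 (by decide), ar 16 (by decide) (by decide)]; simp [reg_setReg, r16₃]
  have e17 : τ₄.reg 17 = σ.reg 16 + 1 := by
    rw [F₄.1 17 (by decide), ar 17 (by decide) (by decide)]; simp [reg_setReg]
  have f1 : τ₄.mem 1 = σ.mem 1 := by rw [F₄.2 1 (by decide), am, m1₃]
  have f10 : τ₄.mem 10 = τ₃.mem 10 := by rw [F₄.2 10 (by decide), am]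
  have f11 : τ₄.mem 11 = τ₃.mem 11 := by rw [F₄.2 11 (by decide), am]
  simp only [wp_store, mem_setMem, reg_setMem, ↓reduceIte, e12, e15, e16, e17, f1,
    OfNat.ofNat_ne_one, f10, f11, h9₄]
  refine ⟨by omega, ⟨b, hBb, rfl⟩, trivial, fun i hi => ?_, fun a ha => hg2 a (by omega), trivial,
      trivial,
    fun c => ?_⟩
  · rw [hg1 i hi, hbest]
    split_ifs with h
    · simp [h]
    · simp [h]
  · rw [hm c, hbest c]
    have := hmark c
    split_ifs with h
    · simp only [le_refl, true_and, true_iff]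
      exact ⟨⟨h.1, h.2.1⟩, not_lt.1 h.2.2⟩
    · refine ⟨by omega, ⟨fun h' => by omega, fun h' => absurd ⟨h'.1.1, h'.1.2, not_lt.2 h'.2⟩ h⟩⟩

end Component

/-- Colouring unfinished nodes does not affect best choices, so they can be judged against the
initial colouring throughout a component. -/
theorem Best.congr {N A : ℕ → List ℕ} {st s s' : ℕ → ℕ} (h : ∀ u, st u = 2 → s u = s' u)
    (y c : ℕ) : Best N A st s y c ↔ Best N A st s' y c := by
  simp only [Best, weight_congr h]

/-- Find the best colours of all the nodes of the component of the node in register `10`. -/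
def chooseLoop : Program :=
  .whileLt 13 1 (.seq procNode (.seq (.plus 18 18 1)
    -- Two failed strict comparisons express equality: the flag goes up when the node just treated
    -- is the root.
    (.seq (.ifLt 12 10 .skip (.ifLt 10 12 .skip (.move 13 1))) (.load 12 6 12))))

/-- Copy colours twice around the component. -/
def sweepLoop : Program :=
  .whileLt 22 19 (.seq (.load 20 1 12) (.seq (.load 21 6 12) (.seq (loopCols 21 scanBody)
    (.seq (.store 5 21 2) (.seq (.move 12 21) (.plus 22 22 1))))))

section Component

variable {n W k : ℕ} {N A : ℕ → List ℕ} {σ : State} {Y : ℕ → ℕ}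

/-- Treating the node `x` leaves the flags of the other nodes alone. -/
theorem colAddr_disjoint (N A : ℕ → List ℕ) {x y t : ℕ} (h : y ≠ x) (ht : t < (A y).length) :
    colAddr N A y + t < offset N A x ∨ offset N A (x + 1) ≤ colAddr N A y + t := by
  have hoff := offset_succ N A y
  have hcost : cost N A y = (N y).length + (A y).length + 2 := rfl
  have hca : colAddr N A y = offset N A y + 2 + (N y).length := rfl
  rcases Nat.lt_or_gt_of_ne h with h | h
  · left
    have := offset_mono N A (show y + 1 ≤ x from h)
    omega
  · right
    have := offset_mono N A (show x + 1 ≤ y from h)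
    omega

/-- The nodes are treated in the order `Y 1, …, Y k`, so that the root comes last and ends the loop.
Register 17 is 0 at first, which makes every stamp valid for the first node; afterwards only the
newest stamp is valid. -/
theorem wp_chooseLoop (hE : Env n N A σ) (hW : offset N A n ≤ W)
    (hYs : ∀ i, Y (i + 1) = σ.mem 6 (Y i)) (hY0 : Y 0 = σ.reg 10) (hk : 0 < k)
    (hkv : Y k = Y 0) (hmin : ∀ i, 0 < i → i < k → Y i ≠ Y 0) (hYn : ∀ i, Y i < n)
    (hYst : ∀ i, σ.mem 5 (Y i) ≠ 2) (hst : ∀ x, σ.mem 5 x ≤ 2) (h9 : σ.mem 9 = fun _ => 0)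
    (hA : ∀ x < n, A x ≠ []) (hgW : σ.reg 16 + k ≤ W)
    (hmark : ∀ c, σ.mem 11 c ≤ σ.reg 16)
    (h12 : σ.reg 12 = Y 1) (h13 : σ.reg 13 = 0) (h17 : σ.reg 17 = 0) (h18 : σ.reg 18 = 0) :
    wp W chooseLoop (fun t τ => Frame chooseLoop σ τ ∧
      t ≤ ∑ j ∈ Finset.range k, 20 * cost N A (Y (j + 1)) + 1 ∧
      τ.reg 18 = k ∧ τ.reg 16 = σ.reg 16 + k ∧ τ.mem 9 = (fun _ => 0) ∧
      (∀ x, (∀ j, x ≠ Y j) → τ.mem 1 x = σ.mem 1 x) ∧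
      (∀ j, 0 < j → j ≤ k → Best N A (σ.mem 5) (σ.mem 1) (Y j) (τ.mem 1 (Y j)) ∧
        ∀ i (h : i < (A (Y j)).length), 0 < τ.mem 10 (colAddr N A (Y j) + i) ↔
          Best N A (σ.mem 5) (σ.mem 1) (Y j) (A (Y j))[i]) ∧
      ∀ c, τ.mem 11 c ≤ σ.reg 16 + k ∧ (σ.reg 16 + k ≤ τ.mem 11 c ↔
        ∀ j, 0 < j → j ≤ k → Best N A (σ.mem 5) (σ.mem 1) (Y j) c)) σ := by
  refine (wp_while_frame (m := ∑ j ∈ Finset.Ico 0 k, 20 * cost N A (Y (j + 1)))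
    (fun τ m => ∃ i ≤ k, τ.reg 12 = Y (i + 1) ∧ τ.reg 18 = i ∧
      τ.reg 13 = (if i = k then 1 else 0) ∧ τ.reg 16 = σ.reg 16 + i ∧ τ.reg 17 ≤ τ.reg 16 ∧
      (0 < i → τ.reg 17 = τ.reg 16) ∧ τ.mem 9 = (fun _ => 0) ∧
      (∀ x, (∀ j, x ≠ Y j) → τ.mem 1 x = σ.mem 1 x) ∧
      (∀ j, 0 < j → j ≤ i → Best N A (σ.mem 5) (σ.mem 1) (Y j) (τ.mem 1 (Y j)) ∧
        ∀ i (h : i < (A (Y j)).length), 0 < τ.mem 10 (colAddr N A (Y j) + i) ↔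
          Best N A (σ.mem 5) (σ.mem 1) (Y j) (A (Y j))[i]) ∧
      (∀ c, τ.mem 11 c ≤ τ.reg 16 ∧ (τ.reg 17 ≤ τ.mem 11 c ↔
        ∀ j, 0 < j → j ≤ i → Best N A (σ.mem 5) (σ.mem 1) (Y j) c)) ∧
      m = ∑ j ∈ Finset.Ico i k, 20 * cost N A (Y (j + 1))) ?_ ?_).mono ?_
  · refine ⟨0, hk.le, h12, h18, by rw [h13, if_neg hk.ne], by simp, by simp [h17],
      by simp, h9, fun _ _ => rfl, fun j hj hj' => by omega, fun c => ⟨hmark c, ?_⟩, rfl⟩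
    rw [h17]
    simp only [Nat.zero_le, true_iff]
    intro j hj hj'; omega
  · rintro τ m hF ⟨i, hik, r12, r18, r13, r16, r17, r17', m9, m1, hb, hm, rfl⟩ hlt
    have hEτ := hE.of_frame hF (by decide)
    have hik' : i < k := by
      rw [r13, hEτ.r1] at hlt
      refine lt_of_le_of_ne hik ?_
      rintro rfl
      simp at hlt
    have m5 : τ.mem 5 = σ.mem 5 := hF.2 5 (by decide)
    have m6 : τ.mem 6 = σ.mem 6 := hF.2 6 (by decide)
    have r10 : τ.reg 10 = Y 0 := (hF.1 10 (by decide)).trans hY0.symm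
    have hbc : ∀ y c, Best N A (τ.mem 5) (τ.mem 1) y c ↔ Best N A (σ.mem 5) (σ.mem 1) y c := by
      rw [m5]
      exact Best.congr fun u hu => m1 u (by rintro j rfl; exact hYst j hu)
    rw [wp_seq]
    refine (wp_procNode hEτ hW (hYn (i + 1)) r12 (by rw [m5]; exact hst) m9
      (hA _ (hYn _)) r17 (by omega) (fun c => (hm c).1)).mono ?_
    rintro t υ ⟨F, ht, ⟨b, hbB, n1⟩, n9, n10, n10', s16, s17, n11⟩
    have hEυ := hEτ.of_frame F (by decide)
    have s12 : υ.reg 12 = Y (i + 1) := (F.1 12 (by decide)).trans r12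
    have s18 : υ.reg 18 = i := (F.1 18 (by decide)).trans r18
    have s13 : υ.reg 13 = 0 := by
      rw [F.1 13 (by decide), r13, if_neg hik'.ne]
    have s10 : υ.reg 10 = Y 0 := (F.1 10 (by decide)).trans r10
    have n6 : υ.mem 6 = σ.mem 6 := (F.2 6 (by decide)).trans m6
    have hnext : σ.mem 6 (Y (i + 1)) = Y (i + 1 + 1) := (hYs _).symm
    simp only [hbc] at hbB n10 n11
    rw [r16] at s16 s17 n11
    have hflag : Y (i + 1) = Y 0 ↔ i + 1 = k := by
      constructor
      · intro h
        by_contra hne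
        exact hmin (i + 1) (by omega) (by omega) h
      · rintro h; rw [h, hkv]
    have c1 : ∀ x, (∀ j, x ≠ Y j) → υ.mem 1 x = σ.mem 1 x := by
      intro x hx
      rw [n1, Function.update_of_ne (hx _), m1 x hx]
    have c2 : ∀ j, 0 < j → j ≤ i + 1 → Best N A (σ.mem 5) (σ.mem 1) (Y j) (υ.mem 1 (Y j)) ∧
        ∀ i (h : i < (A (Y j)).length), 0 < υ.mem 10 (colAddr N A (Y j) + i) ↔
          Best N A (σ.mem 5) (σ.mem 1) (Y j) (A (Y j))[i] := by
      intro j hj hji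
      by_cases hjy : Y j = Y (i + 1)
      · rw [hjy, n1, Function.update_self]
        exact ⟨hbB, n10⟩
      · have hji' : j ≤ i := by
          rcases Nat.lt_or_eq_of_le hji with h | h
          · omega
          · exact absurd (by rw [h]) hjy
        rw [n1, Function.update_of_ne hjy]
        refine ⟨(hb j hj hji').1, fun t ht => ?_⟩
        rw [n10' _ (colAddr_disjoint N A hjy ht)]
        exact (hb j hj hji').2 t ht
    have c3 : ∀ c, υ.mem 11 c ≤ σ.reg 16 + (i + 1) ∧ (σ.reg 16 + (i + 1) ≤ υ.mem 11 c ↔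
        ∀ j, 0 < j → j ≤ i + 1 → Best N A (σ.mem 5) (σ.mem 1) (Y j) c) := by
      intro c
      refine ⟨(n11 c).1, (n11 c).2.trans ?_⟩
      rw [(hm c).2]
      constructor
      · rintro ⟨h1, h2⟩ j hj hji
        rcases Nat.lt_or_eq_of_le hji with h | rfl
        · exact h2 j hj (by omega)
        · exact h1
      · exact fun h => ⟨h _ (by omega) le_rfl, fun j hj hji => h j hj (by omega)⟩
    have hsum : ∑ j ∈ Finset.Ico i k, 20 * cost N A (Y (j + 1)) =
        20 * cost N A (Y (i + 1)) + ∑ j ∈ Finset.Ico (i + 1) k, 20 * cost N A (Y (j + 1)) :=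
      Finset.sum_eq_sum_Ico_succ_bot hik' _
    have hcost : 2 ≤ cost N A (Y (i + 1)) := by simp [cost]
    have hif : ∀ ρ : State, ρ.reg 12 = Y (i + 1) → ρ.reg 10 = Y 0 → ρ.reg 13 = 0 → ρ.reg 1 = 1 →
        wp W (.ifLt 12 10 .skip (.ifLt 10 12 .skip (.move 13 1))) (fun t π => t ≤ 3 ∧
          π.reg 13 = (if i + 1 = k then 1 else 0) ∧ (∀ r, r ≠ 13 → π.reg r = ρ.reg r) ∧
          π.mem = ρ.mem) ρ := by
      intro ρ g1 g2 g3 g4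
      rw [wp_ifLt, wp_ifLt, wp_skip, wp_skip, wp_move, g1, g2, g4]
      refine ⟨fun h => ⟨by omega, ?_, fun _ _ => rfl, rfl⟩,
        fun h => ⟨fun h' => ⟨by omega, ?_, fun _ _ => rfl, rfl⟩,
        fun h' => ⟨by omega, ?_, fun r hr => by simp [reg_setReg, hr], rfl⟩⟩⟩
      · rw [g3, if_neg (fun hc => by have := hflag.2 hc; omega)]
      · rw [g3, if_neg (fun hc => by have := hflag.2 hc; omega)]
      · rw [reg_setReg, if_pos rfl, if_pos (hflag.1 (by omega))]
    rw [wp_seq, wp_plus, wp_seq, s18, hEυ.r1]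
    refine ⟨by omega, (hif _ (by simp [reg_setReg, s12]) (by simp [reg_setReg, s10])
      (by simp [reg_setReg, s13]) (by simp [reg_setReg, hEυ.r1])).mono ?_⟩
    rintro u π ⟨hu, p13, pr, pm⟩
    rw [wp_load]
    simp only [mem_setReg] at pm
    have p12 : π.reg 12 = Y (i + 1) := by rw [pr 12 (by decide)]; simp [reg_setReg, s12]
    have p16 : π.reg 16 = σ.reg 16 + (i + 1) := by
      rw [pr 16 (by decide)]; simp [reg_setReg, s16, add_assoc]
    have p17 : π.reg 17 = σ.reg 16 + (i + 1) := by
      rw [pr 17 (by decide)]; simp [reg_setReg, s17, add_assoc]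
    have p18 : π.reg 18 = i + 1 := by rw [pr 18 (by decide)]; simp [reg_setReg]
    simp only [mem_setReg, pm, p12, n6, hnext]
    refine ⟨_, ⟨i + 1, by omega, by simp [reg_setReg], by simp [reg_setReg, p18],
      by simp [reg_setReg, p13], by simp [reg_setReg, p16], by simp [reg_setReg, p16, p17],
      fun _ => by simp [reg_setReg, p16, p17], n9, c1, c2, ?_, rfl⟩, by omega⟩
    simpa [reg_setReg, p16, p17] using c3
  · rintro t τ ⟨hF, m, ⟨i, hik, r12, r18, r13, r16, r17, r17', m9, m1, hb, hm, rfl⟩, hlt, ht⟩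
    have hEτ := hE.of_frame hF (by decide)
    have hi : i = k := by
      by_contra hne
      rw [r13, hEτ.r1, if_neg hne] at hlt
      omega
    subst hi
    rw [Finset.range_eq_Ico]
    simp only [r17' hk, r16] at hm
    exact ⟨hF, by omega, r18, r16, m9, m1, hb, hm⟩

-- The permitted colours `B` are read off flags fixed beforehand, so it does no harm that nodes are
-- already marked as finished during the sweep.
open Classical in
theorem wp_sweepLoop {M : ℕ} {B : ℕ → ℕ → Prop} (hE : Env n N A σ) (hW : offset N A n ≤ W)
    (hYs : ∀ i, Y (i + 1) = σ.mem 6 (Y i)) (hYn : ∀ i, Y i < n) (hMW : M ≤ W)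
    (hB : ∀ i d, (∃ t, ∃ h : t < (A (Y i)).length, (A (Y i))[t] = d ∧
      0 < σ.mem 10 (colAddr N A (Y i) + t)) ↔ B (Y i) d)
    (h12 : σ.reg 12 = Y 0) (h22 : σ.reg 22 = 0) (h19 : σ.reg 19 = M) :
    wp W sweepLoop (fun t τ => Frame sweepLoop σ τ ∧
      t ≤ ∑ j ∈ Finset.range M, 20 * cost N A (Y (j + 1)) + 1 ∧
      τ.mem 1 = sweep B Y (σ.mem 1) M ∧
      τ.mem 5 = fun x => if ∃ j, j < M ∧ x = Y (j + 1) then 2 else σ.mem 5 x) σ := by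
  refine (wp_while_frame (m := ∑ j ∈ Finset.Ico 0 M, 20 * cost N A (Y (j + 1)))
    (fun τ m => ∃ i ≤ M, τ.reg 12 = Y i ∧ τ.reg 22 = i ∧ τ.reg 19 = M ∧
      τ.mem 1 = sweep B Y (σ.mem 1) i ∧
      τ.mem 5 = (fun x => if ∃ j, j < i ∧ x = Y (j + 1) then 2 else σ.mem 5 x) ∧
      m = ∑ j ∈ Finset.Ico i M, 20 * cost N A (Y (j + 1))) ?_ ?_).mono ?_
  · exact ⟨0, Nat.zero_le _, h12, h22, h19, rfl, by simp, rfl⟩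
  · rintro τ m hF ⟨i, -, r12, r22, r19, m1, m5, rfl⟩ hlt
    rw [r22, r19] at hlt
    have hEτ := hE.of_frame hF (by decide)
    have m6 : τ.mem 6 = σ.mem 6 := hF.2 6 (by decide)
    have m10 : τ.mem 10 = σ.mem 10 := hF.2 10 (by decide)
    simp only [wp_seq, wp_load, reg_setReg, mem_setReg, Nat.reduceEqDiff, ↓reduceIte, r12, m6,
        ← hYs]
    refine wp_loopCols (x := Y (i + 1)) (hEτ.congr (fun r hr => ?_) rfl rfl rfl) hW (hYn _)
      (by simp [reg_setReg]) (fun σ₁ a4 a5 al aW ar am => ?_)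
    · have h1 : r ≠ 20 := by omega
      have h2 : r ≠ 21 := by omega
      simp [reg_setReg, h1, h2]
    simp only [mem_setReg] at am
    have e0 : σ₁.reg 0 = 0 := by
      rw [ar 0 (by decide) (by decide)]; simp [reg_setReg, hEτ.r0]
    have e1 : σ₁.reg 1 = 1 := by
      rw [ar 1 (by decide) (by decide)]; simp [reg_setReg, hEτ.r1]
    have e2 : σ₁.reg 2 = 2 := by
      rw [ar 2 (by decide) (by decide)]; simp [reg_setReg, hEτ.r2]
    have e20 : σ₁.reg 20 = τ.mem 1 (Y i) := by
      rw [ar 20 (by decide) (by decide)]; simp [reg_setReg]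
    have e21 : σ₁.reg 21 = Y (i + 1) := by
      rw [ar 21 (by decide) (by decide)]; simp [reg_setReg]
    have e22 : σ₁.reg 22 = i := by
      rw [ar 22 (by decide) (by decide)]; simp [reg_setReg, r22]
    have e19 : σ₁.reg 19 = M := by
      rw [ar 19 (by decide) (by decide)]; simp [reg_setReg, r19]
    refine (wp_scan e0 e1 a4 a5 al aW).mono ?_
    rintro t υ ⟨ht, F, n1⟩
    rw [am, m10, e20, e21, m1] at n1
    have s21 : υ.reg 21 = Y (i + 1) := (F.1 21 (by decide)).trans e21
    have s22 : υ.reg 22 = i := (F.1 22 (by decide)).trans e22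
    have s19 : υ.reg 19 = M := (F.1 19 (by decide)).trans e19
    have s1 : υ.reg 1 = 1 := (F.1 1 (by decide)).trans e1
    have s2 : υ.reg 2 = 2 := (F.1 2 (by decide)).trans e2
    have n5 : υ.mem 5 = τ.mem 5 := by rw [F.2 5 (by decide), am]
    have hsum : ∑ j ∈ Finset.Ico i M, 20 * cost N A (Y (j + 1)) =
        20 * cost N A (Y (i + 1)) + ∑ j ∈ Finset.Ico (i + 1) M, 20 * cost N A (Y (j + 1)) :=
      Finset.sum_eq_sum_Ico_succ_bot hlt _
    have hcost : cost N A (Y (i + 1)) = (N (Y (i + 1))).length + (A (Y (i + 1))).length + 2 := rfl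
    simp only [wp_store, wp_move, wp_plus, reg_setReg, reg_setMem, mem_setReg, mem_setMem,
      Nat.reduceEqDiff, ↓reduceIte, s21, s22, s1, s2, OfNat.one_ne_ofNat]
    refine ⟨by omega, _, ⟨i + 1, hlt, rfl, rfl, s19, ?_, ?_, rfl⟩, by omega⟩
    · rw [n1, sweep]
      exact if_congr (hB _ _) rfl rfl
    · rw [n5, m5]
      funext x
      by_cases hx : x = Y (i + 1)
      · rw [hx, Function.update_self, if_pos ⟨i, by omega, rfl⟩]
      · rw [Function.update_of_ne hx]
        refine if_congr ⟨fun ⟨j, hj, h⟩ => ⟨j, by omega, h⟩, fun ⟨j, hj, h⟩ => ⟨j, ?_, h⟩⟩ rfl rfl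
        rcases Nat.lt_succ_iff_lt_or_eq.1 hj with h' | rfl
        · exact h'
        · exact absurd h hx
  · rintro t τ ⟨hF, m, ⟨i, hi, r12, r22, r19, m1, m5, rfl⟩, hlt, ht⟩
    rw [r22, r19] at hlt
    obtain rfl : i = M := by omega
    rw [Finset.range_eq_Ico]
    exact ⟨hF, by omega, m1, m5⟩

/-- Colour the component whose root is in register `10`, and return to the parent of this node. -/
def comp : Program :=
  .seq (.load 11 6 10) (.seq (.load 7 8 10) (.seq (.store 6 10 7) (.seq (.load 12 6 10)
    (.seq (.move 13 0) (.seq (.move 17 0) (.seq (.move 18 0) (.seq chooseLoop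
      (.seq (loopCols 10 checkBody) (.seq (.move 12 10) (.seq (.move 22 0)
        (.seq (.plus 19 18 18) (.seq sweepLoop (.move 10 11)))))))))))))

/-- The loops speak of the indices from 1 to `k`; this extends their results to all indices. -/
theorem cycle_index {Y : ℕ → ℕ} {f : ℕ → ℕ} (hYs : ∀ i, Y (i + 1) = f (Y i)) (hk : 0 < k)
    (hkv : Y k = Y 0) (i : ℕ) : ∃ j, 0 < j ∧ j ≤ k ∧ Y j = Y i := by
  induction i with
  | zero => exact ⟨k, hk, le_rfl, hkv⟩
  | succ i ih =>
    obtain ⟨j, hj, hjk, h⟩ := ih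
    rcases Nat.lt_or_eq_of_le hjk with h' | rfl
    · exact ⟨j + 1, by omega, h', by rw [hYs, hYs, h]⟩
    · refine ⟨1, one_pos, hk, ?_⟩
      rw [hYs i, ← h, hkv, ← hYs 0]

theorem cycle_periodic {Y : ℕ → ℕ} {f : ℕ → ℕ} (hYs : ∀ i, Y (i + 1) = f (Y i))
    (hkv : Y k = Y 0) (i : ℕ) : Y (i + k) = Y i := by
  induction i with
  | zero => rw [zero_add, hkv]
  | succ i ih => rw [show i + 1 + k = (i + k) + 1 by ring, hYs, hYs, ih]

theorem cycle_injective {Y : ℕ → ℕ} {f : ℕ → ℕ} (hYs : ∀ i, Y (i + 1) = f (Y i))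
    (hk : 0 < k) (hkv : Y k = Y 0) (hmin : ∀ i, 0 < i → i < k → Y i ≠ Y 0) (i j : ℕ)
    (hij : i < j) (hji : j < i + k) : Y i ≠ Y j := by
  intro h
  have hadd : ∀ m, Y (i + m) = Y (j + m) := by
    intro m
    induction m with
    | zero => exact h
    | succ m ih => rw [← add_assoc, ← add_assoc, hYs, hYs, ih]
  have hper : ∀ m i, Y (i + m * k) = Y i := by
    intro m
    induction m with
    | zero => simp
    | succ m ih => intro i; rw [Nat.succ_mul, ← add_assoc, cycle_periodic hYs hkv, ih]
  obtain ⟨k, rfl⟩ : ∃ k', k = k' + 1 := ⟨k - 1, by omega⟩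
  obtain ⟨e, rfl⟩ := Nat.exists_eq_add_of_lt hij
  refine hmin (e + 1) (by omega) (by omega) ?_
  -- Here the period is `k + 1`, so the shift turns `i` into a multiple of the period and moves the
  -- coincidence to index 0.
  have h1 := hadd (i * k)
  rw [show i + i * k = 0 + i * (k + 1) by ring,
    show i + e + 1 + i * k = (e + 1) + i * (k + 1) by ring, hper, hper] at h1
  exact h1.symm

/-- The last clauses are the conditions of `Stable.extend`: best choices survive the sweep
(`sweep_best`), two rounds settle the links (`sweep_nash`), and a common colour at the root spreads
everywhere (`sweep_common`). -/
theorem wp_comp (hE : Env n N A σ) (hW : offset N A n ≤ W)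
    (hYs : ∀ i, Y (i + 1) =
      Function.update (σ.mem 6) (σ.reg 10) (σ.mem 8 (σ.reg 10)) (Y i))
    (hY0 : Y 0 = σ.reg 10) (hk : 0 < k)
    (hkv : Y k = Y 0) (hmin : ∀ i, 0 < i → i < k → Y i ≠ Y 0) (hYn : ∀ i, Y i < n)
    (hYst : ∀ i, σ.mem 5 (Y i) ≠ 2) (hst : ∀ x, σ.mem 5 x ≤ 2) (h9 : σ.mem 9 = fun _ => 0)
    (hA : ∀ x < n, A x ≠ []) (hgW : σ.reg 16 + k ≤ W) (hkW : 2 * k ≤ W)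
    (hmark : ∀ c, σ.mem 11 c ≤ σ.reg 16) :
    wp W comp (fun t τ => Frame comp σ τ ∧
      t ≤ 80 * ∑ j ∈ Finset.range k, cost N A (Y (j + 1)) ∧
      τ.reg 10 = σ.mem 6 (σ.reg 10) ∧ τ.reg 16 = σ.reg 16 + k ∧ τ.mem 9 = (fun _ => 0) ∧
      τ.mem 6 = Function.update (σ.mem 6) (σ.reg 10) (σ.mem 8 (σ.reg 10)) ∧
      (∀ i, τ.mem 5 (Y i) = 2) ∧ (∀ x, (∀ i, x ≠ Y i) → τ.mem 5 x = σ.mem 5 x) ∧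
      (∀ c, τ.mem 11 c ≤ σ.reg 16 + k) ∧
      (∀ x, (∀ i, x ≠ Y i) → τ.mem 1 x = σ.mem 1 x) ∧
      (∀ i, Best N A (σ.mem 5) (σ.mem 1) (Y i) (τ.mem 1 (Y i))) ∧
      (∀ i, Best N A (σ.mem 5) (σ.mem 1) (Y (i + 1)) (τ.mem 1 (Y i)) →
        τ.mem 1 (Y (i + 1)) = τ.mem 1 (Y i)) ∧
      ∀ c, (∀ i, Best N A (σ.mem 5) (σ.mem 1) (Y i) c) →
        ∀ i, τ.mem 1 (Y (i + 1)) = τ.mem 1 (Y i)) σ := by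
  classical
  refine wp.frame ?_
  have hper := cycle_periodic hYs hkv
  have hind := cycle_index hYs hk hkv
  simp only [comp, wp_seq, wp_load, wp_store, wp_move, reg_setReg, reg_setMem, mem_setReg,
      mem_setMem,
    Nat.reduceEqDiff, ↓reduceIte, OfNat.zero_ne_ofNat, hE.r0, Function.update_self]
  refine (wp_chooseLoop (Y := Y) (k := k) (hE.congr (fun r hr => ?_) ?_ ?_ ?_) hW ?_ ?_ hk hkv
      hmin hYn ?_ ?_ ?_
    hA ?_ ?_ ?_ ?_ ?_ ?_).mono ?_
  · have h1 : r ≠ 11 := by omega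
    have h2 : r ≠ 7 := by omega
    have h3 : r ≠ 12 := by omega
    have h4 : r ≠ 13 := by omega
    have h5 : r ≠ 17 := by omega
    have h6 : r ≠ 18 := by omega
    simp [reg_setReg, reg_setMem, h1, h2, h3, h4, h5, h6]
  · simp [mem_setReg, mem_setMem]
  · simp [mem_setReg, mem_setMem]
  · simp [mem_setReg, mem_setMem]
  · simpa [mem_setReg, mem_setMem] using hYs
  · simpa [reg_setReg, reg_setMem] using hY0
  · simpa [mem_setReg, mem_setMem] using hYst
  · simpa [mem_setReg, mem_setMem] using hst
  · simpa [mem_setReg, mem_setMem] using h9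
  · simpa [reg_setReg, reg_setMem] using hgW
  · simpa [reg_setReg, reg_setMem, mem_setReg, mem_setMem] using hmark
  · simp [reg_setReg, hYs, hY0]
  · simp [reg_setReg]
  · simp [reg_setReg]
  · simp [reg_setReg]
  rintro t₁ τ₁ ⟨F₁, ht₁, r18, r16, m9, c1, c2, c3⟩
  simp only [reg_setReg, reg_setMem, mem_setReg, mem_setMem, Nat.reduceEqDiff, ↓reduceIte,
    OfNat.one_ne_ofNat] at r16 c1 c2 c3
  have E₁ : Env n N A τ₁ := by
    refine Env.of_frame (hE.congr (fun r hr => ?_) ?_ ?_ ?_) F₁ (by decide)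
    · have h1 : r ≠ 11 := by omega
      have h2 : r ≠ 7 := by omega
      have h3 : r ≠ 12 := by omega
      have h4 : r ≠ 13 := by omega
      have h5 : r ≠ 17 := by omega
      have h6 : r ≠ 18 := by omega
      simp [reg_setReg, reg_setMem, h1, h2, h3, h4, h5, h6]
    · simp [mem_setReg, mem_setMem]
    · simp [mem_setReg, mem_setMem]
    · simp [mem_setReg, mem_setMem]
  have r10 : τ₁.reg 10 = Y 0 := by
    rw [F₁.1 10 (by decide), hY0]; simp [reg_setReg, reg_setMem]
  have r11 : τ₁.reg 11 = σ.mem 6 (σ.reg 10) := by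
    rw [F₁.1 11 (by decide)]; simp [reg_setReg, reg_setMem]
  have m5 : τ₁.mem 5 = σ.mem 5 := by
    rw [F₁.2 5 (by decide)]; simp [mem_setReg, mem_setMem]
  have m6 : τ₁.mem 6 = Function.update (σ.mem 6) (σ.reg 10) (σ.mem 8 (σ.reg 10)) := by
    rw [F₁.2 6 (by decide)]; simp [mem_setReg, mem_setMem]
  have b1 : ∀ i, Best N A (σ.mem 5) (σ.mem 1) (Y i) (τ₁.mem 1 (Y i)) := by
    intro i
    obtain ⟨j, hj, hjk, h⟩ := hind i
    rw [← h]; exact (c2 j hj hjk).1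
  have b2 : ∀ i t (h : t < (A (Y i)).length), 0 < τ₁.mem 10 (colAddr N A (Y i) + t) ↔
      Best N A (σ.mem 5) (σ.mem 1) (Y i) (A (Y i))[t] := by
    intro i
    obtain ⟨j, hj, hjk, h⟩ := hind i
    rw [← h]; exact (c2 j hj hjk).2
  have b3 : ∀ c, σ.reg 16 + k ≤ τ₁.mem 11 c ↔ ∀ i, Best N A (σ.mem 5) (σ.mem 1) (Y i) c := by
    refine fun c => (c3 c).2.trans ⟨fun h i => ?_, fun h j _ _ => h j⟩
    obtain ⟨j, hj, hjk, h'⟩ := hind i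
    rw [← h']; exact h j hj hjk
  have hcostv : cost N A (Y 0) ≤ ∑ j ∈ Finset.range k, cost N A (Y (j + 1)) := by
    have := Finset.single_le_sum (f := fun j => cost N A (Y (j + 1))) (s := Finset.range k)
      (fun _ _ => Nat.zero_le _) (Finset.mem_range.2 (show k - 1 < k by omega))
    simpa [Nat.sub_add_cancel hk, hkv] using this
  have hcost : cost N A (Y 0) = (N (Y 0)).length + (A (Y 0)).length + 2 := rfl
  rw [← Finset.mul_sum] at ht₁
  refine wp_loopCols E₁ hW (hYn 0) r10 (fun σ₂ a4 a5 al aW ar am => ?_)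
  have e0 : σ₂.reg 0 = 0 := by rw [ar 0 (by decide) (by decide), E₁.r0]
  have e1 : σ₂.reg 1 = 1 := by rw [ar 1 (by decide) (by decide), E₁.r1]
  refine (wp_check e0 e1 a4 a5 al aW).mono ?_
  rintro t₂ τ₂ ⟨ht₂, F₂, x, n1, hx, hxc⟩
  rw [am, ar 10 (by decide) (by decide), r10] at n1 hx
  rw [am, ar 16 (by decide) (by decide), r16] at hxc
  have E₂ : Env n N A τ₂ := (E₁.congr (fun r hr => ar r (by omega) (by omega)) (by rw [am])
    (by rw [am]) (by rw [am])).of_frame F₂ (by decide)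
  have s10 : τ₂.reg 10 = Y 0 := by rw [F₂.1 10 (by decide), ar 10 (by decide) (by decide), r10]
  have s11 : τ₂.reg 11 = σ.mem 6 (σ.reg 10) := by
    rw [F₂.1 11 (by decide), ar 11 (by decide) (by decide), r11]
  have s16 : τ₂.reg 16 = σ.reg 16 + k := by
    rw [F₂.1 16 (by decide), ar 16 (by decide) (by decide), r16]
  have s18 : τ₂.reg 18 = k := by rw [F₂.1 18 (by decide), ar 18 (by decide) (by decide), r18]
  have n5 : τ₂.mem 5 = σ.mem 5 := by rw [F₂.2 5 (by decide), am, m5]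
  have n6 : τ₂.mem 6 = Function.update (σ.mem 6) (σ.reg 10) (σ.mem 8 (σ.reg 10)) := by
    rw [F₂.2 6 (by decide), am, m6]
  have n9 : τ₂.mem 9 = fun _ => 0 := by rw [F₂.2 9 (by decide), am, m9]
  have n10 : τ₂.mem 10 = τ₁.mem 10 := by rw [F₂.2 10 (by decide), am]
  have n11 : τ₂.mem 11 = τ₁.mem 11 := by rw [F₂.2 11 (by decide), am]
  have hxB : Best N A (σ.mem 5) (σ.mem 1) (Y 0) x := by
    rcases hx with rfl | ⟨i, hi, rfl, hg⟩
    · exact b1 0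
    · exact (b2 0 i hi).1 hg
  have d0 : τ₂.mem 1 (Y 0) = x := by rw [n1, Function.update_self]
  have d1 : ∀ i, Best N A (σ.mem 5) (σ.mem 1) (Y i) (τ₂.mem 1 (Y i)) := by
    intro i
    by_cases hi : Y i = Y 0
    · rw [hi, d0]; exact hxB
    · rw [n1, Function.update_of_ne hi]; exact b1 i
  -- A common colour `c` carries the newest stamp, so the check left the root with such a colour
  -- too, perhaps a different one.
  have d2 : ∀ c, (∀ i, Best N A (σ.mem 5) (σ.mem 1) (Y i) c) →
      ∀ i, Best N A (σ.mem 5) (σ.mem 1) (Y i) x := by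
    intro c hc
    obtain ⟨t, ht, rfl⟩ := List.getElem_of_mem (hc 0).1
    exact (b3 x).1 (hxc t ht ((b2 0 t ht).2 (hc 0)) ((b3 _).2 hc))
  simp only [wp_plus, reg_setReg, Nat.reduceEqDiff, ↓reduceIte, s18]
  refine ⟨by omega, ?_⟩
  refine (wp_sweepLoop (Y := Y) (M := 2 * k) (B := Best N A (σ.mem 5) (σ.mem 1))
    (E₂.congr (fun r hr => ?_) ?_ ?_ ?_) hW ?_ hYn hkW ?_ ?_ ?_ ?_).mono ?_
  · have h3 : r ≠ 12 := by omega
    have h4 : r ≠ 22 := by omega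
    have h5 : r ≠ 19 := by omega
    simp [reg_setReg, h3, h4, h5]
  iterate 3 · rfl
  · simpa only [mem_setReg, n6] using hYs
  · intro i d
    simp only [mem_setReg, n10]
    constructor
    · rintro ⟨t, ht, rfl, hg⟩
      exact (b2 i t ht).1 hg
    · intro hB
      obtain ⟨t, ht, rfl⟩ := List.getElem_of_mem hB.1
      exact ⟨t, ht, rfl, (b2 i t ht).2 hB⟩
  · simp [reg_setReg, s10]
  · simp [reg_setReg, E₂.r0]
  · simp [reg_setReg, two_mul]
  rintro t₃ τ₃ ⟨F₃, ht₃, q1, q5⟩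
  simp only [mem_setReg, n5] at q1 q5
  have u10 : τ₃.reg 11 = σ.mem 6 (σ.reg 10) := by
    rw [F₃.1 11 (by decide)]; simp [reg_setReg, s11]
  have u16 : τ₃.reg 16 = σ.reg 16 + k := by
    rw [F₃.1 16 (by decide)]; simp [reg_setReg, s16]
  have q6 : τ₃.mem 6 = Function.update (σ.mem 6) (σ.reg 10) (σ.mem 8 (σ.reg 10)) := by
    rw [F₃.2 6 (by decide)]; simp only [mem_setReg, n6]
  have q9 : τ₃.mem 9 = fun _ => 0 := by rw [F₃.2 9 (by decide)]; simp only [mem_setReg, n9]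
  have q11 : τ₃.mem 11 = τ₁.mem 11 := by rw [F₃.2 11 (by decide)]; simp only [mem_setReg, n11]
  -- The second round meets the same nodes as the first.
  have hsum : ∑ j ∈ Finset.range (2 * k), 20 * cost N A (Y (j + 1)) =
      40 * ∑ j ∈ Finset.range k, cost N A (Y (j + 1)) := by
    rw [two_mul, Finset.sum_range_add, ← Finset.mul_sum, ← Finset.mul_sum]
    have : ∀ j, Y (k + j + 1) = Y (j + 1) := fun j => by
      rw [show k + j + 1 = (j + 1) + k by ring, hper]
    simp only [this]
    ring
  simp only [u10, u16, q9, q6, q11, q1, q5]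
  refine ⟨by omega, trivial, trivial, trivial, trivial, fun i => ?_, fun y hy => ?_,
      fun c => (c3 c).1,
    fun y hy => ?_, sweep_best d1 _, fun i hi => ?_, fun c hc i => ?_⟩
  · obtain ⟨j, hj, hjk, h⟩ := hind i
    exact if_pos ⟨j - 1, by omega, by rw [Nat.sub_add_cancel hj, h]⟩
  · exact if_neg (fun ⟨j, _, h⟩ => hy _ h)
  · rw [sweep_of_ne hy, n1, Function.update_of_ne (hy 0), c1 y hy]
  · exact sweep_nash hk hper (cycle_injective hYs hk hkv hmin) i hi
  · have hx' : ∀ i, Best N A (σ.mem 5) (σ.mem 1) (Y i) (τ₂.mem 1 (Y 0)) := by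
      rw [d0]; exact d2 c hc
    have hall : ∀ i, sweep (Best N A (σ.mem 5) (σ.mem 1)) Y (τ₂.mem 1) (2 * k) (Y i) =
        τ₂.mem 1 (Y 0) := by
      intro i
      obtain ⟨j, hj, hjk, h⟩ := hind i
      rw [← h, sweep_common hx' (2 * k) j (by omega)]
    rw [hall, hall]

end Component

/-! ### The search -/

/-- Enter the node in register `u`, whose parent is in register `v`. -/
def enterNode (u v : ℕ) : Program :=
  .seq (.store 5 u 1) (.seq (.store 6 u v) (.seq (.store 7 u u) (.seq (.store 8 u u) (.move 10 u))))

def explore : Program :=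
  .seq (.load 6 0 7) (.seq (.plus 7 7 1) (.seq (.store 4 10 7) (.seq (.load 8 5 6)
    (.ifLt 8 1 (enterNode 6 10) (.ifLt 8 2 (.seq (.store 7 10 6) (.store 8 6 10)) .skip)))))

def goBack : Program := .seq (.store 7 8 7) (.move 10 8)

/-- A node is the root of its component exactly if `low` is still the node itself; only then both
comparisons fail and the component is coloured. -/
def leave : Program :=
  .seq (.load 7 7 10) (.seq (.load 8 6 10) (.ifLt 7 10 goBack (.ifLt 10 7 goBack comp)))

/-- One step of the search. -/
def searchStep : Program := .seq (.load 7 4 10) (.seq (.load 8 3 10) (.ifLt 7 8 explore leave))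

/-- The search state in the memory. -/
def toSearch (σ : State) (ex d : ℕ → ℕ) : Search where
  st := σ.mem 5
  par := σ.mem 6
  low := σ.mem 7
  tail := σ.mem 8
  ex := ex
  d := d
  cur := σ.reg 10

/-- The total cost of the unfinished nodes. -/
def unfinished (n : ℕ) (N A : ℕ → List ℕ) (st : ℕ → ℕ) : ℕ :=
  ∑ x ∈ Finset.range n, if st x = 2 then 0 else cost N A x

/-- The depths `d` are ghost data and the counters `ex` are stored as addresses in array 4. By
`bound`, each stamp is charged to a node that gets finished, which keeps the stamps within the word
size. -/
structure RunInv (n W : ℕ) (N A : ℕ → List ℕ) (σ : State) (ex d : ℕ → ℕ) : Prop where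
  env : Env n N A σ
  search : (toSearch σ ex d).Inv n N
  ptr : ∀ x < n, σ.mem 4 x = offset N A x + 1 + ex x
  stable : Stable N A (σ.mem 5) (σ.mem 1)
  weights : σ.mem 9 = fun _ => 0
  stamps : ∀ c, σ.mem 11 c ≤ σ.reg 16
  bound : σ.reg 16 + unfinished n N A (σ.mem 5) ≤ W

/-- An upper bound for the remaining time. -/
def potential (n : ℕ) (N A : ℕ → List ℕ) (st ex d : ℕ → ℕ) (cur : ℕ) : ℕ :=
  -- An explored neighbour releases 40, enough for the step and for 20 stored in the depth of a new
  -- node; these 20 pay for going back. The coefficient 100 covers the factor 80 of `wp_comp`.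
  40 * (∑ x ∈ Finset.range n, ((N x).length - ex x)) + (if cur = n then 0 else 20 * (d cur + 1)) +
    100 * unfinished n N A st

theorem sum_eq_add_one {n v : ℕ} {f g : ℕ → ℕ} (hv : v < n) (h : ∀ x, x ≠ v → f x = g x)
    (hfg : f v = g v + 1) : ∑ x ∈ Finset.range n, f x = ∑ x ∈ Finset.range n, g x + 1 := by
  have e : ∑ x ∈ (Finset.range n).erase v, f x = ∑ x ∈ (Finset.range n).erase v, g x :=
    Finset.sum_congr rfl fun x hx => h x (Finset.ne_of_mem_erase hx)
  rw [← Finset.add_sum_erase _ f (Finset.mem_range.2 hv), ← Finset.add_sum_erase _ g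
    (Finset.mem_range.2 hv), hfg, e]
  ring

section

variable {n W : ℕ} {N A : ℕ → List ℕ} {σ : State} {ex d : ℕ → ℕ}

theorem sum_explored {v : ℕ} (hv : v < n) (hex : ex v < (N v).length) :
    ∑ x ∈ Finset.range n, ((N x).length - ex x) =
      ∑ x ∈ Finset.range n, ((N x).length - Function.update ex v (ex v + 1) x) + 1 :=
  sum_eq_add_one hv (fun x hx => by rw [Function.update_of_ne hx])
    (by rw [Function.update_self]; omega)

theorem unfinished_congr {st st' : ℕ → ℕ} (h : ∀ x, st' x = 2 ↔ st x = 2) :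
    unfinished n N A st' = unfinished n N A st :=
  Finset.sum_congr rfl fun x _ => if_congr (h x) rfl rfl

theorem Stable.congr {st st' s : ℕ → ℕ} (hs : Stable N A st s) (h : ∀ x, st' x = 2 ↔ st x = 2) :
    Stable N A st' s := by
  simpa only [Stable, h] using hs

/-- The nodes of one period are distinct, so each of them is removed from the sum once. -/
theorem unfinished_component {st st' : ℕ → ℕ} {Y : ℕ → ℕ} {k : ℕ} (hYn : ∀ i, Y i < n)
    (hinj : ∀ i j, i < j → j < i + k → Y i ≠ Y j) (hst : ∀ i, st (Y i) ≠ 2)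
    (h2 : ∀ i, st' (Y i) = 2) (h : ∀ x, (∀ i, x ≠ Y i) → st' x = st x) :
    unfinished n N A st' + ∑ j ∈ Finset.range k, cost N A (Y (j + 1)) ≤ unfinished n N A st := by
  have hinj' : Set.InjOn (fun j => Y (j + 1)) (Finset.range k : Set ℕ) := by
    intro i hi j hj hij
    simp only [Finset.coe_range, Set.mem_Iio] at hi hj
    rcases Nat.lt_trichotomy i j with h | h | h
    · exact absurd hij (hinj _ _ (by omega) (by omega))
    · exact h
    · exact absurd hij.symm (hinj _ _ (by omega) (by omega))
  set I := (Finset.range k).image (fun j => Y (j + 1)) with hI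
  have hIn : I ⊆ Finset.range n := by
    intro x hx
    obtain ⟨j, -, rfl⟩ := Finset.mem_image.1 hx
    exact Finset.mem_range.2 (hYn _)
  have hsum : ∑ j ∈ Finset.range k, cost N A (Y (j + 1)) =
      ∑ x ∈ Finset.range n, if x ∈ I then cost N A x else 0 := by
    rw [Finset.sum_ite_mem, Finset.inter_eq_right.2 hIn, hI, Finset.sum_image hinj']
  rw [hsum, unfinished, unfinished, ← Finset.sum_add_distrib]
  refine Finset.sum_le_sum fun x _ => ?_
  by_cases hx : ∃ i, x = Y i
  · obtain ⟨i, rfl⟩ := hx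
    rw [if_pos (h2 i), if_neg (hst i)]
    split_ifs <;> omega
  · push Not at hx
    rw [h x hx, if_neg (show x ∉ I from fun hc => by
      obtain ⟨j, -, rfl⟩ := Finset.mem_image.1 hc
      exact hx (j + 1) rfl)]
    simp

/-- The search and the colouring meet here: `Y` iterates the redirected parent pointer from the
root, `k` is its minimal period, `finish` preserves the search invariant and `Stable.extend` the
equilibrium. -/
theorem wp_comp_search (hG : IsCyclic n N) (hW : offset N A n ≤ W) (hA : ∀ x < n, A x ≠ [])
    (h : RunInv n W N A σ ex d) (hcur : σ.mem 5 (σ.reg 10) = 1)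
    (hex : ex (σ.reg 10) = (N (σ.reg 10)).length) (hlow : σ.mem 7 (σ.reg 10) = σ.reg 10) :
    wp W comp (fun t τ => RunInv n W N A τ ex d ∧ (∀ x, σ.mem 5 x ≠ 0 → τ.mem 5 x ≠ 0) ∧
      t + 10 + potential n N A (τ.mem 5) ex d (τ.reg 10) ≤
        potential n N A (σ.mem 5) ex d (σ.reg 10)) σ := by
  have hS := h.search
  set f := Function.update (σ.mem 6) (σ.reg 10) (σ.mem 8 (σ.reg 10)) with hf
  set k := Function.minimalPeriod f (σ.reg 10) with hk
  set Y : ℕ → ℕ := fun i => f^[i] (σ.reg 10) with hY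
  have hYs : ∀ i, Y (i + 1) = f (Y i) := fun i => Function.iterate_succ_apply' f i _
  have hk0 : 0 < k := hS.periodic hcur
  have hkv : Y k = Y 0 := Function.iterate_minimalPeriod
  have hmin : ∀ i, 0 < i → i < k → Y i ≠ Y 0 := fun i hi hik hc =>
    absurd (Function.IsPeriodicPt.minimalPeriod_le hi hc) (not_le.2 hik)
  have hcyc : ∀ i, Search.Inv.Cyc n (toSearch σ ex d) (σ.reg 10) (Y i) := hS.cyc_iterate hcur
  have hY1 : ∀ i, σ.mem 5 (Y i) = 1 := fun i => hS.cyc_st' hcur (hcyc i)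
  have hYn : ∀ i, Y i < n := fun i => hS.lt _ (show σ.mem 5 (Y i) ≠ 0 by rw [hY1]; simp)
  have hinj := cycle_injective hYs hk0 hkv hmin
  classical
  have hun := unfinished_component (N := N) (A := A) (st := σ.mem 5)
    (st' := fun x => if ∃ i, x = Y i then 2 else σ.mem 5 x) hYn hinj (fun i => by rw [hY1]; simp)
    (fun i => if_pos ⟨i, rfl⟩) (fun x hx => if_neg fun ⟨i, hi⟩ => hx i hi)
  have hbd := h.bound
  have hkS : 2 * k ≤ ∑ j ∈ Finset.range k, cost N A (Y (j + 1)) := by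
    have := Finset.card_nsmul_le_sum (Finset.range k) (fun j => cost N A (Y (j + 1))) 2
      (fun j _ => by simp [cost])
    simpa [mul_comm] using this
  refine (wp_comp h.env hW hYs rfl hk0 hkv hmin hYn (fun i => by rw [hY1]; simp) hS.st_le
    h.weights hA (by omega) (by omega) h.stamps).mono ?_
  rintro t τ ⟨F, ht, s10, s16, n9, n6, n5, n5', n11, n1, g1, g2, g3⟩
  have hun' := unfinished_component (N := N) (A := A) (st := σ.mem 5) hYn hinj
    (fun i => by rw [hY1]; simp) n5 n5'
  have hst1 : ∀ x, Search.Inv.Cyc n (toSearch σ ex d) (σ.reg 10) x → τ.mem 5 x = 2 := by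
    intro x hx
    obtain ⟨i, rfl⟩ := hS.exists_iterate hx
    exact n5 i
  have hst2 : ∀ x, ¬ Search.Inv.Cyc n (toSearch σ ex d) (σ.reg 10) x →
      τ.mem 5 x = σ.mem 5 x := fun x hx => n5' x (by rintro i rfl; exact hx (hcyc i))
  obtain ⟨hd, hS'⟩ := hS.finish hG hcur hex hlow hst1 hst2
  have m4 : τ.mem 4 = σ.mem 4 := F.2 4 (by decide)
  have m7 : τ.mem 7 = σ.mem 7 := F.2 7 (by decide)
  have m8 : τ.mem 8 = σ.mem 8 := F.2 8 (by decide)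
  have hcn : σ.reg 10 ≠ n := (hYn 0).ne
  refine ⟨⟨h.env.of_frame F (by decide), ?_, by rw [m4]; exact h.ptr, ?_, n9, ?_, ?_⟩, ?_, ?_⟩
  · have e : toSearch τ ex d = { toSearch σ ex d with
        st := τ.mem 5
        par := Function.update (σ.mem 6) (σ.reg 10) (σ.mem 8 (σ.reg 10))
        cur := σ.mem 6 (σ.reg 10) } := by
      simp only [toSearch, n6, m7, m8, s10]
    rw [e]
    exact hS'
  · refine h.stable.extend hG.nodup hS.closed hk0 (cycle_periodic hYs hkv)
      (fun i => by rw [hY1]; simp) (fun i u hu => ?_) (fun x => ?_) (fun x hx => ?_) g1 g2 g3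
    · rw [hYs] at hu
      exact hS.cyc_edges hG hcur hex hlow (hcyc i) hu
    · by_cases hx : ∃ i, x = Y i
      · simp only [hx, or_true, iff_true]
        obtain ⟨i, rfl⟩ := hx
        exact n5 i
      · rw [n5' x (fun i hi => hx ⟨i, hi⟩)]
        simp [hx]
    · refine n1 x ?_
      rintro i rfl
      rw [hY1] at hx
      simp at hx
  · rw [s16]; exact n11
  · rw [s16]; omega
  · intro x hx
    by_cases hxc : Search.Inv.Cyc n (toSearch σ ex d) (σ.reg 10) x
    · rw [hst1 x hxc]; simp
    · rwa [hst2 x hxc]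
  · rw [potential, potential, if_neg hcn, s10]
    have : (if σ.mem 6 (σ.reg 10) = n then 0 else 20 * (d (σ.mem 6 (σ.reg 10)) + 1)) ≤
        20 * d (σ.reg 10) := by
      split_ifs with hc
      · exact Nat.zero_le _
      · have hd' : d (σ.reg 10) = d (σ.mem 6 (σ.reg 10)) + 1 := hd.resolve_left hc
        omega
    omega

theorem wp_enterNode {Q : ℕ → State → Prop} {u v : ℕ} (h1 : σ.reg 1 = 1) :
    wp W (enterNode u v) Q σ ↔ Q 5 (((((σ.setMem 5 (σ.reg u) 1).setMem 6 (σ.reg u) (σ.reg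
        v)).setMem 7
      (σ.reg u) (σ.reg u)).setMem 8 (σ.reg u) (σ.reg u)).setReg 10 (σ.reg u)) := by
  simp only [enterNode, wp_seq, wp_store, wp_move, reg_setMem, h1]

/-- Everything but the search state is unchanged when a node is entered. -/
theorem RunInv.enter {τ : State} {u e : ℕ} {ex' : ℕ → ℕ} (h : RunInv n W N A σ ex d)
    (hus : σ.mem 5 u = 0)
    (hS : ((toSearch σ ex d).enter u (σ.reg 10) e ex').Inv n N)
    (hr : ∀ r, r < 4 ∨ r = 16 → τ.reg r = σ.reg r) (h10 : τ.reg 10 = u)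
    (m5 : τ.mem 5 = Function.update (σ.mem 5) u 1)
    (m6 : τ.mem 6 = Function.update (σ.mem 6) u (σ.reg 10))
    (m7 : τ.mem 7 = Function.update (σ.mem 7) u u)
    (m8 : τ.mem 8 = Function.update (σ.mem 8) u u)
    (m4 : ∀ x < n, τ.mem 4 x = offset N A x + 1 + ex' x)
    (hm : ∀ a, a < 4 ∨ 8 < a → τ.mem a = σ.mem a) :
    RunInv n W N A τ ex' (Function.update d u e) := by
  have h2 : ∀ x, Function.update (σ.mem 5) u 1 x = 2 ↔ σ.mem 5 x = 2 := by
    intro x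
    by_cases hx : x = u
    · rw [hx, Function.update_self, hus]; simp
    · rw [Function.update_of_ne hx]
  have e' : toSearch τ ex' (Function.update d u e) =
      (toSearch σ ex d).enter u (σ.reg 10) e ex' := by
    simp only [toSearch, Search.enter, m5, m6, m7, m8, h10]
  constructor
  · exact h.env.congr (fun r hr' => hr r (by omega)) (hm 0 (by omega)) (hm 2 (by omega))
      (hm 3 (by omega))
  · rw [e']; exact hS
  · exact m4
  · rw [m5, hm 1 (by omega)]; exact h.stable.congr h2
  · rw [hm 9 (by omega)]; exact h.weights
  · rw [hm 11 (by omega), hr 16 (by omega)]; exact h.stamps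
  · rw [m5, hr 16 (by omega), unfinished_congr h2]; exact h.bound

theorem unfinished_enter {u : ℕ} {st : ℕ → ℕ} (hus : st u = 0) :
    unfinished n N A (Function.update st u 1) = unfinished n N A st := by
  refine unfinished_congr fun x => ?_
  by_cases hx : x = u
  · rw [hx, Function.update_self, hus]; simp
  · rw [Function.update_of_ne hx]

theorem wp_explore (hG : IsCyclic n N) (hW : offset N A n ≤ W)
    (h : RunInv n W N A σ ex d) (hcn : σ.reg 10 < n) (hex : ex (σ.reg 10) < (N (σ.reg 10)).length)
    (h7 : σ.reg 7 = σ.mem 4 (σ.reg 10)) :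
    wp W explore (fun t τ => ∃ ex' d', RunInv n W N A τ ex' d' ∧
      (∀ x, σ.mem 5 x ≠ 0 → τ.mem 5 x ≠ 0) ∧
      t + 5 + potential n N A (τ.mem 5) ex' d' (τ.reg 10) ≤
        potential n N A (σ.mem 5) ex d (σ.reg 10)) σ := by
  have hS := h.search
  have hE := h.env
  have hcur : σ.mem 5 (σ.reg 10) = 1 := hS.cur.resolve_left hcn.ne
  obtain ⟨u, hu⟩ : ∃ u, (N (σ.reg 10))[ex (σ.reg 10)]? = some u := ⟨_, List.getElem?_eq_getElem hex⟩
  have hinp : σ.mem 0 (σ.mem 4 (σ.reg 10)) = u := by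
    rw [h.ptr _ hcn, hE.layout.nbrs _ hcn _ hex]
    rw [List.getElem?_eq_getElem hex] at hu
    exact Option.some.inj hu
  have hb : offset N A (σ.reg 10) + cost N A (σ.reg 10) ≤ W :=
    ((offset_succ N A _).symm.le.trans (offset_mono N A hcn)).trans hW
  have hptr := h.ptr _ hcn
  have hcost : cost N A (σ.reg 10) = (N (σ.reg 10)).length + (A (σ.reg 10)).length + 2 := rfl
  have hsum := sum_explored (N := N) hcn hex
  have hptr' : ∀ x < n, Function.update (σ.mem 4) (σ.reg 10) (σ.mem 4 (σ.reg 10) + 1) x =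
      offset N A x + 1 + Function.update ex (σ.reg 10) (ex (σ.reg 10) + 1) x := by
    intro x hx
    by_cases hxc : x = σ.reg 10
    · rw [hxc, Function.update_self, Function.update_self, hptr]; ring
    · rw [Function.update_of_ne hxc, Function.update_of_ne hxc, h.ptr x hx]
  simp only [explore, wp_seq, wp_load, wp_plus, wp_store, reg_setReg, reg_setMem, mem_setReg,
      mem_setMem,
    Nat.reduceEqDiff, ↓reduceIte, OfNat.one_ne_ofNat, h7, hinp, hE.r1]
  refine ⟨by omega, ?_⟩
  rw [wp_ifLt]
  simp only [reg_setReg, reg_setMem, ↓reduceIte, OfNat.one_ne_ofNat, hE.r1]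
  refine ⟨fun h0 => ?_, fun h0 => ?_⟩
  · have hus : σ.mem 5 u = 0 := by omega
    rw [wp_enterNode (by simp [reg_setReg, reg_setMem, hE.r1])]
    have hS' : ((toSearch σ ex d).enter u (σ.reg 10) (d (σ.reg 10) + 1)
        (Function.update ex (σ.reg 10) (ex (σ.reg 10) + 1))).Inv n N := hS.push hG hcur hu hus
    have hne : u ≠ n := (hG.lt _ u (List.mem_of_getElem? hu)).ne
    refine ⟨Function.update ex (σ.reg 10) (ex (σ.reg 10) + 1),
      Function.update d u (d (σ.reg 10) + 1), h.enter hus hS' ?_ ?_ ?_ ?_ ?_ ?_ ?_ ?_, ?_, ?_⟩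
    · intro r hr
      have h2 : r ≠ 6 := by omega
      have h3 : r ≠ 7 := by omega
      have h4 : r ≠ 8 := by omega
      have h5 : r ≠ 10 := by omega
      simp [reg_setReg, reg_setMem, h2, h3, h4, h5]
    · simp [reg_setReg, reg_setMem]
    · simp [reg_setReg, reg_setMem, mem_setReg, mem_setMem]
    · simp [reg_setReg, reg_setMem, mem_setReg, mem_setMem]
    · simp [reg_setReg, reg_setMem, mem_setReg, mem_setMem]
    · simp [reg_setReg, reg_setMem, mem_setReg, mem_setMem]
    · simpa [reg_setReg, reg_setMem, mem_setReg, mem_setMem] using hptr'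
    · intro a ha
      have h2 : a ≠ 4 := by omega
      have h3 : a ≠ 5 := by omega
      have h4 : a ≠ 6 := by omega
      have h5 : a ≠ 7 := by omega
      have h6 : a ≠ 8 := by omega
      simp [mem_setReg, mem_setMem, h2, h3, h4, h5, h6]
    · intro x hx
      by_cases hxu : x = u
      · simp [reg_setReg, reg_setMem, mem_setReg, mem_setMem, hxu]
      · simpa [reg_setReg, reg_setMem, mem_setReg, mem_setMem, hxu] using hx
    · simp only [reg_setReg, reg_setMem, mem_setReg, mem_setMem, ↓reduceIte, Nat.reduceEqDiff]
      rw [potential, potential, unfinished_enter hus, if_neg hne, if_neg hcn.ne, hsum,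
        Function.update_self]
      omega
  · have hus : σ.mem 5 u ≠ 0 := by omega
    rw [wp_ifLt]
    simp only [reg_setReg, reg_setMem, ↓reduceIte, Nat.reduceEqDiff, hE.r2]
    refine ⟨fun h1 => ?_, fun h1 => ?_⟩
    · have hus : σ.mem 5 u = 1 := by omega
      have hS' := hS.back hG hcur hu hus
      simp only [wp_seq, wp_store, reg_setReg, reg_setMem, mem_setReg, mem_setMem, ↓reduceIte,
        Nat.reduceEqDiff]
      refine ⟨Function.update ex (σ.reg 10) (ex (σ.reg 10) + 1), d,
          ⟨hE.congr (fun r hr => ?_) ?_ ?_ ?_, ?_, ?_, ?_, ?_, ?_, ?_⟩, fun x hx => hx, ?_⟩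
      · have h2 : r ≠ 6 := by omega
        have h3 : r ≠ 7 := by omega
        have h4 : r ≠ 8 := by omega
        simp [reg_setReg, reg_setMem, h2, h3, h4]
      · simp [mem_setReg, mem_setMem]
      · simp [mem_setReg, mem_setMem]
      · simp [mem_setReg, mem_setMem]
      · simpa [toSearch, mem_setReg, mem_setMem, reg_setReg, reg_setMem] using hS'
      · simpa [mem_setReg, mem_setMem] using hptr'
      · simpa [mem_setReg, mem_setMem] using h.stable
      · simpa [mem_setReg, mem_setMem] using h.weights
      · simpa [mem_setReg, mem_setMem, reg_setReg, reg_setMem] using h.stamps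
      · simpa [mem_setReg, mem_setMem, reg_setReg, reg_setMem] using h.bound
      · rw [potential, potential, hsum]
        omega
    · have hus : σ.mem 5 u = 2 := by have : σ.mem 5 u ≤ 2 := hS.st_le u; omega
      have hS' := hS.skip hcur hu hus
      simp only [wp_skip, reg_setReg, reg_setMem, mem_setReg, mem_setMem, ↓reduceIte,
        Nat.reduceEqDiff]
      refine ⟨Function.update ex (σ.reg 10) (ex (σ.reg 10) + 1), d,
          ⟨hE.congr (fun r hr => ?_) ?_ ?_ ?_, ?_, ?_, ?_, ?_, ?_, ?_⟩, fun x hx => hx, ?_⟩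
      · have h2 : r ≠ 6 := by omega
        have h3 : r ≠ 7 := by omega
        have h4 : r ≠ 8 := by omega
        simp [reg_setReg, reg_setMem, h2, h3, h4]
      · simp [mem_setReg, mem_setMem]
      · simp [mem_setReg, mem_setMem]
      · simp [mem_setReg, mem_setMem]
      · simpa [toSearch, mem_setReg, mem_setMem, reg_setReg, reg_setMem] using hS'
      · simpa [mem_setReg, mem_setMem] using hptr'
      · simpa [mem_setReg, mem_setMem] using h.stable
      · simpa [mem_setReg, mem_setMem] using h.weights
      · simpa [mem_setReg, mem_setMem, reg_setReg, reg_setMem] using h.stamps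
      · simpa [mem_setReg, mem_setMem, reg_setReg, reg_setMem] using h.bound
      · rw [potential, potential, hsum]
        omega

theorem wp_goBack (hG : IsCyclic n N)
    (h : RunInv n W N A σ ex d) (hcn : σ.reg 10 < n) (hex : ex (σ.reg 10) = (N (σ.reg 10)).length)
    (hlow : σ.mem 7 (σ.reg 10) ≠ σ.reg 10) (h7 : σ.reg 7 = σ.mem 7 (σ.reg 10))
    (h8 : σ.reg 8 = σ.mem 6 (σ.reg 10)) :
    wp W goBack (fun t τ => RunInv n W N A τ ex d ∧ (∀ x, σ.mem 5 x ≠ 0 → τ.mem 5 x ≠ 0) ∧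
      t + 10 + potential n N A (τ.mem 5) ex d (τ.reg 10) ≤
        potential n N A (σ.mem 5) ex d (σ.reg 10)) σ := by
  have hS := h.search
  have hcur : σ.mem 5 (σ.reg 10) = 1 := hS.cur.resolve_left hcn.ne
  obtain ⟨⟨hpn, hpd⟩, hS'⟩ := hS.retreat hG hcur hex hlow
  have hpn' : σ.mem 6 (σ.reg 10) ≠ n := hpn
  have hpd' : d (σ.reg 10) = d (σ.mem 6 (σ.reg 10)) + 1 := hpd
  simp only [goBack, wp_seq, wp_store, wp_move, reg_setReg, reg_setMem, mem_setReg, mem_setMem,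
    ↓reduceIte, Nat.reduceEqDiff, h7, h8]
  refine ⟨⟨h.env.congr (fun r hr => ?_) ?_ ?_ ?_, ?_, ?_, ?_, ?_, ?_, ?_⟩, fun x hx => hx, ?_⟩
  · have h5 : r ≠ 10 := by omega
    simp [reg_setReg, reg_setMem, h5]
  · simp [mem_setReg, mem_setMem]
  · simp [mem_setReg, mem_setMem]
  · simp [mem_setReg, mem_setMem]
  · simpa [toSearch, mem_setReg, mem_setMem, reg_setReg, reg_setMem] using hS'
  · simpa [mem_setReg, mem_setMem] using h.ptr
  · simpa [mem_setReg, mem_setMem] using h.stable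
  · simpa [mem_setReg, mem_setMem] using h.weights
  · simpa [mem_setReg, mem_setMem, reg_setReg, reg_setMem] using h.stamps
  · simpa [mem_setReg, mem_setMem, reg_setReg, reg_setMem] using h.bound
  · rw [potential, potential, if_neg hcn.ne, if_neg hpn', hpd']
    omega

theorem RunInv.congr {τ : State} (h : RunInv n W N A σ ex d)
    (hr : ∀ r, r < 4 ∨ r = 10 ∨ r = 16 → τ.reg r = σ.reg r) (hm : τ.mem = σ.mem) :
    RunInv n W N A τ ex d := by
  have e : toSearch τ ex d = toSearch σ ex d := by
    simp only [toSearch, hm, hr 10 (by omega)]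
  constructor
  · exact h.env.congr (fun r hr' => hr r (by omega)) (by rw [hm]) (by rw [hm]) (by rw [hm])
  · rw [e]; exact h.search
  · rw [hm]; exact h.ptr
  · rw [hm]; exact h.stable
  · rw [hm]; exact h.weights
  · rw [hm, hr 16 (by omega)]; exact h.stamps
  · rw [hm, hr 16 (by omega)]; exact h.bound

theorem wp_searchStep (hG : IsCyclic n N) (hW : offset N A n ≤ W) (hA : ∀ x < n, A x ≠ [])
    (h : RunInv n W N A σ ex d) (hcn : σ.reg 10 < n) :
    wp W searchStep (fun t τ => ∃ ex' d', RunInv n W N A τ ex' d' ∧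
      (∀ x, σ.mem 5 x ≠ 0 → τ.mem 5 x ≠ 0) ∧
      t + 1 + potential n N A (τ.mem 5) ex' d' (τ.reg 10) ≤
        potential n N A (σ.mem 5) ex d (σ.reg 10)) σ := by
  have hS := h.search
  have hE := h.env
  have hcur : σ.mem 5 (σ.reg 10) = 1 := hS.cur.resolve_left hcn.ne
  have hexle : ex (σ.reg 10) ≤ (N (σ.reg 10)).length := hS.ex_le _
  have hptr := h.ptr _ hcn
  have hna := hE.na _ hcn
  simp only [searchStep, wp_seq, wp_load, wp_ifLt, reg_setReg, mem_setReg, ↓reduceIte,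
      Nat.reduceEqDiff]
  have hI : ∀ a b, RunInv n W N A ((σ.setReg 7 a).setReg 8 b) ex d := fun a b =>
    h.congr (fun r hr => by
      have h1 : r ≠ 7 := by omega
      have h2 : r ≠ 8 := by omega
      simp [reg_setReg, h1, h2]) rfl
  refine ⟨fun hlt => ?_, fun hlt => ?_⟩
  · refine (wp_explore hG hW (hI _ _) ?_ ?_ ?_).mono ?_
    · simpa [reg_setReg] using hcn
    · simp only [reg_setReg, ↓reduceIte, Nat.reduceEqDiff]; omega
    · simp [reg_setReg, mem_setReg]
    · rintro t τ ⟨ex', d', h1, h2, h3⟩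
      refine ⟨ex', d', h1, h2, ?_⟩
      simp only [reg_setReg, mem_setReg, ↓reduceIte, Nat.reduceEqDiff] at h3
      omega
  · have hex : ex (σ.reg 10) = (N (σ.reg 10)).length := by omega
    have hback : ∀ τ : State,
        τ = (((σ.setReg 7 (σ.mem 4 (σ.reg 10))).setReg 8 (σ.mem 3 (σ.reg 10))).setReg 7
          (σ.mem 7 (σ.reg 10))).setReg 8 (σ.mem 6 (σ.reg 10)) →
        RunInv n W N A τ ex d ∧ τ.reg 10 = σ.reg 10 ∧ τ.mem = σ.mem ∧
          τ.reg 7 = σ.mem 7 (σ.reg 10) ∧ τ.reg 8 = σ.mem 6 (σ.reg 10) := by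
      rintro τ rfl
      refine ⟨h.congr (fun r hr => ?_) rfl, by simp [reg_setReg], rfl, by simp [reg_setReg],
        by simp [reg_setReg]⟩
      have h1 : r ≠ 7 := by omega
      have h2 : r ≠ 8 := by omega
      simp [reg_setReg, h1, h2]
    simp only [leave, wp_seq, wp_load, wp_ifLt, reg_setReg, mem_setReg, ↓reduceIte,
        Nat.reduceEqDiff]
    obtain ⟨g1, g2, g3, g4, g5⟩ := hback _ rfl
    have hgb : σ.mem 7 (σ.reg 10) ≠ σ.reg 10 → wp W goBack (fun t τ => RunInv n W N A τ ex d ∧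
        (∀ x, σ.mem 5 x ≠ 0 → τ.mem 5 x ≠ 0) ∧
        t + 10 + potential n N A (τ.mem 5) ex d (τ.reg 10) ≤
          potential n N A (σ.mem 5) ex d (σ.reg 10))
        ((((σ.setReg 7 (σ.mem 4 (σ.reg 10))).setReg 8 (σ.mem 3 (σ.reg 10))).setReg 7
          (σ.mem 7 (σ.reg 10))).setReg 8 (σ.mem 6 (σ.reg 10))) := by
      intro hne
      have := wp_goBack hG g1 (by rwa [g2]) (by rwa [g2]) (by rwa [g2, g3]) (by rw [g2, g3, g4])
        (by rw [g2, g3, g5])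
      rwa [g2, g3] at this
    refine ⟨fun h1 => (hgb (by omega)).mono ?_, fun h1 => ⟨fun h2 => (hgb (by omega)).mono ?_,
      fun h2 => ?_⟩⟩
    · rintro t τ ⟨h1, h2, h3⟩
      exact ⟨ex, d, h1, h2, by omega⟩
    · rintro t τ ⟨h1, h2, h3⟩
      exact ⟨ex, d, h1, h2, by omega⟩
    · have := wp_comp_search hG hW hA g1 (by rwa [g2, g3]) (by rwa [g2])
        (by rw [g2, g3]; omega)
      rw [g2, g3] at this
      refine this.mono ?_
      rintro t τ ⟨h1, h2, h3⟩
      exact ⟨ex, d, h1, h2, by omega⟩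

end

/-- Search until no node is active. -/
def searchLoop : Program := .whileLt 10 3 searchStep

/-- Search from all the nodes that have not been reached before. -/
def searchAll : Program :=
  .whileLt 9 3 (.seq (.load 7 5 9) (.seq (.ifLt 7 1 (.seq (enterNode 9 3) searchLoop) .skip)
    (.plus 9 9 1)))

section

variable {n W : ℕ} {N A : ℕ → List ℕ} {σ : State} {ex d : ℕ → ℕ}

theorem wp_searchLoop (hG : IsCyclic n N) (hW : offset N A n ≤ W) (hA : ∀ x < n, A x ≠ [])
    (h : RunInv n W N A σ ex d) :
    wp W searchLoop (fun t τ => Frame searchStep σ τ ∧ ∃ ex' d', RunInv n W N A τ ex' d' ∧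
      τ.reg 10 = n ∧ (∀ x, σ.mem 5 x ≠ 0 → τ.mem 5 x ≠ 0) ∧
      t + potential n N A (τ.mem 5) ex' d' (τ.reg 10) ≤
        potential n N A (σ.mem 5) ex d (σ.reg 10) + 1) σ := by
  refine (wp_while_frame (fun τ m => ∃ ex' d', RunInv n W N A τ ex' d' ∧
    (∀ x, σ.mem 5 x ≠ 0 → τ.mem 5 x ≠ 0) ∧
    m = potential n N A (τ.mem 5) ex' d' (τ.reg 10)) ⟨ex, d, h, fun _ hx => hx, rfl⟩ ?_).mono ?_
  · rintro τ m - ⟨ex', d', h1, h2, rfl⟩ hlt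
    rw [h1.env.r3] at hlt
    refine (wp_searchStep hG hW hA h1 hlt).mono ?_
    rintro t υ ⟨ex'', d'', h3, h4, h5⟩
    exact ⟨_, ⟨ex'', d'', h3, fun x hx => h4 x (h2 x hx), rfl⟩, h5⟩
  · rintro t τ ⟨hF, m, ⟨ex', d', h1, h2, rfl⟩, hlt, ht⟩
    rw [h1.env.r3] at hlt
    refine ⟨hF, ex', d', h1, ?_, h2, ht⟩
    rcases h1.search.cur with hc | hc
    · exact hc
    · exact absurd (h1.search.lt (τ.reg 10) (show τ.mem 5 (τ.reg 10) ≠ 0 from by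
        rw [show τ.mem 5 (τ.reg 10) = 1 from hc]; simp)) hlt

theorem RunInv.setReg (h : RunInv n W N A σ ex d) {r v : ℕ} (h4 : 4 ≤ r) (h10 : r ≠ 10)
    (h16 : r ≠ 16) : RunInv n W N A (σ.setReg r v) ex d :=
  h.congr (fun r' hr' => by
    rw [reg_setReg, if_neg]
    omega) rfl

/-- Each candidate root has a budget of 40: 20 for the depth term of a newly entered root, the rest
for the loop itself. At the end every node has been reached and none is active, so all are finished.
-/
theorem wp_searchAll (hG : IsCyclic n N) (hW : offset N A n ≤ W) (hnW : n ≤ W)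
    (hA : ∀ x < n, A x ≠ []) (h : RunInv n W N A σ ex d) (h9 : σ.reg 9 = 0) (h10 : σ.reg 10 = n) :
    wp W searchAll (fun t τ => Stable N A (τ.mem 5) (τ.mem 1) ∧ (∀ x, τ.mem 5 x = 2 ↔ x < n) ∧
      t ≤ potential n N A (σ.mem 5) ex d n + 40 * n + 1) σ := by
  refine (wp_while (fun τ m => ∃ ex' d', RunInv n W N A τ ex' d' ∧ τ.reg 10 = n ∧
    τ.reg 9 ≤ n ∧ (∀ x < τ.reg 9, τ.mem 5 x ≠ 0) ∧
    m = potential n N A (τ.mem 5) ex' d' n + 40 * (n - τ.reg 9))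
    ⟨ex, d, h, h10, by omega, by simp [h9], rfl⟩ ?_).mono ?_
  · rintro τ m ⟨ex', d', h1, h2, h3, h4, rfl⟩ hlt
    have hE := h1.env
    rw [hE.r3] at hlt
    simp only [wp_seq, wp_load, wp_ifLt, wp_skip, wp_plus, reg_setReg, mem_setReg, ↓reduceIte,
      OfNat.one_ne_ofNat, Nat.reduceEqDiff, hE.r1]
    refine ⟨fun h0 => ?_, fun h0 => ?_⟩
    · have hus : τ.mem 5 (τ.reg 9) = 0 := by omega
      have hS := h1.search.start (u := τ.reg 9) h2 hlt hus
      rw [wp_enterNode (by simp [reg_setReg, hE.r1])]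
      set υ := ((((((τ.setReg 7 (τ.mem 5 (τ.reg 9))).setMem 5
        ((τ.setReg 7 (τ.mem 5 (τ.reg 9))).reg 9) 1).setMem 6
        ((τ.setReg 7 (τ.mem 5 (τ.reg 9))).reg 9) ((τ.setReg 7 (τ.mem 5 (τ.reg 9))).reg 3)).setMem 7
        ((τ.setReg 7 (τ.mem 5 (τ.reg 9))).reg 9) ((τ.setReg 7 (τ.mem 5 (τ.reg 9))).reg 9)).setMem 8
        ((τ.setReg 7 (τ.mem 5 (τ.reg 9))).reg 9) ((τ.setReg 7 (τ.mem 5 (τ.reg 9))).reg 9)).setReg 10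
        ((τ.setReg 7 (τ.mem 5 (τ.reg 9))).reg 9)) with hυ
      have e9 : υ.reg 9 = τ.reg 9 := by simp [hυ, reg_setReg, reg_setMem]
      have e10 : υ.reg 10 = τ.reg 9 := by simp [hυ, reg_setReg]
      have e5 : υ.mem 5 = Function.update (τ.mem 5) (τ.reg 9) 1 := by
        simp [hυ, reg_setReg, mem_setReg, mem_setMem]
      have hυI : RunInv n W N A υ ex' (Function.update d' (τ.reg 9) 0) := by
        refine h1.enter hus (by rw [h2]; exact hS) (fun r hr => ?_) e10 e5 ?_ ?_ ?_ ?_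
          (fun a ha => ?_)
        · have h2 : r ≠ 7 := by omega
          have h3 : r ≠ 10 := by omega
          simp [hυ, reg_setReg, reg_setMem, h2, h3]
        · simp [hυ, reg_setReg, mem_setReg, mem_setMem, hE.r3, h2]
        · simp [hυ, reg_setReg, mem_setReg, mem_setMem]
        · simp [hυ, reg_setReg, mem_setReg, mem_setMem]
        · simpa [hυ, reg_setReg, mem_setReg, mem_setMem] using h1.ptr
        · have h3 : a ≠ 5 := by omega
          have h4 : a ≠ 6 := by omega
          have h5 : a ≠ 7 := by omega
          have h6 : a ≠ 8 := by omega
          simp [hυ, mem_setReg, mem_setMem, h3, h4, h5, h6]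
      refine (wp_searchLoop hG hW hA hυI).mono ?_
      rintro t ω ⟨hF, ex'', d'', g1, g2, g3, g4⟩
      have f9 : ω.reg 9 = τ.reg 9 := (hF.1 9 (by decide)).trans e9
      rw [f9, g1.env.r1]
      refine ⟨by omega, _, ⟨ex'', d'', g1.setReg (by decide) (by decide) (by decide),
        by simpa [reg_setReg] using g2, by simpa [reg_setReg] using hlt, ?_, rfl⟩, ?_⟩
      · intro x hx
        refine g3 x ?_
        rw [e5]
        by_cases hx9 : x = τ.reg 9
        · simp [hx9]
        · rw [Function.update_of_ne hx9]
          exact h4 x (by omega)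
      · rw [g2, e10, e5] at g4
        have e : potential n N A (Function.update (τ.mem 5) (τ.reg 9) 1) ex'
            (Function.update d' (τ.reg 9) 0) (τ.reg 9) = potential n N A (τ.mem 5) ex' d' n + 20
                := by
          rw [potential, potential, unfinished_enter hus, if_neg hlt.ne, if_pos rfl,
            Function.update_self]
          ring
        omega
    · refine ⟨by omega, _, ⟨ex', d', (h1.setReg (by decide) (by decide) (by decide)).setReg
        (by decide) (by decide) (by decide), by simpa [reg_setReg] using h2,
        by simpa [reg_setReg] using hlt, ?_, rfl⟩, ?_⟩
      · intro x hx
        by_cases hx9 : x = τ.reg 9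
        · rw [hx9]; omega
        · exact h4 x (by omega)
      · omega
  · rintro t τ ⟨m, ⟨ex', d', h1, h2, h3, h4, rfl⟩, hlt, ht⟩
    rw [h1.env.r3] at hlt
    refine ⟨h1.stable, fun x => ⟨fun hx => h1.search.lt x
      (show τ.mem 5 x ≠ 0 by rw [hx]; simp), fun hx => ?_⟩, by omega⟩
    have g1 : τ.mem 5 x ≠ 1 := h1.search.not_active h2 x
    have g2 : τ.mem 5 x ≤ 2 := h1.search.st_le x
    have g3 := h4 x (by omega)
    omega

end

/-! ### Reading the input -/

/-- Read the description of the node in register `9`, which starts at the address in register `4`. -/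
def readNode : Program :=
  .seq (.load 5 0 4) (.seq (.plus 4 4 1) (.seq (.store 2 9 4) (.seq (.store 4 9 4) (.seq (.plus 4
      4 5)
    (.seq (.store 3 9 4) (.seq (.load 5 0 4) (.seq (.plus 4 4 1) (.seq (.plus 4 4 5)
      (.plus 9 9 1)))))))))

/-- Initialize the registers and the arrays of addresses. -/
def readInput : Program :=
  .seq (.setConst 1 1) (.seq (.setConst 2 2) (.seq (.load 3 0 0) (.seq (.move 4 2)
    (.seq (.whileLt 9 3 readNode) (.seq (.move 9 0) (.move 10 3))))))

/-- The whole program. -/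
def solve : Program := .seq readInput searchAll

section

variable {n W : ℕ} {N A : ℕ → List ℕ} {f : ℕ → ℕ}

theorem wp_readInput {input : List ℕ} (hn : input.getD 0 0 = n)
    (hlen : ∀ x < n, input.getD (offset N A x) 0 = (N x).length)
    (hL : Layout n N A (fun i => input.getD i 0)) (hW : offset N A n ≤ W) (hnW : n ≤ W) :
    wp W readInput (fun t τ => RunInv n W N A τ (fun _ => 0) (fun _ => 0) ∧ τ.reg 9 = 0 ∧
      τ.reg 10 = n ∧ τ.mem 5 = (fun _ => 0) ∧ t ≤ 12 * n + 10) (State.init input) := by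
  have hW2 : 2 ≤ W := le_trans (by simp [offset]) hW
  simp only [readInput, wp_seq, wp_setConst, wp_load, wp_move, reg_setReg, mem_setReg, ↓reduceIte,
    Nat.reduceEqDiff, OfNat.zero_ne_ofNat, zero_ne_one]
  refine ⟨by omega, hW2, ?_⟩
  refine (wp_while_frame (m := 11 * n) (fun τ m => τ.reg 9 ≤ n ∧ τ.reg 4 = offset N A (τ.reg 9) ∧
    (∀ x < τ.reg 9, τ.mem 2 x = offset N A x + 1 ∧ τ.mem 4 x = offset N A x + 1 ∧
      τ.mem 3 x = offset N A x + 1 + (N x).length) ∧ m = 11 * (n - τ.reg 9)) ?_ ?_).mono ?_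
  · simp [reg_setReg, State.init, offset]
  · rintro τ m hF ⟨h1, h2, h3, rfl⟩ hlt
    have r1 : τ.reg 1 = 1 := (hF.1 1 (by decide)).trans (by simp [reg_setReg])
    have r3 : τ.reg 3 = n := (hF.1 3 (by decide)).trans (by simp [reg_setReg, State.init, ← hn])
    have m0 : τ.mem 0 = fun i => input.getD i 0 :=
      (hF.2 0 (by decide)).trans (by simp [mem_setReg, State.init])
    rw [r3] at hlt
    have hb : offset N A (τ.reg 9) + cost N A (τ.reg 9) ≤ W :=
      ((offset_succ N A _).symm.le.trans (offset_mono N A hlt)).trans hW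
    rw [cost] at hb
    have g1 : τ.mem 0 (offset N A (τ.reg 9)) = (N (τ.reg 9)).length := by
      rw [m0]; exact hlen _ hlt
    have g2 : τ.mem 0 (offset N A (τ.reg 9) + 1 + (N (τ.reg 9)).length) = (A (τ.reg 9)).length := by
      rw [m0]; exact hL.ncols _ hlt
    simp only [readNode, wp_seq, wp_load, wp_plus, wp_store, reg_setReg, mem_setReg, reg_setMem,
        mem_setMem,
      ↓reduceIte, Nat.reduceEqDiff, OfNat.one_ne_ofNat, OfNat.zero_ne_ofNat, h2, r1, g1, g2]
    refine ⟨by omega, by omega, by omega, by omega, by omega, _, ⟨by omega, ?_, ?_, rfl⟩, by omega⟩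
    · rw [offset_succ, cost]; omega
    · intro x hx
      by_cases hx9 : x = τ.reg 9
      · simp [hx9]
      · simp only [Function.update_of_ne hx9]
        exact h3 x (by omega)
  · rintro t τ ⟨hF, m, ⟨h1, h2, h3, rfl⟩, hlt, ht⟩
    have r0 : τ.reg 0 = 0 := (hF.1 0 (by decide)).trans (by simp [reg_setReg, State.init])
    have r1 : τ.reg 1 = 1 := (hF.1 1 (by decide)).trans (by simp [reg_setReg])
    have r2 : τ.reg 2 = 2 := (hF.1 2 (by decide)).trans (by simp [reg_setReg])
    have r3 : τ.reg 3 = n := (hF.1 3 (by decide)).trans (by simp [reg_setReg, State.init, ← hn])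
    have r16 : τ.reg 16 = 0 := (hF.1 16 (by decide)).trans (by simp [reg_setReg, State.init])
    have m0 : τ.mem 0 = fun i => input.getD i 0 :=
      (hF.2 0 (by decide)).trans (by simp [mem_setReg, State.init])
    have m5 : τ.mem 5 = fun _ => 0 := (hF.2 5 (by decide)).trans (by simp [mem_setReg, State.init])
    have m9 : τ.mem 9 = fun _ => 0 := (hF.2 9 (by decide)).trans (by simp [mem_setReg, State.init])
    have m11 : τ.mem 11 = fun _ => 0 :=
      (hF.2 11 (by decide)).trans (by simp [mem_setReg, State.init])
    have h9 : τ.reg 9 = n := by omega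
    rw [h9] at h3
    refine ⟨⟨⟨?_, ?_, ?_, ?_, ?_, ?_, ?_⟩, ?_, ?_, ?_, ?_, ?_, ?_⟩, ?_, ?_, ?_, ?_⟩
    · simp [reg_setReg, r0]
    · simp [reg_setReg, r1]
    · simp [reg_setReg, r2]
    · simp [reg_setReg, r3]
    · rw [mem_setReg, mem_setReg, m0]; exact hL
    · exact fun x hx => (h3 x hx).1
    · exact fun x hx => (h3 x hx).2.2
    · constructor <;> simp [toSearch, mem_setReg, reg_setReg, m5, r3]
    · exact fun x hx => (h3 x hx).2.1
    · simp [Stable, mem_setReg, m5]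
    · rw [mem_setReg, mem_setReg, m9]
    · simp [mem_setReg, m11]
    -- At the start the total cost is the input length minus 2 and no stamp has been used.
    · have : unfinished n N A (fun _ => 0) ≤ offset N A n := by simp [unfinished, offset]
      simp only [mem_setReg, reg_setReg, m5, Nat.reduceEqDiff, ↓reduceIte, r16]
      omega
    · exact r0
    · exact r3
    · exact m5
    · omega

theorem wp_solve {input : List ℕ} (hG : IsCyclic n N) (hA : ∀ x < n, A x ≠ [])
    (hn : input.getD 0 0 = n)
    (hlen : ∀ x < n, input.getD (offset N A x) 0 = (N x).length)
    (hL : Layout n N A (fun i => input.getD i 0)) (hW : offset N A n ≤ W) :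
    wp W solve (fun t τ => Stable N A (fun x => if x < n then 2 else 0) (τ.mem 1) ∧
      t ≤ 200 * offset N A n) (State.init input) := by
  have hcost : ∀ x, 2 + (N x).length ≤ cost N A x := fun x => by rw [cost]; omega
  have hsum : 2 * n + ∑ x ∈ Finset.range n, (N x).length ≤ ∑ x ∈ Finset.range n, cost N A x := by
    have := Finset.sum_le_sum fun x (_ : x ∈ Finset.range n) => hcost x
    rw [Finset.sum_add_distrib] at this
    simpa [mul_comm] using this
  have hoff : offset N A n = 2 + ∑ x ∈ Finset.range n, cost N A x := rfl
  rw [solve, wp_seq]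
  refine (wp_readInput hn hlen hL hW (by omega)).mono ?_
  rintro t τ ⟨h1, h2, h3, h4, h5⟩
  refine (wp_searchAll hG hW (by omega) hA h1 h2 h3).mono ?_
  rintro u υ ⟨g1, g2, g3⟩
  refine ⟨?_, ?_⟩
  · refine g1.congr fun x => ?_
    rw [g2]
    simp
  · have : potential n N A (τ.mem 5) (fun _ => 0) (fun _ => 0) n =
        40 * (∑ x ∈ Finset.range n, (N x).length) + 100 * ∑ x ∈ Finset.range n, cost N A x := by
      simp [potential, unfinished, h4]
    omega

end

/-! ### The layout of the input -/

/-- The description of a node in the input. -/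
def block (N A : ℕ → List ℕ) (x : ℕ) : List ℕ :=
  ((N x).length :: N x) ++ ((A x).length :: A x)

theorem length_block (N A : ℕ → List ℕ) (x : ℕ) : (block N A x).length = cost N A x := by
  simp [block, cost]; omega

theorem length_blocks (N A : ℕ → List ℕ) (n : ℕ) :
    ((List.range n).map (block N A)).flatten.length = ∑ x ∈ Finset.range n, cost N A x := by
  induction n with
  | zero => simp
  | succ n ih =>
    rw [List.range_succ, List.map_append, List.flatten_append, List.length_append, ih,
      Finset.sum_range_succ]
    simp [length_block]

theorem getD_blocks (N A : ℕ → List ℕ) (a b : ℕ) {n x j : ℕ} (hx : x < n)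
    (hj : j < (block N A x).length) :
    (a :: b :: ((List.range n).map (block N A)).flatten).getD (offset N A x + j) 0 =
      (block N A x)[j] := by
  obtain ⟨m, rfl⟩ : ∃ m, n = x + 1 + m := ⟨n - (x + 1), by omega⟩
  have e : (a :: b :: ((List.range (x + 1 + m)).map (block N A)).flatten) =
      (a :: b :: ((List.range x).map (block N A)).flatten) ++ (block N A x ++
        (((List.range m).map (fun y => x + 1 + y)).map (block N A)).flatten) := by
    rw [List.range_add, List.range_succ]
    simp
  have hl : (a :: b :: ((List.range x).map (block N A)).flatten).length = offset N A x := by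
    rw [offset, List.length_cons, List.length_cons, length_blocks]; ring
  rw [e, List.getD_append_right _ _ _ _ (by omega), hl, Nat.add_sub_cancel_left,
    List.getD_append _ _ _ _ hj, List.getD_eq_getElem _ _ hj]

theorem getD_offset (N A : ℕ → List ℕ) (a b : ℕ) {n x : ℕ} (hx : x < n) :
    (a :: b :: ((List.range n).map (block N A)).flatten).getD (offset N A x) 0 =
      (N x).length :=
  getD_blocks N A a b (j := 0) hx (by simp [block])

theorem layout_blocks (N A : ℕ → List ℕ) (a b n : ℕ) :
    Layout n N A (fun i => (a :: b :: ((List.range n).map (block N A)).flatten).getD i 0) where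
  nbrs x hx j hj := by
    simp only [add_assoc]
    rw [getD_blocks N A a b hx (by simp [block]; omega)]
    simp [block, add_comm 1 j, List.getElem_append_left, hj]
  ncols x hx := by
    simp only [add_assoc]
    rw [getD_blocks N A a b hx (by simp [block]; omega)]
    simp [block, add_comm 1, List.getElem_append_right]
  cols x hx j hj := by
    simp only [colAddr, add_assoc]
    rw [getD_blocks N A a b hx (by simp [block]; omega)]
    rw [List.getElem_of_eq (show block N A x = ((N x).length :: N x ++ [(A x).length]) ++ A x by
      simp [block]), List.getElem_append_right (by simp; omega)]
    congr 1
    simp; omega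

/-! ### From games to lists -/

section

variable {n m : ℕ}

/-- Lists indexed by the elements of `Fin n`, as lists of numbers indexed by numbers. -/
def toLists (l : Fin n → List (Fin m)) (x : ℕ) : List ℕ :=
  if h : x < n then (l ⟨x, h⟩).map Fin.val else []

theorem toLists_val (l : Fin n → List (Fin m)) (i : Fin n) :
    toLists l i = (l i).map Fin.val := by
  simp [toLists]

theorem mem_toLists {l : Fin n → List (Fin m)} {x u : ℕ} :
    u ∈ toLists l x ↔ ∃ (i : Fin n) (j : Fin m), (i : ℕ) = x ∧ (j : ℕ) = u ∧ j ∈ l i := by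
  constructor
  · intro h
    rw [toLists] at h
    split_ifs at h with hx
    · obtain ⟨j, hj, rfl⟩ := List.mem_map.1 h
      exact ⟨⟨x, hx⟩, j, rfl, rfl, hj⟩
    · simp at h
  · rintro ⟨i, j, rfl, rfl, h⟩
    rw [toLists_val]
    exact List.mem_map_of_mem h

theorem nodup_toLists {l : Fin n → List (Fin m)} (hl : ∀ i, (l i).Nodup) (x : ℕ) :
    (toLists l x).Nodup := by
  rw [toLists]
  split_ifs
  · exact (hl _).map Fin.val_injective
  · exact List.nodup_nil

end

theorem encodeGame_eq {n C : ℕ} (nbrs : Fin n → List (Fin n)) (cols : Fin n → List (Fin C)) :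
    encodeGame nbrs cols =
      n :: C :: ((List.range n).map (block (toLists nbrs) (toLists cols))).flatten := by
  rw [encodeGame]
  congr 3
  refine List.ext_getElem (by simp) fun i h1 h2 => ?_
  have hi : i < n := by simpa using h1
  have e : ∀ {m : ℕ} (l : List (Fin m)), l.flatMap (fun u : Fin m => [u.val]) = l.map Fin.val :=
    fun l => List.map_eq_flatMap.symm
  simp [block, encodeList, toLists, hi, e]
  rfl

theorem length_encodeGame {n C : ℕ} (nbrs : Fin n → List (Fin n)) (cols : Fin n → List (Fin C)) :
    (encodeGame nbrs cols).length = offset (toLists nbrs) (toLists cols) n := by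
  rw [encodeGame_eq, List.length_cons, List.length_cons, length_blocks, offset]
  ring

section

variable {n C : ℕ} {G : CoordinationGame (Fin n) (Fin C)} {nbrs : Fin n → List (Fin n)}
  {cols : Fin n → List (Fin C)}

/-- Neighbours are sources of incoming edges, so reachability is reversed. -/
theorem reach_adj (hrep : G.IsRepresentedBy nbrs cols) {a b : Fin n}
    (h : Reach (toLists nbrs) a b) : Relation.ReflTransGen G.graph.Adj b a := by
  suffices H : ∀ y : ℕ, Reach (toLists nbrs) a y →
      ∀ b : Fin n, (b : ℕ) = y → Relation.ReflTransGen G.graph.Adj b a from H b h b rfl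
  intro y hy
  induction hy with
  | refl =>
    intro b hb
    rw [Fin.ext hb]
  | tail _ hyz ih =>
    intro b hb
    obtain ⟨i, j, rfl, rfl, hj⟩ := mem_toLists.1 hyz
    rw [Fin.ext hb]
    exact .head ((hrep.mem_nbrs i j).1 hj) (ih i rfl)

/-- On a simple cycle an edge from `a` to `b` forces `b = a + 1`, so predecessors within a component
are unique; a component with one node leaves no choice at all. -/
theorem isCyclic_toLists (hrep : G.IsRepresentedBy nbrs cols) (hG : G.graph.SCCsAreSimpleCycles) :
    IsCyclic n (toLists nbrs) where
  nodup := nodup_toLists hrep.nbrs_nodup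
  lt x u hu := by
    obtain ⟨i, j, rfl, rfl, -⟩ := mem_toLists.1 hu
    exact j.isLt
  self x hx := by
    obtain ⟨i, j, rfl, hj, h⟩ := mem_toLists.1 hx
    rw [Fin.ext hj] at h
    exact G.loopless i ((hrep.mem_nbrs i i).1 h)
  unique v u u' hu hu' h h' := by
    obtain ⟨i, j, rfl, rfl, hj⟩ := mem_toLists.1 hu
    obtain ⟨i', j', hi, rfl, hj'⟩ := mem_toLists.1 hu'
    obtain rfl := Fin.ext hi
    have h1 := (hrep.mem_nbrs _ _).1 hj
    have h2 := (hrep.mem_nbrs _ _).1 hj'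
    have h3 := reach_adj hrep h
    have h4 := reach_adj hrep h'
    have hj1 : j ∈ {x | Relation.ReflTransGen G.graph.Adj i' x ∧
        Relation.ReflTransGen G.graph.Adj x i'} := ⟨h3, .single h1⟩
    have hj2 : j' ∈ {x | Relation.ReflTransGen G.graph.Adj i' x ∧
        Relation.ReflTransGen G.graph.Adj x i'} := ⟨h4, .single h2⟩
    have hi1 : i' ∈ {x | Relation.ReflTransGen G.graph.Adj i' x ∧
        Relation.ReflTransGen G.graph.Adj x i'} := ⟨.refl, .refl⟩
    rcases hG _ ⟨i', rfl⟩ with ⟨k, hk⟩ | ⟨m, y, hy, hr, hadj⟩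
    · rw [hk] at hj1 hj2
      rw [hj1, hj2]
    · rw [← hr] at hj1 hj2 hi1
      obtain ⟨a, rfl⟩ := hj1
      obtain ⟨a', rfl⟩ := hj2
      obtain ⟨b, rfl⟩ := hi1
      have e : a + 1 = a' + 1 := ((hadj _ _).1 h1).symm.trans ((hadj _ _).1 h2)
      rw [add_right_cancel e]

theorem payoff_toLists (hrep : G.IsRepresentedBy nbrs cols) (s : G.toStrategicGame.JointStrategy)
    {q : ℕ → ℕ} (hq : ∀ i : Fin n, q i = ((s i).1 : Fin C)) (i : Fin n) :
    G.toStrategicGame.payoff i s = payoff (toLists nbrs) q i := by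
  have e : {j : Fin n | G.graph.Adj j i ∧ ((s j).1 : Fin C) = (s i).1} =
      (((nbrs i).filter (fun j : Fin n => decide (q j.val = q i.val))).toFinset : Set (Fin n)) := by
    ext j
    simp [hrep.mem_nbrs, hq, Fin.ext_iff]
  change ((Set.ncard {j : Fin n | G.graph.Adj j i ∧ ((s j).1 : Fin C) = (s i).1} : ℕ) : ℝ) = _
  rw [e, Set.ncard_coe_finset, List.toFinset_card_of_nodup ((hrep.nbrs_nodup i).filter _), payoff,
    toLists_val, List.countP_map, List.countP_eq_length_filter]
  rfl

/-- When all nodes are finished, the restricted game is the whole game, and a deviating coalition is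
exactly the set where the two colourings differ. -/
theorem isStrongEquilibrium_of_stable (hrep : G.IsRepresentedBy nbrs cols)
    (s : G.toStrategicGame.JointStrategy) {q : ℕ → ℕ} (hq : ∀ i : Fin n, q i = ((s i).1 : Fin C))
    (h : Stable (toLists nbrs) (toLists cols) (fun x => if x < n then 2 else 0) q) :
    G.toStrategicGame.IsStrongEquilibrium s := by
  rintro K ⟨i, hi⟩ - ⟨s', hdev, hgain⟩
  have hq' : ∀ i : Fin n, (fun x => if h : x < n then ((s' ⟨x, h⟩).1 : Fin C).val else 0) i.val =
      ((s' i).1 : Fin C) := fun i => by simp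
  set q' : ℕ → ℕ := fun x => if h : x < n then ((s' ⟨x, h⟩).1 : Fin C).val else 0
  have hlt : ∀ x, (if x < n then 2 else 0) = 2 → x < n := fun x hx => by
    by_contra hc
    simp [hc] at hx
  have hne : ∀ j : Fin n, q' j ≠ q j ↔ j ∈ K := fun j => by
    rw [hdev j, hq', hq, ne_comm, not_iff_not, ← Fin.ext_iff]
    exact Subtype.ext_iff.symm
  obtain ⟨x, hx, hxq, hp⟩ := h.2 q' (fun x hx => by
      have := hlt x hx
      rw [show x = (⟨x, this⟩ : Fin n).val from rfl, hq']
      exact mem_toLists.2 ⟨_, _, rfl, rfl, (hrep.mem_cols _ _).2 (s' _).2⟩)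
    ⟨i, by simp, (hne i).2 hi⟩
  have hxn := hlt x hx
  have := hgain ⟨x, hxn⟩ ((hne ⟨x, hxn⟩).1 hxq)
  rw [payoff_toLists hrep s hq, payoff_toLists hrep s' hq', Nat.cast_lt] at this
  exact absurd hp (not_le.2 this)

end

end SCCAlg

theorem mainTheorem10 :
    ∃ (p : WordRAM.Program) (c k : ℕ),
      ∀ (n C : ℕ) (G : CoordinationGame (Fin n) (Fin C)), G.graph.SCCsAreSimpleCycles →
      ∀ (nbrs : Fin n → List (Fin n)) (cols : Fin n → List (Fin C)),
        G.IsRepresentedBy nbrs cols →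
        ∃ (t : ℕ) (τ : WordRAM.State) (s : G.toStrategicGame.JointStrategy),
          WordRAM.Run (k * ((encodeGame nbrs cols).length + C)) p
            (WordRAM.State.init (encodeGame nbrs cols)) t τ ∧
          t ≤ c * (encodeGame nbrs cols).length ∧
          G.toStrategicGame.IsStrongEquilibrium s ∧
          ∀ i : Fin n, τ.mem 1 (i : ℕ) = ((s i).1 : ℕ) := by
  -- The word bound needs no factor, since all addresses, counters and stamps produced are at most
  -- the input length.
  refine ⟨SCCAlg.solve, 200, 1, fun n C G hG nbrs cols hrep => ?_⟩
  have hA : ∀ x < n, SCCAlg.toLists cols x ≠ [] := fun x hx => by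
    obtain ⟨c, hc⟩ := G.colours_nonempty ⟨x, hx⟩
    exact List.ne_nil_of_mem (SCCAlg.mem_toLists.2 ⟨⟨x, hx⟩, c, rfl, rfl, (hrep.mem_cols _ _).2 hc⟩)
  obtain ⟨t, τ, hrun, hst, ht⟩ := SCCAlg.wp_solve (W := 1 * ((encodeGame nbrs cols).length + C))
    (input := encodeGame nbrs cols) (SCCAlg.isCyclic_toLists hrep hG) hA rfl
    (fun x hx => by rw [SCCAlg.encodeGame_eq]; exact SCCAlg.getD_offset _ _ _ _ hx)
    (by rw [SCCAlg.encodeGame_eq]; exact SCCAlg.layout_blocks _ _ _ _ _)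
    (by rw [SCCAlg.length_encodeGame]; omega)
  -- Stability includes that the words in array 1 are admissible colours, so they can be read as a
  -- joint strategy.
  have hcol : ∀ i : Fin n, ∃ c : Fin C, (c : ℕ) = τ.mem 1 i ∧ c ∈ G.colours i := fun i => by
    obtain ⟨j, c, hj, hc, hmem⟩ := SCCAlg.mem_toLists.1 (hst.1 i (by simp))
    obtain rfl := Fin.ext hj
    exact ⟨c, hc, (hrep.mem_cols _ _).1 hmem⟩
  choose col hcol1 hcol2 using hcol
  refine ⟨t, τ, fun i => ⟨col i, hcol2 i⟩, hrun, by rwa [SCCAlg.length_encodeGame],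
    SCCAlg.isStrongEquilibrium_of_stable hrep _ (fun i => (hcol1 i).symm) hst,
        fun i => (hcol1 i).symm⟩
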